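/- **Conventions.** Graphs are finite and undirected; loops and multiple edges are allowed unless the graph is called simple, and every edge $e$ of a base graph carries a fixed orientation $o(e)=(v,v')$. For a graph $\Gamma$, a finite group $G$ and a map $\gamma\colon E(\Gamma)\to G$, the *$G$-lift* $\hat\Gamma$ has vertices $\hat v_g=(v,g)$ and edges $\hat e_g=(e,g)$ ($g\in G$), where $\hat e_g$ connects $\hat v_g$ and $\hat v'_{\gamma(e)g}$ if $o(e)=(v,v')$. A graph is *$(a,\lambda)$-edge-expanding* if for all sets $S,T$ of vertices with $|S|,|T|\le a$ we have $|E(S,T)|\le\lambda\sqrt{|S||T|}$, where $E(S,T)$ is the set of triples $(s,e,t)$ with $s\in S$, $t\in T$ such that the edge $e$ connects $s$ and $t$. Let $h\in\mathbb F_q^{r\times w}$. The class $\mathfrak T_G(\hat\Gamma;h)$ of *$G$-lifted Tanner codes* consists of the two-term complexes $\mathcal A=(\mathbb F_qE(\Gamma)\otimes\mathbb F_qG\to\mathbb F_q^rV(\Gamma)\otimes\mathbb F_qG)$ of right $\mathbb F_qG$-modules with $$\partial(e\otimes g)=\partial^{(v)}e\otimes g+\partial^{(v')}e\otimes\gamma(e)g,\qquad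 o(e)=(v,v'),$$ where for each vertex $v$ of $\Gamma$, $\partial^{(v)}\colon\mathbb F_qE_v\to\mathbb F_q^r v$ is a linear map on the span of the edges incident to $v$ whose matrix is obtained from $h$ by permuting rows and columns. The dual complex $\mathcal B^*$ (transposed boundary map) is a complex of left $\mathbb F_qG$-modules. Put $\mathcal A\otimes_G\mathcal B^*:=\mathcal A\otimes_{\mathbb F_qG}\mathcal B^*$, the tensor product complex with terms in degrees $2,1,0$ and boundary map $\partial(a\otimes b)=\partial a\otimes b+(-1)^i a\otimes\partial b$ for $a\in\mathcal A_i$. It is decomposed into blocks indexed by the cells $x\cdot g\cdot y$ with $g\in G$ and $x,y\in V(\Gamma)\cup E(\Gamma)$: the 2-cells have $x\in E(\Gamma)$, $y\in V(\Gamma)$; the 1-cells have $x,y\in E(\Gamma)$ or $x,y\in V(\Gamma)$; the 0-cells have $x\in V(\Gamma)$, $y\in E(\Gamma)$. For $\mathcal B\in\mathfrak T_G(\hat\Gamma;h')$, $h'\in\mathbb F_q^{r'\times w}$, the block of $x\cdot g\cdot y$ is $\mathcal F_x\otimes\mathcal F'_y$ with $\mathcal F_e=\mathcal F'_e=\mathbb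 F_q$ for edges and $\mathcal F_v=\mathbb F_q^r$, $\mathcal F'_v=\mathbb F_q^{r'}$ for vertices. Write $|c|$ for the number of non-zero blocks of a chain $c$. A 1-chain $c$ is *locally minimal* if $|c+\partial u|\ge|c|$ for every 2-chain $u$ supported on a single 2-cell, and $d_{\mathrm{LM}}^{(1)}$ of the complex is the minimum of $|c|$ over the non-zero locally minimal 1-cycles $c$ (and $\infty$ if there are none). **Proposition.** Let $\mathbb F_q$ be a finite field, $(\rho_0,\rho_1)$ and $(\rho_0',\rho_1')$ non-empty open intervals contained in $(0,1)$, $\mu>0$ a real number, and $W\subseteq\mathbb N$ an infinite set. Then there is $w_0$ such that for every $w\in W$ with $w\ge w_0$ there exist $r,r'\in\mathbb N$ and matrices $h\in\mathbb F_q^{r\times w}$, $h'\in\mathbb F_q^{r'\times w}$ with $r/w\in(\rho_0,\rho_1)$ and $r'/w\in(\rho_0',\rho_1')$ such that the following holds. For every finite group $G$, every real number $a$, every $G$-lift $\hat\Gamma$ of a finite graph that is $w$-regular, simple and $(a,\mu\sqrt w)$-edge-expanding, and all $\mathcal A\in\mathfrak T_G(\hat\Gamma;h)$ and $\mathcal B\in\mathfrak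 T_G(\hat\Gamma;h')$, $$d_{\mathrm{LM}}^{(1)}(\mathcal A\otimes_G\mathcal B^*)\ge\frac{a}{2w}\qquad\text{and}\qquad d_{\mathrm{LM}}^{(1)}(\mathcal B\otimes_G\mathcal A^*)\ge\frac{a}{2w}.$$ -/

import Mathlib

open scoped ENNReal

/-! ## Finite multigraphs, voltage lifts, edge expansion -/

/-- An undirected multigraph (loops and multiple edges allowed) with vertex set `V` and edge
set `E`, together with a fixed orientation `e ↦ (src e, tgt e)` of its edges.  The edge `e`
connects `src e` and `tgt e`; the orientation is used only to define lifts. -/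
structure OrientedGraph (V E : Type*) where
  src : E → V
  tgt : E → V

namespace OrientedGraph

variable {V E : Type*} (Γ : OrientedGraph V E)

/-- The unordered pair of end points of an edge. -/
def ends (e : E) : Sym2 V := s(Γ.src e, Γ.tgt e)

/-- `v ↔ₑ v'`: the edge `e` connects `v` and `v'`. -/
def Connects (e : E) (v v' : V) : Prop := Γ.ends e = s(v, v')

/-- The edge `e` is incident to the vertex `v`. -/
def Inc (e : E) (v : V) : Prop := v ∈ Γ.ends e

/-- The set `E_v` of edges incident to `v`. -/
abbrev Star (v : V) : Type _ := {e : E // Γ.Inc e v}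

theorem src_inc (e : E) : Γ.Inc e (Γ.src e) := Sym2.mem_mk_left _ _

theorem tgt_inc (e : E) : Γ.Inc e (Γ.tgt e) := Sym2.mem_mk_right _ _

/-- The degree of a vertex (a loop contributes `2`). -/
noncomputable def degree (v : V) : ℕ := {e | Γ.src e = v}.ncard + {e | Γ.tgt e = v}.ncard

/-- All vertices have degree `w`. -/
def IsRegular (w : ℕ) : Prop := ∀ v, Γ.degree v = w

/-- No loops and no multiple edges. -/
def IsSimple : Prop := (∀ e, Γ.src e ≠ Γ.tgt e) ∧ Function.Injective Γ.ends

/-- The set `E(S, T)` of oriented edges from `S` to `T`: the triples `(s, e, t)` with `s ∈ S`,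
`t ∈ T` and `s ↔ₑ t`. -/
def edgesBetween (S T : Set V) : Set (V × E × V) :=
  {p | p.1 ∈ S ∧ p.2.2 ∈ T ∧ Γ.Connects p.2.1 p.1 p.2.2}

/-- `(a, lam)`-edge-expansion: `|E(S, T)| ≤ lam √(|S| |T|)` whenever `|S|, |T| ≤ a`. -/
def IsEdgeExpanding (a lam : ℝ) : Prop :=
  ∀ S T : Set V, (S.ncard : ℝ) ≤ a → (T.ncard : ℝ) ≤ a →
    ((Γ.edgesBetween S T).ncard : ℝ) ≤ lam * √((S.ncard : ℝ) * (T.ncard : ℝ))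

/-- The `G`-lift (left derived graph) of `Γ` for the voltage assignment `γ : E → G`: if `e` is
oriented from `v` to `v'`, then `(e, g)` connects `(v, g)` and `(v', γ e * g)`. -/
def lift {G : Type*} [Group G] (γ : E → G) : OrientedGraph (V × G) (E × G) where
  src := fun p => (Γ.src p.1, p.2)
  tgt := fun p => (Γ.tgt p.1, γ p.1 * p.2)

end OrientedGraph

/-! ## Based chain complexes with local coefficients, local minimality

For a finite set `X` of cells whose local coefficient space at `x` is `F^(κ x)`, the space of
chains is `⨁ₓ F^(κ x)`. -/

/-- Chains `∑ₓ aₓ x` with `aₓ ∈ F^(κ x)`. -/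
abbrev LocalChain (F : Type*) {X : Type*} (κ : X → Type*) : Type _ := (x : X) → κ x → F

/-- The block weight: the number of cells `x` with `cₓ ≠ 0`. -/
noncomputable def blockWeight {F X : Type*} [Field F] {κ : X → Type*} (c : LocalChain F κ) : ℕ :=
  {x | c x ≠ 0}.ncard

/-- Chains on a disjoint union of two sets of cells are pairs of chains. -/
def LocalChain.sumEquiv (F : Type*) [Field F] {X Y : Type*}
    (κ : X → Type) (κ' : Y → Type) :
    (LocalChain F κ × LocalChain F κ') ≃ₗ[F] LocalChain F (Sum.elim κ κ') where
  toFun := fun p z => match z with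
    | .inl x => p.1 x
    | .inr y => p.2 y
  map_add' p q := by
    funext z
    cases z <;> rfl
  map_smul' t p := by
    funext z
    cases z <;> rfl
  invFun := fun c => (fun x => c (.inl x), fun y => c (.inr y))
  left_inv _ := rfl
  right_inv c := by
    funext z
    cases z <;> rfl

/-- Three consecutive terms `C₂ → C₁ → C₀` of a based chain complex with local coefficients. -/
structure LocalComplex (F : Type*) [Field F] {X₂ X₁ X₀ : Type*}
    (κ₂ : X₂ → Type*) (κ₁ : X₁ → Type*) (κ₀ : X₀ → Type*) where
  bd₂ : LocalChain F κ₂ →ₗ[F] LocalChain F κ₁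
  bd₁ : LocalChain F κ₁ →ₗ[F] LocalChain F κ₀
  bd_bd : ∀ c, bd₁ (bd₂ c) = 0

namespace LocalComplex

variable {F : Type*} [Field F] {X₂ X₁ X₀ : Type*}
  {κ₂ : X₂ → Type*} {κ₁ : X₁ → Type*} {κ₀ : X₀ → Type*} (C : LocalComplex F κ₂ κ₁ κ₀)

open Classical in
/-- A 1-chain `c` is locally minimal if `|c + ∂(a x)| ≥ |c|` for every 2-cell `x` and every
local coefficient `a` of `x`. -/
def IsLocallyMinimal (c : LocalChain F κ₁) : Prop :=
  ∀ (x : X₂) (a : κ₂ x → F), blockWeight c ≤ blockWeight (c + C.bd₂ (Pi.single x a))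

/-- The 1-st locally minimal distance: the minimal block weight of a non-zero locally minimal
1-cycle, and `⊤` if there is none. -/
noncomputable def locallyMinimalDistance : ℕ∞ :=
  ⨅ c ∈ {c : LocalChain F κ₁ | C.bd₁ c = 0 ∧ c ≠ 0 ∧ C.IsLocallyMinimal c}, (blockWeight c : ℕ∞)

end LocalComplex

/-! ## Two-term complexes of based free modules over a group algebra, and their lifted product

Write `R = F[G]`. A cell `x ∈ Xᵢ` carries the free module `R^(κᵢ)`. -/

/-- A two-term complex `R^(X₁ × κ₁) → R^(X₀ × κ₀)` of based free *right* `F[G]`-modules; the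
`F[G]`-linear boundary map sends the basis element `x` to `∑ x', x' · mat x' x`. -/
structure RightComplex (F G X₁ κ₁ X₀ κ₀ : Type*) [Field F] [Group G] where
  mat : Matrix (X₀ × κ₀) (X₁ × κ₁) (MonoidAlgebra F G)

/-- A two-term complex `R^(Y₁ × ι₁) → R^(Y₀ × ι₀)` of based free *left* `F[G]`-modules; the
`F[G]`-linear boundary map sends the basis element `y` to `∑ y', mat y y' · y'`. -/
structure LeftComplex (F G Y₁ ι₁ Y₀ ι₀ : Type*) [Field F] [Group G] where
  mat : Matrix (Y₁ × ι₁) (Y₀ × ι₀) (MonoidAlgebra F G)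

section Dual

variable {F G X₁ κ₁ X₀ κ₀ : Type*} [Field F] [Group G]

/-- The matrix over `F` of the boundary map of a right complex in the `F`-bases `x · g`. -/
noncomputable def RightComplex.matF (A : RightComplex F G X₁ κ₁ X₀ κ₀) :
    Matrix ((X₀ × κ₀) × G) ((X₁ × κ₁) × G) F :=
  fun p q => (A.mat p.1 q.1 * MonoidAlgebra.single q.2 1).coeff p.2

/-- The matrix over `F` of the boundary map of a left complex in the `F`-bases `g⁻¹ · y`, indexed
by the pairs `(y, g)`. -/
noncomputable def LeftComplex.matF (B : LeftComplex F G X₁ κ₁ X₀ κ₀) :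
    Matrix ((X₀ × κ₀) × G) ((X₁ × κ₁) × G) F :=
  fun p q => (MonoidAlgebra.single q.2⁻¹ 1 * B.mat q.1 p.1).coeff p.2⁻¹

/-- The dual complex `Hom(A₀, F) → Hom(A₁, F)`, with `G` acting from the left by
`(g f)(a) = f (a g)`.  For this action the functional dual to the `F`-basis element `x · g` is
`g⁻¹ · x*`, with `x*` dual to `x · 1`; the `x*` form an `F[G]`-basis, in which the boundary map,
the transpose of that of `A`, has the entries of `A.mat` (see `RightComplex.matF_dual`). -/
def RightComplex.dual (A : RightComplex F G X₁ κ₁ X₀ κ₀) : LeftComplex F G X₀ κ₀ X₁ κ₁ :=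
  ⟨A.mat⟩

theorem RightComplex.matF_dual (A : RightComplex F G X₁ κ₁ X₀ κ₀) :
    A.dual.matF = A.matF.transpose := by
  ext p q
  simp [LeftComplex.matF, RightComplex.matF, RightComplex.dual]

end Dual

section LiftedProduct

variable {F G : Type*} [Field F] [Group G] [Fintype G]

/-- The map `∂ ⊗_G id`.  The triple `(x, g, y)` stands for the cell `x · g · y`; the map sends
`x₁ · g · y` to `(∂ x₁) · g · y = ∑ x₀, x₀ · (mat x₀ x₁ * g) · y`. -/
noncomputable def leftBoundary {X₁ κ₁ X₀ κ₀ : Type*} [Fintype X₁] [Fintype κ₁]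
    (A : RightComplex F G X₁ κ₁ X₀ κ₀) (Y ι : Type*) :
    LocalChain F (fun _ : X₁ × G × Y => κ₁ × ι) →ₗ[F]
      LocalChain F (fun _ : X₀ × G × Y => κ₀ × ι) where
  toFun c := fun z k => ∑ x₁ : X₁, ∑ k₁ : κ₁, ∑ g : G,
    (A.mat (z.1, k.1) (x₁, k₁)).coeff (z.2.1 * g⁻¹) * c (x₁, g, z.2.2) (k₁, k.2)
  map_add' c c' := by
    funext z k
    simp only [Pi.add_apply, mul_add, Finset.sum_add_distrib]
  map_smul' t c := by
    funext z k
    simp only [Pi.smul_apply, smul_eq_mul, RingHom.id_apply, Finset.mul_sum, mul_left_comm]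

/-- The map `id ⊗_G ∂` without its sign: it sends `x · g · y₁` to
`x · g · (∂ y₁) = ∑ y₀, x · (g * mat y₁ y₀) · y₀`. -/
noncomputable def rightBoundary {Y₁ ι₁ Y₀ ι₀ : Type*} [Fintype Y₁] [Fintype ι₁]
    (B : LeftComplex F G Y₁ ι₁ Y₀ ι₀) (X κ : Type*) :
    LocalChain F (fun _ : X × G × Y₁ => κ × ι₁) →ₗ[F]
      LocalChain F (fun _ : X × G × Y₀ => κ × ι₀) where
  toFun c := fun z k => ∑ y₁ : Y₁, ∑ m₁ : ι₁, ∑ g : G,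
    (B.mat (y₁, m₁) (z.2.2, k.2)).coeff (g⁻¹ * z.2.1) * c (z.1, g, y₁) (k.1, m₁)
  map_add' c c' := by
    funext z k
    simp only [Pi.add_apply, mul_add, Finset.sum_add_distrib]
  map_smul' t c := by
    funext z k
    simp only [Pi.smul_apply, smul_eq_mul, RingHom.id_apply, Finset.mul_sum, mul_left_comm]

theorem leftBoundary_rightBoundary_comm {X₁ κ₁ X₀ κ₀ Y₁ ι₁ Y₀ ι₀ : Type*}
    [Fintype X₁] [Fintype κ₁] [Fintype Y₁] [Fintype ι₁]
    (A : RightComplex F G X₁ κ₁ X₀ κ₀) (B : LeftComplex F G Y₁ ι₁ Y₀ ι₀)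
    (c : LocalChain F (fun _ : X₁ × G × Y₁ => κ₁ × ι₁)) :
    leftBoundary A Y₀ ι₀ (rightBoundary B X₁ κ₁ c) =
      rightBoundary B X₀ κ₀ (leftBoundary A Y₁ ι₁ c) := by
  funext z k
  obtain ⟨x, h, y⟩ := z
  obtain ⟨k, m⟩ := k
  have key : ∀ (x₁ : X₁) (k₁ : κ₁) (y₁ : Y₁) (m₁ : ι₁),
      ∑ g : G, (A.mat (x, k) (x₁, k₁)).coeff (h * g⁻¹) *
        ∑ g' : G, (B.mat (y₁, m₁) (y, m)).coeff (g'⁻¹ * g) * c (x₁, g', y₁) (k₁, m₁) =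
      ∑ g : G, (B.mat (y₁, m₁) (y, m)).coeff (g⁻¹ * h) *
        ∑ g' : G, (A.mat (x, k) (x₁, k₁)).coeff (g * g'⁻¹) * c (x₁, g', y₁) (k₁, m₁) := by
    intro x₁ k₁ y₁ m₁
    simp only [Finset.mul_sum]
    rw [Finset.sum_comm]
    conv_rhs => rw [Finset.sum_comm]
    refine Finset.sum_congr rfl fun g' _ => ?_
    refine Finset.sum_bij' (fun g _ => h * g⁻¹ * g') (fun g _ => g' * g⁻¹ * h)
      (fun _ _ => Finset.mem_univ _) (fun _ _ => Finset.mem_univ _)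
      (fun g _ => by group) (fun g _ => by group) (fun g _ => ?_)
    have e₁ : (h * g⁻¹ * g')⁻¹ * h = g'⁻¹ * g := by group
    have e₂ : h * g⁻¹ * g' * g'⁻¹ = h * g⁻¹ := by group
    simp only [e₁, e₂]
    ring
  simp only [leftBoundary, rightBoundary, LinearMap.coe_mk, AddHom.coe_mk]
  have lhs : ∀ (x₁ : X₁) (k₁ : κ₁), ∑ g : G, (A.mat (x, k) (x₁, k₁)).coeff (h * g⁻¹) *
        ∑ y₁ : Y₁, ∑ m₁ : ι₁, ∑ g' : G,
          (B.mat (y₁, m₁) (y, m)).coeff (g'⁻¹ * g) * c (x₁, g', y₁) (k₁, m₁) =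
      ∑ y₁ : Y₁, ∑ m₁ : ι₁, ∑ g : G, (A.mat (x, k) (x₁, k₁)).coeff (h * g⁻¹) *
        ∑ g' : G, (B.mat (y₁, m₁) (y, m)).coeff (g'⁻¹ * g) * c (x₁, g', y₁) (k₁, m₁) := by
    intro x₁ k₁
    simp only [Finset.mul_sum (Finset.univ : Finset Y₁), Finset.mul_sum (Finset.univ : Finset ι₁)]
    rw [Finset.sum_comm]
    exact Finset.sum_congr rfl fun _ _ => Finset.sum_comm
  have rhs : ∀ (y₁ : Y₁) (m₁ : ι₁), ∑ g : G, (B.mat (y₁, m₁) (y, m)).coeff (g⁻¹ * h) *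
        ∑ x₁ : X₁, ∑ k₁ : κ₁, ∑ g' : G,
          (A.mat (x, k) (x₁, k₁)).coeff (g * g'⁻¹) * c (x₁, g', y₁) (k₁, m₁) =
      ∑ x₁ : X₁, ∑ k₁ : κ₁, ∑ g : G, (B.mat (y₁, m₁) (y, m)).coeff (g⁻¹ * h) *
        ∑ g' : G, (A.mat (x, k) (x₁, k₁)).coeff (g * g'⁻¹) * c (x₁, g', y₁) (k₁, m₁) := by
    intro y₁ m₁
    simp only [Finset.mul_sum (Finset.univ : Finset X₁), Finset.mul_sum (Finset.univ : Finset κ₁)]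
    rw [Finset.sum_comm]
    exact Finset.sum_congr rfl fun _ _ => Finset.sum_comm
  simp only [lhs, rhs, key]
  have swap : ∀ f : X₁ → κ₁ → Y₁ → ι₁ → F, ∑ x₁, ∑ k₁, ∑ y₁, ∑ m₁, f x₁ k₁ y₁ m₁ =
      ∑ y₁, ∑ m₁, ∑ x₁, ∑ k₁, f x₁ k₁ y₁ m₁ := by
    intro f
    rw [Finset.sum_congr rfl fun x₁ _ => Finset.sum_comm, Finset.sum_comm]
    refine Finset.sum_congr rfl fun y₁ _ => ?_
    rw [Finset.sum_congr rfl fun x₁ _ => Finset.sum_comm, Finset.sum_comm]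
  exact swap _

/-- The `G`-lifted product `A ⊗_G B`: the tensor product over `F[G]` of a right and a left
two-term complex, in the distinguished basis of the elements `x · g · y = x g ⊗ y = x ⊗ g y`,
with the boundary map `∂(x · g · y) = (∂ x) · g · y + (-1)^i x · g · (∂ y)` for `x ∈ Xᵢ`.
The local coefficient space of a cell in `Xᵢ × G × Yⱼ` is `F^(κᵢ) ⊗ F^(ιⱼ) = F^(κᵢ × ιⱼ)`. -/
noncomputable def liftedProduct {X₁ X₀ Y₁ Y₀ : Type*} {κ₁ κ₀ ι₁ ι₀ : Type}
    [Fintype X₁] [Fintype κ₁] [Fintype Y₁] [Fintype ι₁]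
    (A : RightComplex F G X₁ κ₁ X₀ κ₀) (B : LeftComplex F G Y₁ ι₁ Y₀ ι₀) :
    LocalComplex F
      (X₂ := X₁ × G × Y₁) (X₁ := (X₁ × G × Y₀) ⊕ (X₀ × G × Y₁)) (X₀ := X₀ × G × Y₀)
      (fun _ => κ₁ × ι₁)
      (Sum.elim (fun _ => κ₁ × ι₀) (fun _ => κ₀ × ι₁))
      (fun _ => κ₀ × ι₀) where
  bd₂ := (LocalChain.sumEquiv F _ _).toLinearMap ∘ₗ
    LinearMap.prod (-(rightBoundary B X₁ κ₁)) (leftBoundary A Y₁ ι₁)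
  bd₁ := LinearMap.coprod (leftBoundary A Y₀ ι₀) (rightBoundary B X₀ κ₀) ∘ₗ
    (LocalChain.sumEquiv F _ _).symm.toLinearMap
  bd_bd := fun c => by
    rw [LinearMap.comp_apply, LinearMap.comp_apply, LinearEquiv.coe_coe, LinearEquiv.coe_coe,
      LinearEquiv.symm_apply_apply, LinearMap.prod_apply, Function.prod_apply,
      LinearMap.coprod_apply, LinearMap.neg_apply, map_neg, leftBoundary_rightBoundary_comm,
      neg_add_cancel]

end LiftedProduct

/-! ## Tanner complexes and their lifts -/

/-- The data of a Tanner complex `F E → F^r V` on `Γ`: a local boundary map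
`F E_v → F^r v` for every vertex `v`, given by its matrix. -/
abbrev LocalMaps (F : Type*) {V E : Type*} (Γ : OrientedGraph V E) (r : ℕ) : Type _ :=
  (v : V) → Matrix (Fin r) (Γ.Star v) F

/-- The matrices `A` and `h` agree up to permutations of rows and of columns. -/
def MatrixEquivalent {F m n m' n' : Type*} (A : Matrix m n F) (h : Matrix m' n' F) : Prop :=
  ∃ (σ : m ≃ m') (τ : n ≃ n'), A = h.submatrix σ τ

open Classical in
/-- The `G`-lifted Tanner complex `F E ⊗ F[G] → F^r V ⊗ F[G]`, a complex of right
`F[G]`-modules: for `e` oriented from `v` to `v'`,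
`∂(e ⊗ g) = ∂_v e ⊗ g + ∂_v' e ⊗ (γ e * g)`. -/
noncomputable def liftedTanner {F G V E : Type*} [Field F] [Group G] {Γ : OrientedGraph V E}
    {r : ℕ} (D : LocalMaps F Γ r) (γ : E → G) : RightComplex F G E Unit V (Fin r) where
  mat := fun p q =>
    (if p.1 = Γ.src q.1 then
      MonoidAlgebra.single 1 (D (Γ.src q.1) p.2 ⟨q.1, Γ.src_inc q.1⟩) else 0) +
    (if p.1 = Γ.tgt q.1 then
      MonoidAlgebra.single (γ q.1) (D (Γ.tgt q.1) p.2 ⟨q.1, Γ.tgt_inc q.1⟩) else 0)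

/-- The class of `G`-lifted Tanner complexes on the lift `Γ.lift γ` all of whose local boundary
maps are permutation equivalent to `h`. -/
def liftedTannerCodes {F G V E : Type*} [Field F] [Group G] (Γ : OrientedGraph V E) (γ : E → G)
    {r w : ℕ} (h : Matrix (Fin r) (Fin w) F) : Set (RightComplex F G E Unit V (Fin r)) :=
  {A | ∃ D : LocalMaps F Γ r, (∀ v, MatrixEquivalent (D v) h) ∧ A = liftedTanner D γ}

/-! Split a 1-chain into its part `x` on the cells v·g·v' and its part `y` on the cells e·g·e'.
Around a cell (v, g, v') the values of `y` form a w × w matrix M, and the cycle condition reads h M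
+ x h' = 0 in every column e' whose other end carries no `x`. The boundary of a 2-cell meets one row
of such a matrix and only two vertex cells, so by local minimality, subtracting a codeword of the
row space of h' lowers the weight of a row of M by at most 2.

Suppose that ker h and the row space of h' have large distance, and that no non-zero sparse matrix
lies in ker h ⊗ F^w + F^w ⊗ (row space of h'), even up to a few rows and columns. Then a sparse M
with few exceptional columns forces x = 0 at the cell (`IsRobustPair.eq_zero`). Hence every cell in
the support X of `x` has many neighbours in X or a heavy M (`lt_neighbourCount_add`).

Expansion with constant λ = μ√w contradicts this on average (`eq_zero_of_cycle`). The neighbour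
counts sum to at most λ|X|. For the weights of the matrices M fix e': the support of `y` is then a
set of edges of the lift, and at a vertex not near X it is a codeword of ker h, so the degree is
zero or large. Expansion lets such vertices of large degree be at most as numerous as those near X
(`IsEdgeExpanding.sum_card_le_of_forall`), which bounds the total weight by 4λw|X|. So `x` vanishes,
and then `y` does.

Robust pairs exist by counting (`exists_isRobustPair`). A matrix of rank k with m-sparse rows and
columns is given by k of its columns, k of its rows and their positions, which leaves (wq)^O(mk)
choices. A random pair of codes admits a given one with probability at most 2 q^(-el), where e is
proportional to w and l to k (`card_pairs_mul_le`). The union bound needs m log w small against w,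
the expansion argument needs m² large against w^(3/2); m ≈ w^(4/5) satisfies both. -/

section Robust

/-! ### Robust pairs of local codes. -/

open Matrix

/-- The pair `(ker h, row space of h')` has minimum distances at least `4 m + 3`, and a matrix in
`ker h ⊗ F^n + F^n ⊗ (row space of h')`, up to at most `m` columns, whose rows and columns are
`m`-sparse outside of at most `m` rows and `m` columns vanishes outside of them. -/
structure IsRobustPair {F κ ι κ' ι' : Type*} [Field F] [DecidableEq F] [Fintype ι] [Fintype ι']
    [DecidableEq ι] [DecidableEq ι']
    [Fintype κ'] (m : ℕ) (h : Matrix κ ι F) (h' : Matrix κ' ι' F) : Prop where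
  dist_ker : ∀ v : ι → F, v ≠ 0 → h *ᵥ v = 0 → 4 * m + 3 ≤ hammingNorm v
  dist_row : ∀ a : κ' → F, a ≠ 0 → 4 * m + 3 ≤ hammingNorm (a ᵥ* h')
  vanish : ∀ (M : Matrix ι ι' F) (X : Matrix κ κ' F) (P : Finset ι) (Q : Finset ι'),
    P.card ≤ m → Q.card ≤ m → (∀ k, ∀ j ∉ Q, (h * M) k j = (X * h') k j) →
    (∀ i ∉ P, (Finset.univ.filter fun j => j ∉ Q ∧ M i j ≠ 0).card ≤ m) →
    (∀ j ∉ Q, (Finset.univ.filter fun i => i ∉ P ∧ M i j ≠ 0).card ≤ m) →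
    ∀ i ∉ P, ∀ j ∉ Q, M i j = 0

variable {F κ ι κ' ι' : Type*} [Field F] [DecidableEq F] [Fintype ι] [Fintype ι'] [DecidableEq ι]
  [DecidableEq ι'] [Fintype κ']

theorem hammingNorm_comp_equiv {α β : Type*} [Fintype α] [Fintype β] (e : α ≃ β) (v : β → F) :
    hammingNorm (fun i => v (e i)) = hammingNorm v := by
  unfold hammingNorm
  exact Finset.card_bij (fun i _ => e i) (by simp) (by simp)
    (fun b hb => ⟨e.symm b, by simpa using hb, by simp⟩)

theorem IsRobustPair.submatrix {κ₂ ι₂ κ₂' ι₂' : Type*} [Fintype ι₂] [Fintype ι₂'] [DecidableEq ι₂]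
    [DecidableEq ι₂'] [Fintype κ₂'] {m : ℕ} {h : Matrix κ ι F} {h' : Matrix κ' ι' F}
    (H : IsRobustPair m h h')
    (σ : κ₂ ≃ κ) (τ : ι₂ ≃ ι) (σ' : κ₂' ≃ κ') (τ' : ι₂' ≃ ι') :
    IsRobustPair m (h.submatrix σ τ) (h'.submatrix σ' τ') where
  dist_ker v hv h0 := by
    rw [← hammingNorm_comp_equiv τ.symm]
    refine H.dist_ker _ (fun h1 => hv ?_) ?_
    · funext i
      simpa using congrFun h1 (τ i)
    · rw [submatrix_mulVec_equiv] at h0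
      funext k
      have := congrFun h0 (σ.symm k)
      simp only [Function.comp_apply, Equiv.apply_symm_apply, Pi.zero_apply] at this
      exact this
  dist_row a ha := by
    rw [submatrix_vecMul_equiv]
    refine (H.dist_row (a ∘ σ'.symm) fun h1 => ha ?_).trans_eq
      (hammingNorm_comp_equiv τ' ((a ∘ σ'.symm) ᵥ* h')).symm
    funext i
    simpa using congrFun h1 (σ' i)
  vanish M X P Q hP hQ hM hr hc i hi j hj := by
    have key := H.vanish (M.submatrix τ.symm τ'.symm) (X.submatrix σ.symm σ'.symm)
      (P.map τ.toEmbedding) (Q.map τ'.toEmbedding) (by simpa using hP) (by simpa using hQ)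
      (fun k j hj => ?_) (fun i hi => ?_) (fun j hj => ?_) (τ i) (by simpa using hi) (τ' j)
      (by simpa using hj)
    · simpa using key
    · have := hM (σ.symm k) (τ'.symm j) (by simpa [Finset.mem_map_equiv] using hj)
      rw [mul_apply, mul_apply] at this ⊢
      rw [← τ.symm.sum_comp, ← σ'.symm.sum_comp] at this
      simpa using this
    · refine le_trans (le_of_eq ?_) (hr (τ.symm i) (by simpa [Finset.mem_map_equiv] using hi))
      exact Finset.card_bij (fun j _ => τ'.symm j) (by simp [Finset.mem_map_equiv]) (by simp)
        (fun b hb => ⟨τ' b, by simpa [Finset.mem_map_equiv] using hb, by simp⟩)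
    · refine le_trans (le_of_eq ?_) (hc (τ'.symm j) (by simpa [Finset.mem_map_equiv] using hj))
      exact Finset.card_bij (fun i _ => τ.symm i) (by simp [Finset.mem_map_equiv]) (by simp)
        (fun b hb => ⟨τ b, by simpa [Finset.mem_map_equiv] using hb, by simp⟩)

/-- The number of indices with more than `m` elements in the fibre is small. -/
theorem card_heavy_mul_le {α β : Type*} [Fintype α] [Fintype β] (p : α → β → Prop)
    [∀ a, DecidablePred (p a)] [DecidablePred fun x : α × β => p x.1 x.2] (m : ℕ) :
    (Finset.univ.filter fun a => m < (Finset.univ.filter (p a)).card).card * m ≤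
      (Finset.univ.filter fun x : α × β => p x.1 x.2).card := by
  have h1 : (Finset.univ.filter fun x : α × β => p x.1 x.2).card =
      ∑ a, (Finset.univ.filter (p a)).card := by
    simp only [Finset.card_filter, Fintype.sum_prod_type]
    congr! 4
  rw [h1, ← smul_eq_mul]
  refine (Finset.card_nsmul_le_sum _ (fun a => (Finset.univ.filter (p a)).card) m
    fun a ha => ?_).trans (Finset.sum_le_sum_of_subset (Finset.filter_subset _ _))
  exact (Finset.mem_filter.1 ha).2.le

/-- A nearly row-minimal sparse matrix `M` with `h M + x h' = 0` outside of a few columns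
forces `x = 0`. -/
theorem IsRobustPair.eq_zero {m : ℕ} {h : Matrix κ ι F} {h' : Matrix κ' ι' F}
    (H : IsRobustPair m h h') (M : Matrix ι ι' F) (x : Matrix κ κ' F) (J : Finset ι')
    (hJ : 2 * J.card ≤ m) (hM : 2 * (Finset.univ.filter fun z : ι × ι' => M z.1 z.2 ≠ 0).card ≤ m * m)
    (hx : ∀ k, ∀ j ∉ J, (h * M + x * h') k j = 0)
    (hmin : ∀ i (a : κ' → F), hammingNorm (M i) ≤ hammingNorm (M i - a ᵥ* h') + 2) : x = 0 := by
  classical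
  set P := Finset.univ.filter fun i => m < (Finset.univ.filter fun j => M i j ≠ 0).card with hPdef
  set Q₀ := Finset.univ.filter fun j => m < (Finset.univ.filter fun i => M i j ≠ 0).card with hQdef
  have hP : P.card * m ≤ (Finset.univ.filter fun z : ι × ι' => M z.1 z.2 ≠ 0).card :=
    by convert card_heavy_mul_le (fun i j => M i j ≠ 0) m
  have hQ₀ : Q₀.card * m ≤ (Finset.univ.filter fun z : ι × ι' => M z.1 z.2 ≠ 0).card := by
    refine (card_heavy_mul_le (fun j i => M i j ≠ 0) m).trans_eq ?_
    exact Finset.card_bij (fun z _ => z.swap) (by simp) (by simp)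
      (fun b hb => ⟨b.swap, by simpa using hb, by simp⟩)
  have hsmall : ∀ n, n * m ≤ (Finset.univ.filter fun z : ι × ι' => M z.1 z.2 ≠ 0).card →
      m ≠ 0 → 2 * n ≤ m := fun n hn h0 => by
    have : (2 * n) * m ≤ m * m := by linarith [hn]
    exact Nat.le_of_mul_le_mul_right this (Nat.pos_of_ne_zero h0)
  set Q := J ∪ Q₀ with hQ
  obtain ⟨hPm, hQm⟩ : P.card ≤ m ∧ Q.card ≤ m := by
    -- For `m = 0` the Markov bound on heavy rows and columns is void, but the sparsity hypotheses
    -- already make `M` zero and `J` empty.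
    rcases Nat.eq_zero_or_pos m with h0 | h0
    · have hz : ∀ i j, M i j = 0 := by
        rw [h0] at hM
        intro i j
        by_contra hne
        have : (i, j) ∈ (Finset.univ.filter fun z : ι × ι' => M z.1 z.2 ≠ 0) := by simpa using hne
        have := Finset.card_pos.2 ⟨_, this⟩
        omega
      have : J = ∅ := by rw [← Finset.card_eq_zero]; omega
      simp [hPdef, hQdef, hQ, hz, this]
    · have h1 := hsmall _ hP h0.ne'
      have h2 := hsmall _ hQ₀ h0.ne'
      have h3 := Finset.card_union_le J Q₀
      exact ⟨by omega, by rw [hQ]; omega⟩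
  have hxQ : ∀ k, ∀ j ∉ Q, (h * M) k j = ((-x) * h') k j := fun k j hj => by
    have := hx k j fun h1 => hj (Finset.mem_union_left _ h1)
    rw [Matrix.neg_mul, Matrix.neg_apply, eq_neg_iff_add_eq_zero]
    simpa using this
  have hzero := H.vanish M (-x) P Q hPm hQm hxQ
    (fun i hi => by
      have : ¬ m < (Finset.univ.filter fun j => M i j ≠ 0).card := by simpa [hPdef] using hi
      refine (Finset.card_le_card fun j hj => ?_).trans (not_lt.1 this)
      simp only [Finset.mem_filter, Finset.mem_univ, true_and] at hj ⊢
      exact hj.2)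
    (fun j hj => by
      have : ¬ m < (Finset.univ.filter fun i => M i j ≠ 0).card := by
        intro h1
        exact hj (Finset.mem_union_right _ (by simpa [hQdef] using h1))
      refine (Finset.card_le_card fun i hi => ?_).trans (not_lt.1 this)
      simp only [Finset.mem_filter, Finset.mem_univ, true_and] at hi ⊢
      exact hi.2)
  -- restriction of codewords to the complement of `Q` is injective
  let f : (κ' → F) →ₗ[F] ({j // j ∉ Q} → F) := (LinearMap.funLeft F F Subtype.val) ∘ₗ h'.vecMulLinear
  have hf : ∀ a j, f a j = (a ᵥ* h') j := fun a j => rfl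
  have hker : LinearMap.ker f = ⊥ := by
    rw [LinearMap.ker_eq_bot']
    intro a ha
    by_contra hne
    have h1 := H.dist_row a hne
    have h2 : hammingNorm (a ᵥ* h') ≤ Q.card := by
      refine Finset.card_le_card fun j hj => ?_
      by_contra hjQ
      have := congrFun ha ⟨j, hjQ⟩
      rw [hf] at this
      simp [this] at hj
    omega
  obtain ⟨g, hg⟩ := f.exists_leftInverse_of_injective hker
  let z : Matrix ι κ' F := fun i => g fun j => M i j
  have hzP : ∀ i ∉ P, z i = 0 := fun i hi => by
    have : (fun j : {j // j ∉ Q} => M i j) = 0 := funext fun j => hzero i hi j j.2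
    simp only [z, this, map_zero]
  have hxz : x = -(h * z) := by
    ext k l
    have h1 : x k = g (f (x k)) := (LinearMap.congr_fun hg (x k)).symm
    have h2 : f (x k) = -∑ i, h k i • fun j : {j // j ∉ Q} => M i j := by
      funext j
      have := hxQ k j j.2
      rw [hf, Pi.neg_apply, Finset.sum_apply]
      rw [Matrix.neg_mul, Matrix.neg_apply, mul_apply, mul_apply, ← neg_eq_iff_eq_neg] at this
      simpa [vecMul, dotProduct] using this.symm
    rw [h1, h2, map_neg, map_sum, Pi.neg_apply, Finset.sum_apply, Matrix.neg_apply, mul_apply]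
    simp [z]
  have hMz : ∀ j ∉ Q, ∀ i, M i j = (z i ᵥ* h') j := by
    intro j hj
    -- This column lies in ker h and is supported on `P`, whose size is below the distance.
    have hcol : (fun i => M i j - (z i ᵥ* h') j) = 0 := by
      by_contra hne
      have h1 := H.dist_ker _ hne ?_
      · have h2 : hammingNorm (fun i => M i j - (z i ᵥ* h') j) ≤ P.card := by
          refine Finset.card_le_card fun i hi => ?_
          by_contra hiP
          simp [hzero i hiP j hj, hzP i hiP] at hi
        omega
      · funext k
        have := hxQ k j hj
        rw [hxz, neg_neg, Matrix.mul_assoc] at this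
        have h3 : (h *ᵥ fun i => M i j - (z i ᵥ* h') j) k = (h * M) k j - (h * (z * h')) k j := by
          rw [← Matrix.sub_apply, ← Matrix.mul_sub]
          rfl
        rw [h3, this, sub_self, Pi.zero_apply]
    intro i
    exact sub_eq_zero.1 (congrFun hcol i)
  -- `M i - z i h'` lives on `Q`, so near-minimality gives `M i` weight at most m + 2. The codeword
  -- `z i h'` then has weight at most 2m + 2, less than the distance.
  have hz0 : z = 0 := by
    refine funext fun i => ?_
    change z i = 0
    by_contra hne
    have h1 := H.dist_row _ hne
    have h2 := hmin i (z i)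
    have h3 : hammingNorm (M i - z i ᵥ* h') ≤ Q.card := by
      refine Finset.card_le_card fun j hj => ?_
      by_contra hjQ
      simp [hMz j hjQ i] at hj
    have h4 : hammingNorm (z i ᵥ* h') ≤ hammingNorm (M i) + hammingNorm (M i - z i ᵥ* h') := by
      have := hammingDist_triangle (z i ᵥ* h') (M i) 0
      rw [hammingDist_zero_right, hammingDist_zero_right,
        hammingDist_eq_hammingNorm, neg_add_eq_sub] at this
      omega
    omega
  rw [hxz, hz0, Matrix.mul_zero, neg_zero]

end Robust

/-! ### Counting matrices whose row or column space meets given vectors. -/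

section Counting

open Matrix

variable {F : Type*} [Field F]

theorem LinearIndependent.exists_leftInverse {M ι : Type*} [AddCommGroup M] [Module F M]
    [Fintype ι] [DecidableEq ι] {f : ι → M} (hf : LinearIndependent F f) :
    ∃ g : M →ₗ[F] (ι → F), ∀ t, g (f t) = Pi.single t 1 := by
  obtain ⟨g, hg⟩ := (Fintype.linearCombination F f).exists_leftInverse_of_injective
    (LinearMap.ker_eq_bot.2 (LinearIndependent.fintypeLinearCombination_injective hf))
  refine ⟨g, fun t => ?_⟩
  have := LinearMap.congr_fun hg (Pi.single t 1)
  simpa using this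

/-- Either many independent combinations of the columns of `C` lie in the column space of `g`,
or many independent functionals that vanish on `g` are independent on the columns of `C`. -/
theorem exists_independent_or {ι ρ : Type*} [Fintype ι] [Fintype ρ] [DecidableEq ι] [DecidableEq ρ]
    (P : Finset ι) (g : Matrix ι ρ F) {k l : ℕ} (hkl : k + 1 = 2 * l)
    (C : Matrix ι (Fin k) F) (hP : ∀ i ∈ P, C i = 0) :
    (∃ (T : Matrix (Fin k) (Fin l) F) (T' : Matrix (Fin l) (Fin k) F) (Y : Matrix ρ (Fin l) F),
      T' * T = 1 ∧ ∀ i ∉ P, (g * Y) i = (C * T) i) ∨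
    ∃ (S : Matrix (Fin l) ι F) (W : Matrix (Fin k) (Fin l) F),
      (∀ i ∈ P, ∀ t, S t i = 0) ∧ S * g = 0 ∧ S * C * W = 1 := by
  -- `D` erases the coordinates in `P`, so that agreement off `P` becomes equality.
  let D : (ι → F) →ₗ[F] (ι → F) := LinearMap.pi fun i => if i ∈ P then 0 else LinearMap.proj i
  have hD : ∀ v i, D v i = if i ∈ P then 0 else v i := by
    intro v i
    by_cases hi : i ∈ P <;> simp [D, hi]
  let U := LinearMap.range (D ∘ₗ g.mulVecLin)
  let φ : (Fin k → F) →ₗ[F] ((ι → F) ⧸ U) := U.mkQ ∘ₗ C.mulVecLin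
  -- Since k = 2l - 1, rank-nullity gives the kernel or the range of `φ` dimension at least l. The
  -- kernel yields combinations of columns, the range yields functionals.
  by_cases hl : l ≤ Module.finrank F (LinearMap.ker φ)
  · left
    obtain ⟨f, hf⟩ := exists_linearIndependent_of_le_finrank hl
    have hf' : LinearIndependent F fun t => (f t : Fin k → F) :=
      hf.map' (LinearMap.ker φ).subtype (Submodule.ker_subtype _)
    obtain ⟨u, hu⟩ := hf'.exists_leftInverse
    have hmem : ∀ t, ∃ y : ρ → F, D (g *ᵥ y) = C *ᵥ (f t : Fin k → F) := fun t => by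
      have := (f t).2
      rw [LinearMap.mem_ker, LinearMap.comp_apply, Submodule.mkQ_apply,
        Submodule.Quotient.mk_eq_zero] at this
      exact this
    choose y hy using hmem
    refine ⟨Matrix.of fun a t => (f t : Fin k → F) a, LinearMap.toMatrix' u,
      Matrix.of fun a t => y t a, ?_, ?_⟩
    · ext s t
      have h1 : (LinearMap.toMatrix' u * Matrix.of fun a t => (f t : Fin k → F) a) s t =
          (LinearMap.toMatrix' u *ᵥ (f t : Fin k → F)) s := rfl
      rw [h1, LinearMap.toMatrix'_mulVec, hu, one_apply, Pi.single_apply]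
    · intro i hi
      funext t
      have := congrFun (hy t) i
      rw [hD, if_neg hi] at this
      exact this
  · right
    have h1 := LinearMap.finrank_range_add_finrank_ker φ
    rw [Module.finrank_fin_fun] at h1
    have h2 : l ≤ Module.finrank F (LinearMap.range φ) := by omega
    obtain ⟨f, hf⟩ := exists_linearIndependent_of_le_finrank h2
    have hf' : LinearIndependent F fun t => (f t : (ι → F) ⧸ U) :=
      hf.map' (LinearMap.range φ).subtype (Submodule.ker_subtype _)
    obtain ⟨u, hu⟩ := hf'.exists_leftInverse
    choose x hx using fun t => (f t).2
    let s : (ι → F) →ₗ[F] (Fin l → F) := u ∘ₗ U.mkQ ∘ₗ D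
    refine ⟨LinearMap.toMatrix' s, Matrix.of fun a t => x t a, ?_, ?_, ?_⟩
    · intro i hi t
      have : D (Pi.single i 1) = 0 := by
        funext j
        rw [hD]
        split_ifs with hj
        · rfl
        · rw [Pi.single_eq_of_ne (by rintro rfl; exact hj hi), Pi.zero_apply]
      rw [LinearMap.toMatrix'_apply]
      have h3 : (fun j => if j = i then (1 : F) else 0) = Pi.single i 1 := by
        funext j
        rw [Pi.single_apply]
      simp [s, this]
    · ext t a
      have h3 : (LinearMap.toMatrix' s * g) t a = (LinearMap.toMatrix' s *ᵥ fun i => g i a) t := rfl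
      have h4 : (fun i => g i a) = g *ᵥ Pi.single a 1 := by
        rw [mulVec_single_one]
        rfl
      rw [h3, LinearMap.toMatrix'_mulVec, h4]
      have h5 : U.mkQ (D (g *ᵥ Pi.single a 1)) = 0 := by
        rw [Submodule.mkQ_apply, Submodule.Quotient.mk_eq_zero]
        exact ⟨Pi.single a 1, rfl⟩
      simp only [s, LinearMap.comp_apply, h5, map_zero]
      rfl
    · ext t a
      have h3 : (LinearMap.toMatrix' s * C * Matrix.of fun a t => x t a) t a =
          (LinearMap.toMatrix' s *ᵥ (C *ᵥ x a)) t := by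
        rw [mulVec_mulVec]
        rfl
      have h4 : D (C *ᵥ x a) = C *ᵥ x a := by
        funext i
        rw [hD]
        split_ifs with hi
        · simp [mulVec, hP i hi]
        · rfl
      have h5 : U.mkQ (C *ᵥ x a) = f a := hx a
      rw [h3, LinearMap.toMatrix'_mulVec]
      simp only [s, LinearMap.comp_apply, h4, h5, hu]
      rw [one_apply, Pi.single_apply]

variable [Fintype F]

/-- A left inverse of `Y` makes `v ↦ v Y` surjective. Translating by the vectors `c Z` moves a fibre
to pairwise disjoint sets, one for each `c`. -/
theorem card_vecMul_eq_mul_le {ρ τ : Type*} [Fintype ρ] [Fintype τ] [DecidableEq ρ]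
    [DecidableEq τ] [DecidableEq F] (Y : Matrix ρ τ F) (Z : Matrix τ ρ F) (hZ : Z * Y = 1)
    (u : τ → F) :
    (Finset.univ.filter fun v : ρ → F => v ᵥ* Y = u).card * Fintype.card F ^ Fintype.card τ ≤
      Fintype.card F ^ Fintype.card ρ := by
  have h1 : Fintype.card F ^ Fintype.card τ = (Finset.univ : Finset (τ → F)).card := by
    rw [Finset.card_univ, Fintype.card_fun]
  have h2 : Fintype.card F ^ Fintype.card ρ = (Finset.univ : Finset (ρ → F)).card := by
    rw [Finset.card_univ, Fintype.card_fun]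
  rw [h1, h2, ← Finset.card_product]
  refine Finset.card_le_card_of_injOn (fun p => p.1 + p.2 ᵥ* Z) (fun _ _ => by simp) ?_
  rintro ⟨v, c⟩ hv ⟨v', c'⟩ hv' heq
  simp only [Finset.coe_product, Finset.coe_filter, Finset.mem_univ, true_and, Finset.coe_univ,
    Set.mem_prod, Set.mem_ofPred_eq, Set.mem_univ, and_true] at hv hv'
  have h3 := congrArg (fun v => v ᵥ* Y) heq
  simp only [add_vecMul, vecMul_vecMul, hZ, vecMul_one, hv, hv', add_right_inj] at h3
  subst h3
  simpa using heq

open Classical in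
/-- The number of `g` such that `L` agrees with some `g Y` off the set `P` of rows. -/
theorem card_exists_mul_eq_mul_le {ι ρ τ : Type*} [Fintype ι] [Fintype ρ] [Fintype τ] [DecidableEq τ]
    (P : Finset ι) (L : Matrix ι τ F) (L' : Matrix τ ι F)
    (hL : L' * L = 1) (hP : ∀ i ∈ P, L i = 0) :
    (Finset.univ.filter fun g : Matrix ι ρ F =>
        ∃ Y : Matrix ρ τ F, ∀ i ∉ P, (g * Y) i = L i).card *
      Fintype.card F ^ ((Fintype.card ι - P.card) * Fintype.card τ) ≤
      Fintype.card F ^ (Fintype.card ρ * Fintype.card τ + Fintype.card ρ * Fintype.card ι) := by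
  have hsub : (Finset.univ.filter fun g : Matrix ι ρ F =>
        ∃ Y : Matrix ρ τ F, ∀ i ∉ P, (g * Y) i = L i) ⊆
      (Finset.univ : Finset (Matrix ρ τ F)).biUnion fun Y =>
        Finset.univ.filter fun g : Matrix ι ρ F => ∀ i ∉ P, (g * Y) i = L i := by
    intro g hg
    simpa using hg
  have hone : ∀ Y : Matrix ρ τ F,
      (Finset.univ.filter fun g : Matrix ι ρ F => ∀ i ∉ P, (g * Y) i = L i).card *
        Fintype.card F ^ ((Fintype.card ι - P.card) * Fintype.card τ) ≤
        Fintype.card F ^ (Fintype.card ρ * Fintype.card ι) := by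
    intro Y
    by_cases hne : ∃ g : Matrix ι ρ F, ∀ i ∉ P, (g * Y) i = L i
    · obtain ⟨g, hg⟩ := hne
      -- A single solution `g`, with its rows in `P` erased, already shows that `Y` has a left
      -- inverse. Each row off `P` of any other solution is then confined to one fibre of `v ↦ v Y`,
      -- and the rows are independent of each other.
      let Z : Matrix τ ρ F := L' * Matrix.of fun i => if i ∈ P then 0 else g i
      have hZ : Z * Y = 1 := by
        rw [← hL, Matrix.mul_assoc]
        congr 1
        funext i
        by_cases hi : i ∈ P
        · rw [hP i hi]
          funext t
          simp [mul_apply, hi]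
        · rw [← hg i hi]
          funext t
          simp [mul_apply, hi]
      let S : ι → Finset (ρ → F) := fun i => if i ∈ P then Finset.univ else
        Finset.univ.filter fun v : ρ → F => v ᵥ* Y = fun t => L i t
      have h1 : (Finset.univ.filter fun g : Matrix ι ρ F => ∀ i ∉ P, (g * Y) i = L i).card ≤
          (Fintype.piFinset S).card := by
        refine Finset.card_le_card_of_injOn (fun g i a => g i a) (fun g hg => ?_)
          fun _ _ _ _ h => h
        rw [Finset.mem_coe, Fintype.mem_piFinset]
        intro i
        by_cases hi : i ∈ P
        · simp [S, hi]
        · simp only [S, hi, if_false, Finset.mem_filter, Finset.mem_univ, true_and]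
          exact (Finset.mem_filter.1 hg).2 i hi
      have h2 : Fintype.card F ^ ((Fintype.card ι - P.card) * Fintype.card τ) =
          ∏ i : ι, if i ∈ P then 1 else Fintype.card F ^ Fintype.card τ := by
        rw [Finset.prod_ite, Finset.prod_const_one, one_mul, Finset.prod_const, mul_comm, pow_mul]
        congr 1
        rw [Finset.filter_not, Finset.card_sdiff_of_subset (Finset.filter_subset _ _)]
        simp
      have h3 : Fintype.card F ^ (Fintype.card ρ * Fintype.card ι) =
          ∏ i : ι, Fintype.card F ^ Fintype.card ρ := by
        rw [Finset.prod_const, ← pow_mul, Finset.card_univ]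
      refine (Nat.mul_le_mul_right _ h1).trans ?_
      rw [h2, h3, Fintype.card_piFinset, ← Finset.prod_mul_distrib]
      refine Finset.prod_le_prod' fun i _ => ?_
      by_cases hi : i ∈ P
      · simp [S, hi]
      · simp only [S, hi, if_false]
        exact card_vecMul_eq_mul_le Y Z hZ (L i)
    · have : (Finset.univ.filter fun g : Matrix ι ρ F => ∀ i ∉ P, (g * Y) i = L i) = ∅ := by
        refine Finset.filter_eq_empty_iff.2 fun g _ hg => hne ⟨g, hg⟩
      rw [this]
      simp
  calc _ ≤ (∑ Y : Matrix ρ τ F, (Finset.univ.filter fun g : Matrix ι ρ F =>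
          ∀ i ∉ P, (g * Y) i = L i).card) *
        Fintype.card F ^ ((Fintype.card ι - P.card) * Fintype.card τ) :=
        Nat.mul_le_mul_right _ ((Finset.card_le_card hsub).trans Finset.card_biUnion_le)
    _ ≤ ∑ Y : Matrix ρ τ F, Fintype.card F ^ (Fintype.card ρ * Fintype.card ι) := by
        rw [Finset.sum_mul]
        exact Finset.sum_le_sum fun Y _ => hone Y
    _ = _ := by
        rw [Finset.sum_const, Finset.card_univ, smul_eq_mul, pow_add]
        congr 1
        change Fintype.card (ρ → τ → F) = _
        rw [Fintype.card_fun, Fintype.card_fun, ← pow_mul, mul_comm]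

open Classical in
/-- The number of `h` such that `L` agrees with some `Y h` off the set `P` of columns. -/
theorem card_exists_mul_eq_mul_le' {ι ρ τ : Type*} [Fintype ι] [Fintype ρ] [Fintype τ] [DecidableEq τ]
    (P : Finset ι) (L : Matrix τ ι F) (L' : Matrix ι τ F)
    (hL : L * L' = 1) (hP : ∀ i ∈ P, ∀ t, L t i = 0) :
    (Finset.univ.filter fun h : Matrix ρ ι F =>
        ∃ Y : Matrix τ ρ F, ∀ i ∉ P, ∀ t, (Y * h) t i = L t i).card *
      Fintype.card F ^ ((Fintype.card ι - P.card) * Fintype.card τ) ≤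
      Fintype.card F ^ (Fintype.card ρ * Fintype.card τ + Fintype.card ρ * Fintype.card ι) := by
  refine le_trans (le_of_eq ?_) (card_exists_mul_eq_mul_le (ρ := ρ) P Lᵀ L'ᵀ
    (by rw [← transpose_mul, hL, transpose_one]) (fun i hi => funext (hP i hi)))
  congr 1
  refine Finset.card_bij (fun h _ => hᵀ) ?_ (fun _ _ _ _ h => transpose_injective h) ?_
  · intro h hh
    simp only [Finset.mem_filter, Finset.mem_univ, true_and] at hh ⊢
    obtain ⟨Y, hY⟩ := hh
    refine ⟨Yᵀ, fun i hi => funext fun t => ?_⟩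
    rw [← transpose_mul]
    exact hY i hi t
  · intro g hg
    simp only [Finset.mem_filter, Finset.mem_univ, true_and] at hg
    obtain ⟨Y, hY⟩ := hg
    refine ⟨gᵀ, ?_, transpose_transpose g⟩
    simp only [Finset.mem_filter, Finset.mem_univ, true_and]
    refine ⟨Yᵀ, fun i hi t => ?_⟩
    rw [← transpose_mul]
    exact congrFun (hY i hi) t

end Counting

/-! ### Low-rank factorisations and the probability of a given matrix. -/

section Counting

open Matrix

variable {F : Type*} [Field F]

theorem exists_fin_linearIndependent {M α : Type*} [AddCommGroup M] [Module F M]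
    [Module.Finite F M] (f : α → M) :
    ∃ (k : ℕ) (J : Fin k → α), k = Module.finrank F (Submodule.span F (Set.range f)) ∧
      LinearIndependent F (fun t => f (J t)) ∧ ∀ a, ∃ c : Fin k → F, ∑ t, c t • f (J t) = f a := by
  obtain ⟨g, hg, hspan, hind⟩ := Submodule.exists_fun_fin_finrank_span_eq F (Set.range f)
  choose J hJ using hg
  obtain rfl : (fun t => f (J t)) = g := funext hJ
  refine ⟨_, J, rfl, hind, fun a => ?_⟩
  rw [← Submodule.mem_span_range_iff_exists_fun, hspan]
  exact Submodule.subset_span ⟨a, rfl⟩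

/-- A matrix of rank `k` is determined by `k` independent columns, `k` independent rows and the
positions of the latter. -/
theorem Matrix.exists_eq_col_mul_row {ι ι' : Type*} [Fintype ι] [Fintype ι'] [DecidableEq ι]
    [DecidableEq ι'] (N : Matrix ι ι' F) (hN : N ≠ 0) :
    ∃ (k : ℕ) (I : Fin k → ι) (J : Fin k → ι'), 0 < k ∧ k ≤ Fintype.card ι ∧
      (∃ C' : Matrix (Fin k) ι F, C' * N.submatrix id J = 1) ∧
      (∃ R' : Matrix ι' (Fin k) F,
        ((N.submatrix id J).submatrix I id)⁻¹ * N.submatrix I id * R' = 1) ∧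
      N = N.submatrix id J * (((N.submatrix id J).submatrix I id)⁻¹ * N.submatrix I id) := by
  obtain ⟨k, J, hk, hind, hspan⟩ := exists_fin_linearIndependent (F := F) fun j i => N i j
  set C := N.submatrix id J with hCdef
  obtain ⟨u, hu⟩ := hind.exists_leftInverse
  have hCinv : LinearMap.toMatrix' u * C = 1 := by
    ext s t
    have h1 : (LinearMap.toMatrix' u * C) s t = (LinearMap.toMatrix' u *ᵥ fun i => N i (J t)) s :=
      rfl
    rw [h1, LinearMap.toMatrix'_mulVec, hu, one_apply, Pi.single_apply]
  obtain ⟨T, hT⟩ : ∃ T : Matrix (Fin k) ι' F, N = C * T := by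
    choose c hc using hspan
    refine ⟨Matrix.of fun t j => c j t, ?_⟩
    ext i j
    have h2 := congrFun (hc j) i
    rw [Finset.sum_apply] at h2
    rw [mul_apply, ← h2]
    refine Finset.sum_congr rfl fun t _ => ?_
    simp [hCdef, mul_comm]
  -- The columns `J` of N = C T are C itself. Cancelling C on the left shows that the columns `J` of
  -- T form the identity.
  have hTJ : T * (1 : Matrix ι' ι' F).submatrix id J = 1 := by
    have h1 : C * (T * (1 : Matrix ι' ι' F).submatrix id J) = C := by
      rw [← Matrix.mul_assoc, ← hT, hCdef]
      conv_rhs => rw [← Matrix.mul_one N]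
      rw [submatrix_mul _ _ _ _ _ Function.bijective_id, submatrix_id_id]
    calc _ = LinearMap.toMatrix' u * (C * (T * (1 : Matrix ι' ι' F).submatrix id J)) := by
          rw [← Matrix.mul_assoc, hCinv, Matrix.one_mul]
      _ = 1 := by rw [h1, hCinv]
  obtain ⟨k₂, I, hk₂, hind₂, -⟩ := exists_fin_linearIndependent (F := F) fun i t => C i t
  have hrank : k₂ = k := by
    have h1 : C.rank = k := by
      refine le_antisymm ((rank_le_card_width C).trans_eq (Fintype.card_fin k)) ?_
      have := rank_mul_le_right (LinearMap.toMatrix' u) C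
      rwa [hCinv, rank_one, Fintype.card_fin] at this
    rw [← h1, hk₂, rank_eq_finrank_span_row]
    rfl
  subst hrank
  have hCI : IsUnit (C.submatrix I id).det := by
    rw [← isUnit_iff_isUnit_det, ← linearIndependent_rows_iff_isUnit]
    exact hind₂
  -- This recovers T, which need not be sparse, from rows and columns of N, which are sparse when N
  -- is. The union bound can therefore run over sparse data only.
  have hrow : (C.submatrix I id)⁻¹ * N.submatrix I id = T := by
    have h1 : N.submatrix I id = C.submatrix I id * T := by
      conv_lhs => rw [hT]
      rw [submatrix_mul _ _ _ _ _ Function.bijective_id, submatrix_id_id]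
    rw [h1, ← Matrix.mul_assoc, nonsing_inv_mul _ hCI, Matrix.one_mul]
  refine ⟨k₂, I, J, ?_, ?_, ⟨_, hCinv⟩, ⟨(1 : Matrix ι' ι' F).submatrix id J, ?_⟩, ?_⟩
  · rw [Nat.pos_iff_ne_zero]
    rintro rfl
    apply hN
    rw [hT]
    ext i j
    simp [mul_apply]
  · rw [hk]
    refine (Submodule.finrank_le _).trans ?_
    rw [Module.finrank_fintype_fun_eq_card]
  · rw [hrow, hTJ]
  · rw [hrow, ← hT]

variable [Fintype F]

open Classical in
/-- The number of pairs `(g, h)` such that a given matrix `C R` of rank `k` lies in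
`im g ⊗ F^n + F^n ⊗ (row space of h)`, up to the rows in `P` and the columns in `Q`. -/
theorem card_pairs_mul_le {ι ρ ρ' : Type*} [Fintype ι] [Fintype ρ] [Fintype ρ']
    (P Q : Finset ι) {k l m e : ℕ} (hl : 0 < l) (hkl : 2 * l ≤ k + 1)
    (C : Matrix ι (Fin k) F) (C' : Matrix (Fin k) ι F) (hC : C' * C = 1)
    (R : Matrix (Fin k) ι F) (R' : Matrix ι (Fin k) F) (hR : R * R' = 1)
    (hCP : ∀ i ∈ P, C i = 0) (hRQ : ∀ j ∈ Q, ∀ t, R t j = 0)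
    (hP : P.card ≤ m) (hQ : Q.card ≤ m)
    (hρ : 2 * l + Fintype.card ρ + m + e ≤ Fintype.card ι)
    (hρ' : Fintype.card ρ' + m + e ≤ Fintype.card ι) :
    (Finset.univ.filter fun p : Matrix ι ρ F × Matrix ρ' ι F =>
        ∃ (Y : Matrix ρ ι F) (X : Matrix ι ρ' F), ∀ i ∉ P, ∀ j ∉ Q,
          (C * R) i j = (p.1 * Y + X * p.2) i j).card * Fintype.card F ^ (e * l) ≤
      2 * Fintype.card F ^ (Fintype.card ρ * Fintype.card ι + Fintype.card ρ' * Fintype.card ι) := by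
  set q := Fintype.card F with hq
  set n := Fintype.card ι with hn
  have hq0 : 0 < q := Fintype.card_pos
  -- Only 2l - 1 of the k columns are used: the union over `T` below costs q^(k₀ l), which the slack
  -- in `hρ` has to pay for.
  set k₀ := 2 * l - 1 with hk₀
  have hk₀k : k₀ ≤ k := by omega
  set C₀ : Matrix ι (Fin k₀) F := C.submatrix id (Fin.castLE hk₀k) with hC₀
  have hC₀inv : C'.submatrix (Fin.castLE hk₀k) id * C₀ = 1 := by
    rw [hC₀, ← submatrix_mul _ _ _ _ _ Function.bijective_id, hC]
    exact submatrix_one _ (Fin.castLE_injective _)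
  have hC₀P : ∀ i ∈ P, C₀ i = 0 := fun i hi => by
    funext t
    exact congrFun (hCP i hi) _
  let ev : Matrix ι ρ F → Matrix ρ' ι F → Prop := fun g h =>
    ∃ (Y : Matrix ρ ι F) (X : Matrix ι ρ' F), ∀ i ∉ P, ∀ j ∉ Q,
          (C * R) i j = (g * Y + X * h) i j
  -- A bad `g` captures, off `P`, an l-dimensional space of combinations of the chosen columns. Bad
  -- `g` are rare on their own; for the others the randomness of `h` suffices.
  let bad : Matrix ι ρ F → Prop := fun g =>
    ∃ (T : Matrix (Fin k₀) (Fin l) F) (T' : Matrix (Fin l) (Fin k₀) F) (Y : Matrix ρ (Fin l) F),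
      T' * T = 1 ∧ ∀ i ∉ P, (g * Y) i = (C₀ * T) i
  have hbad : (Finset.univ.filter bad).card * q ^ (e * l) ≤ q ^ (Fintype.card ρ * n) := by
    have h1 : (Finset.univ.filter bad) ⊆ (Finset.univ : Finset (Matrix (Fin k₀) (Fin l) F)).biUnion
        fun T => Finset.univ.filter fun g : Matrix ι ρ F =>
          (∃ T' : Matrix (Fin l) (Fin k₀) F, T' * T = 1) ∧
          ∃ Y : Matrix ρ (Fin l) F, ∀ i ∉ P, (g * Y) i = (C₀ * T) i := by
      intro g hg
      simp only [Finset.mem_filter, Finset.mem_univ, true_and, Finset.mem_biUnion] at hg ⊢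
      obtain ⟨T, T', Y, h1, h2⟩ := hg
      exact ⟨T, ⟨T', h1⟩, Y, h2⟩
    have h2 : ∀ T : Matrix (Fin k₀) (Fin l) F, (Finset.univ.filter fun g : Matrix ι ρ F =>
          (∃ T' : Matrix (Fin l) (Fin k₀) F, T' * T = 1) ∧
          ∃ Y : Matrix ρ (Fin l) F, ∀ i ∉ P, (g * Y) i = (C₀ * T) i).card * q ^ ((n - P.card) * l) ≤
        q ^ (Fintype.card ρ * l + Fintype.card ρ * n) := by
      intro T
      by_cases hT : ∃ T' : Matrix (Fin l) (Fin k₀) F, T' * T = 1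
      · obtain ⟨T', hT'⟩ := hT
        have := card_exists_mul_eq_mul_le (ρ := ρ) P (C₀ * T)
          (T' * C'.submatrix (Fin.castLE hk₀k) id)
          (by rw [Matrix.mul_assoc, ← Matrix.mul_assoc _ C₀, hC₀inv, Matrix.one_mul, hT'])
          (fun i hi => by
            funext t
            simp [mul_apply, hC₀P i hi])
        rw [Fintype.card_fin] at this
        refine (Nat.mul_le_mul_right _ (Finset.card_le_card fun g hg => ?_)).trans this
        simp only [Finset.mem_filter, Finset.mem_univ, true_and] at hg ⊢
        exact hg.2
      · simp [hT]
    have h3 : (Finset.univ.filter bad).card * q ^ ((n - P.card) * l) ≤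
        q ^ (k₀ * l) * q ^ (Fintype.card ρ * l + Fintype.card ρ * n) := by
      refine (Nat.mul_le_mul_right _ ((Finset.card_le_card h1).trans
        Finset.card_biUnion_le)).trans ?_
      rw [Finset.sum_mul]
      refine (Finset.sum_le_sum fun T _ => h2 T).trans_eq ?_
      rw [Finset.sum_const, Finset.card_univ, smul_eq_mul]
      congr 1
      change Fintype.card (Fin k₀ → Fin l → F) = _
      rw [Fintype.card_fun, Fintype.card_fun, ← pow_mul, Fintype.card_fin, Fintype.card_fin,
        mul_comm]
    have h4 : e * l + (k₀ + Fintype.card ρ) * l ≤ (n - P.card) * l := by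
      rw [← add_mul]
      exact Nat.mul_le_mul_right _ (by omega)
    refine Nat.le_of_mul_le_mul_right (c := q ^ ((k₀ + Fintype.card ρ) * l)) ?_ (by positivity)
    calc _ = (Finset.univ.filter bad).card * q ^ (e * l + (k₀ + Fintype.card ρ) * l) := by
          rw [pow_add, mul_assoc]
      _ ≤ (Finset.univ.filter bad).card * q ^ ((n - P.card) * l) :=
          Nat.mul_le_mul_left _ (Nat.pow_le_pow_right hq0 h4)
      _ ≤ _ := h3
      _ = _ := by
          rw [← pow_add, ← pow_add]
          congr 1
          ring
  have hgood : ∀ g, ¬ bad g → (Finset.univ.filter (ev g)).card * q ^ (e * l) ≤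
      q ^ (Fintype.card ρ' * n) := by
    intro g hg
    rcases exists_independent_or P g (k := k₀) (l := l) (by omega) C₀ hC₀P with h1 | h1
    · exact absurd h1 hg
    obtain ⟨S, W, hSP, hSg, hSW⟩ := h1
    let E : Matrix (Fin k) (Fin k₀) F := (1 : Matrix (Fin k) (Fin k) F).submatrix id (Fin.castLE hk₀k)
    have hE : C₀ = C * E := by
      rw [show E = (1 : Matrix (Fin k) (Fin k) F).submatrix id (Fin.castLE hk₀k) from rfl, hC₀]
      conv_lhs => rw [← Matrix.mul_one C]
      rw [submatrix_mul _ _ _ _ _ Function.bijective_id, submatrix_id_id]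
    have h2 := card_exists_mul_eq_mul_le' (ρ := ρ') Q (S * (C * R)) (R' * (E * W))
      (by
        rw [hE] at hSW
        calc _ = S * C * (R * R') * (E * W) := by simp only [Matrix.mul_assoc]
          _ = 1 := by
            rw [hR, Matrix.mul_one, ← hSW]
            simp only [Matrix.mul_assoc])
      (fun j hj t => by
        rw [← Matrix.mul_assoc, mul_apply]
        exact Finset.sum_eq_zero fun a _ => by rw [hRQ j hj, mul_zero])
    rw [Fintype.card_fin] at h2
    have h3 : (Finset.univ.filter (ev g)).card * q ^ ((n - Q.card) * l) ≤
        q ^ (Fintype.card ρ' * l + Fintype.card ρ' * n) := by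
      refine (Nat.mul_le_mul_right _ (Finset.card_le_card fun h hh => ?_)).trans h2
      simp only [Finset.mem_filter, Finset.mem_univ, true_and] at hh ⊢
      obtain ⟨Y, X, hYX⟩ := hh
      refine ⟨S * X, fun j hj t => ?_⟩
      -- `S` annihilates `g`, so S C R = (S X) h off `Q`: the row space of `h` has to contain l
      -- prescribed independent rows up to `Q`.
      have h4 : (S * (C * R)) t j = (S * (g * Y + X * h)) t j := by
        rw [mul_apply, mul_apply]
        refine Finset.sum_congr rfl fun i _ => ?_
        by_cases hi : i ∈ P
        · rw [hSP i hi, zero_mul, zero_mul]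
        · rw [hYX i hi j hj]
      rw [h4, Matrix.mul_add, ← Matrix.mul_assoc S g, hSg, Matrix.zero_mul, zero_add,
        Matrix.mul_assoc]
    have h4 : e * l + Fintype.card ρ' * l ≤ (n - Q.card) * l := by
      rw [← add_mul]
      exact Nat.mul_le_mul_right _ (by omega)
    refine Nat.le_of_mul_le_mul_right (c := q ^ (Fintype.card ρ' * l)) ?_ (by positivity)
    calc _ = (Finset.univ.filter (ev g)).card * q ^ (e * l + Fintype.card ρ' * l) := by
          rw [pow_add, mul_assoc]
      _ ≤ (Finset.univ.filter (ev g)).card * q ^ ((n - Q.card) * l) :=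
          Nat.mul_le_mul_left _ (Nat.pow_le_pow_right hq0 h4)
      _ ≤ _ := h3
      _ = _ := by rw [← pow_add, add_comm]
  have hcardh : (Finset.univ : Finset (Matrix ρ' ι F)).card = q ^ (Fintype.card ρ' * n) := by
    rw [Finset.card_univ]
    change Fintype.card (ρ' → ι → F) = _
    rw [Fintype.card_fun, Fintype.card_fun, ← pow_mul, mul_comm]
  have hcardg : (Finset.univ : Finset (Matrix ι ρ F)).card = q ^ (Fintype.card ρ * n) := by
    rw [Finset.card_univ]
    change Fintype.card (ι → ρ → F) = _
    rw [Fintype.card_fun, Fintype.card_fun, ← pow_mul]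
  have hsplit : (Finset.univ.filter fun p : Matrix ι ρ F × Matrix ρ' ι F => ev p.1 p.2).card =
      ∑ g : Matrix ι ρ F, (Finset.univ.filter (ev g)).card := by
    simp only [Finset.card_filter, Fintype.sum_prod_type]
  calc _ = (∑ g : Matrix ι ρ F, (Finset.univ.filter (ev g)).card) * q ^ (e * l) := by
        rw [← hsplit]
    _ ≤ ∑ g : Matrix ι ρ F, ((if bad g then q ^ (Fintype.card ρ' * n) * q ^ (e * l) else 0) +
          q ^ (Fintype.card ρ' * n)) := by
        rw [Finset.sum_mul]
        refine Finset.sum_le_sum fun g _ => ?_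
        by_cases hg : bad g
        · rw [if_pos hg]
          refine (Nat.mul_le_mul_right _ ?_).trans (Nat.le_add_right _ _)
          rw [← hcardh]
          exact Finset.card_le_card (Finset.filter_subset _ _)
        · rw [if_neg hg, zero_add]
          exact hgood g hg
    _ = (Finset.univ.filter bad).card * q ^ (e * l) * q ^ (Fintype.card ρ' * n) +
          q ^ (Fintype.card ρ * n) * q ^ (Fintype.card ρ' * n) := by
        rw [Finset.sum_add_distrib, Finset.sum_const, hcardg, smul_eq_mul, ← Finset.sum_filter,
          Finset.sum_const, smul_eq_mul]
        ring
    _ ≤ q ^ (Fintype.card ρ * n) * q ^ (Fintype.card ρ' * n) +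
          q ^ (Fintype.card ρ * n) * q ^ (Fintype.card ρ' * n) :=
        Nat.add_le_add_right (Nat.mul_le_mul_right _ hbad) _
    _ = _ := by
        rw [pow_add]
        ring

end Counting

/-! ### Union bound: almost all pairs of generator matrices are robust. -/

section Counting

open Matrix

variable {F : Type*} [Field F] [DecidableEq F]

/-- The column space of `g` and the row space of `h` have minimum distances at least `4 m + 3`, and
there is no sparse non-zero matrix which lies, outside of few rows and columns, in
`im g ⊗ F^n + F^n ⊗ (row space of h)`. -/
structure IsRobustGenerators {ρ ι ρ' : Type*} [Fintype ρ] [Fintype ι] [DecidableEq ι] [Fintype ρ']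
    (m : ℕ) (g : Matrix ι ρ F) (h : Matrix ρ' ι F) : Prop where
  dist_col : ∀ v ≠ 0, (∃ y, g *ᵥ y = v) → 4 * m + 3 ≤ hammingNorm v
  dist_row : ∀ v ≠ 0, (∃ y, y ᵥ* h = v) → 4 * m + 3 ≤ hammingNorm v
  eq_zero : ∀ (N : Matrix ι ι F) (P Q : Finset ι), P.card ≤ m → Q.card ≤ m →
    (∀ i ∈ P, N i = 0) → (∀ j ∈ Q, ∀ i, N i j = 0) → (∀ i, hammingNorm (N i) ≤ m) →
    (∀ j, hammingNorm (fun i => N i j) ≤ m) →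
    (∃ (Y : Matrix ρ ι F) (X : Matrix ι ρ' F), ∀ i ∉ P, ∀ j ∉ Q, N i j = (g * Y + X * h) i j) →
    N = 0

/-- Surjectivity of `h` allows one to write X = h Z. Off `Q` the columns of M - Z h' then lie in ker
h, hence in the image of `g`. Erasing the rows `P` and the columns `Q` of M produces a sparse matrix
of the excluded kind. -/
theorem IsRobustGenerators.isRobustPair {κ ρ ι κ' : Type*} [Fintype ρ] [Fintype ι] [DecidableEq ι]
    [Fintype κ'] {m : ℕ} {g : Matrix ι ρ F} {h' : Matrix κ' ι F} (H : IsRobustGenerators m g h')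
    (h : Matrix κ ι F) (hg : ∀ v, h *ᵥ v = 0 → ∃ y, g *ᵥ y = v) (hsurj : ∀ y, ∃ v, h *ᵥ v = y)
    (hinj : ∀ a, a ᵥ* h' = 0 → a = 0) : IsRobustPair m h h' where
  dist_ker v hv h0 := H.dist_col v hv (hg v h0)
  dist_row a ha := H.dist_row _ (fun h0 => ha (hinj a h0)) ⟨a, rfl⟩
  vanish M X P Q hP hQ hM hr hc i hi j hj := by
    have hN := H.eq_zero (Matrix.of fun i j => if i ∈ P ∨ j ∈ Q then 0 else M i j) P Q hP hQ
      (fun i hi => by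
        funext j
        simp [hi])
      (fun j hj i => by simp [hj])
      (fun i => by
        by_cases hi : i ∈ P
        · exact (hammingNorm_eq_zero.2 (funext fun j => by simp [hi])).trans_le m.zero_le
        · refine le_trans (Finset.card_le_card fun j hj => ?_) (hr i hi)
          simp only [Finset.mem_filter, Finset.mem_univ, true_and] at hj ⊢
          simpa [hi, or_imp] using hj)
      (fun j => by
        by_cases hj : j ∈ Q
        · exact (hammingNorm_eq_zero.2 (funext fun i => by simp [hj])).trans_le m.zero_le
        · refine le_trans (Finset.card_le_card fun i hi => ?_) (hc j hj)
          simp only [Finset.mem_filter, Finset.mem_univ, true_and] at hi ⊢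
          simpa [hj, or_imp] using hi)
      (by
        choose s hs using hsurj
        let Z : Matrix ι κ' F := Matrix.of fun i a => s (fun k => X k a) i
        have hZ : h * Z = X := by
          ext k a
          exact congrFun (hs fun k => X k a) k
        have h1 : ∀ j, ∃ y : ρ → F, j ∉ Q → g *ᵥ y = fun i => M i j - (Z * h') i j := fun j => by
          by_cases hj : j ∈ Q
          · exact ⟨0, fun h => absurd hj h⟩
          · obtain ⟨y, hy⟩ := hg (fun i => M i j - (Z * h') i j) (by
              funext k
              have h3 : (h *ᵥ fun i => M i j - (Z * h') i j) k =
                  (h * M) k j - (h * (Z * h')) k j := by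
                rw [← Matrix.sub_apply, ← Matrix.mul_sub]
                rfl
              rw [h3, hM k j hj, ← Matrix.mul_assoc, hZ, sub_self, Pi.zero_apply])
            exact ⟨y, fun _ => hy⟩
        choose y hy using h1
        refine ⟨Matrix.of fun a j => y j a, Z, fun i hi j hj => ?_⟩
        have h2 := congrFun (hy j hj) i
        have h3 : (g * Matrix.of fun a j => y j a) i j = (g *ᵥ y j) i := rfl
        rw [Matrix.add_apply, h3, h2]
        simp [hi, hj])
    have := congrFun (congrFun hN i) j
    simpa [hi, hj] using this

variable [Fintype F] {w : ℕ}

/-- Each further unit of weight is one update of a coordinate, with w · q choices. -/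
theorem card_hammingNorm_le (hw : 0 < w) (m : ℕ) :
    (Finset.univ.filter fun v : Fin w → F => hammingNorm v ≤ m).card ≤
      (w * Fintype.card F) ^ m := by
  induction m with
  | zero =>
    rw [pow_zero, Finset.card_le_one]
    intro a ha b hb
    simp only [Finset.mem_filter, Finset.mem_univ, true_and, nonpos_iff_eq_zero,
      hammingNorm_eq_zero] at ha hb
    rw [ha, hb]
  | succ m ih =>
    have hsub : (Finset.univ.filter fun v : Fin w → F => hammingNorm v ≤ m + 1) ⊆
        ((Finset.univ.filter fun v : Fin w → F => hammingNorm v ≤ m) ×ˢ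
          (Finset.univ : Finset (Fin w × F))).image fun p => Function.update p.1 p.2.1 p.2.2 := by
      intro v hv
      simp only [Finset.mem_filter, Finset.mem_univ, true_and] at hv
      rw [Finset.mem_image]
      by_cases h0 : v = 0
      · refine ⟨(0, ⟨0, hw⟩, 0), ?_, ?_⟩
        · simp
        · simp [h0]
      · obtain ⟨i, hi⟩ := Function.ne_iff.1 h0
        refine ⟨(Function.update v i 0, i, v i), ?_, by simp⟩
        simp only [Finset.mem_product, Finset.mem_filter, Finset.mem_univ, true_and, and_true]
        have : hammingNorm (Function.update v i 0) < hammingNorm v := by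
          refine Finset.card_lt_card ((Finset.ssubset_iff_of_subset fun j hj => ?_).2 ⟨i, ?_, ?_⟩)
          · simp only [Finset.mem_filter, Finset.mem_univ, true_and] at hj ⊢
            intro hvj
            refine hj ?_
            by_cases hij : j = i
            · subst hij
              simp
            · simp [hij, hvj]
          · simpa using hi
          · simp
        omega
    refine (Finset.card_le_card hsub).trans (Finset.card_image_le.trans ?_)
    rw [Finset.card_product, pow_succ, Finset.card_univ, Fintype.card_prod, Fintype.card_fin]
    exact Nat.mul_le_mul_right _ ih

variable (F) in
theorem card_finset_card_le (hw : 0 < w) (m : ℕ) :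
    (Finset.univ.filter fun P : Finset (Fin w) => P.card ≤ m).card ≤
      (w * Fintype.card F) ^ m := by
  refine le_trans (Finset.card_le_card_of_injOn
    (fun P i => if i ∈ P then (1 : F) else 0) (fun P hP => ?_) fun P _ P' _ h => ?_)
    (card_hammingNorm_le hw m)
  · simp only [Finset.coe_filter, Finset.mem_univ, true_and, Set.mem_ofPred_eq] at hP ⊢
    refine le_trans (le_of_eq ?_) hP
    unfold hammingNorm
    congr 1
    ext i
    simp
  · ext i
    have := congrFun h i
    by_cases h1 : i ∈ P <;> by_cases h2 : i ∈ P' <;> simp_all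

open Classical in
-- Union bound over the vectors of small weight. A fixed non-zero vector is a w × 1 matrix with a
-- left inverse, so `card_exists_mul_eq_mul_le` applies with nothing erased.
theorem card_not_dist_col_mul_le {ρ : Type*} [Fintype ρ] (hw : 0 < w) {d e : ℕ}
    (he : Fintype.card ρ + e ≤ w) :
    (Finset.univ.filter fun g : Matrix (Fin w) ρ F =>
      ∃ v, v ≠ 0 ∧ hammingNorm v ≤ d ∧ ∃ y, g *ᵥ y = v).card * Fintype.card F ^ e ≤
      (w * Fintype.card F) ^ d * Fintype.card F ^ (Fintype.card ρ * w) := by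
  set q := Fintype.card F with hq
  have hq0 : 0 < q := Fintype.card_pos
  have hone : ∀ v : Fin w → F, (Finset.univ.filter fun g : Matrix (Fin w) ρ F =>
      v ≠ 0 ∧ ∃ y, g *ᵥ y = v).card * q ^ e ≤ q ^ (Fintype.card ρ * w) := by
    intro v
    by_cases hv : v = 0
    · simp [hv]
    obtain ⟨i, hi⟩ := Function.ne_iff.1 hv
    have h1 := card_exists_mul_eq_mul_le (ρ := ρ) ∅ (Matrix.of fun i (_ : Fin 1) => v i)
      (Matrix.of fun (_ : Fin 1) j => if j = i then (v i)⁻¹ else 0)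
      (by
        ext a b
        have : a = b := Subsingleton.elim _ _
        subst this
        simp only [mul_apply, of_apply, ite_mul, zero_mul, Finset.sum_ite_eq', Finset.mem_univ,
          if_true, one_apply_eq]
        exact inv_mul_cancel₀ hi) (by simp)
    simp only [Finset.card_empty, Nat.sub_zero, Fintype.card_fin, mul_one] at h1
    refine Nat.le_of_mul_le_mul_right (c := q ^ Fintype.card ρ) ?_ (by positivity)
    rw [mul_assoc, ← pow_add, ← pow_add, add_comm (Fintype.card ρ * w)]
    refine le_trans (Nat.mul_le_mul (Finset.card_le_card fun g hg => ?_)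
      (Nat.pow_le_pow_right hq0 (by omega : e + Fintype.card ρ ≤ w))) h1
    simp only [Finset.mem_filter, Finset.mem_univ, true_and] at hg ⊢
    obtain ⟨-, y, hy⟩ := hg
    refine ⟨Matrix.of fun a _ => y a, fun i _ => funext fun _ => congrFun hy i⟩
  calc _ ≤ (∑ v ∈ Finset.univ.filter fun v : Fin w → F => hammingNorm v ≤ d,
        (Finset.univ.filter fun g : Matrix (Fin w) ρ F =>
          v ≠ 0 ∧ ∃ y, g *ᵥ y = v).card) * q ^ e := by
        refine Nat.mul_le_mul_right _ (le_trans (Finset.card_le_card fun g hg => ?_)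
          Finset.card_biUnion_le)
        simp only [Finset.mem_filter, Finset.mem_univ, true_and, Finset.mem_biUnion] at hg ⊢
        obtain ⟨v, h1, h2, h3⟩ := hg
        exact ⟨v, h2, h1, h3⟩
    _ ≤ ∑ v ∈ Finset.univ.filter fun v : Fin w → F => hammingNorm v ≤ d,
          q ^ (Fintype.card ρ * w) := by
        rw [Finset.sum_mul]
        exact Finset.sum_le_sum fun v _ => hone v
    _ ≤ _ := by
        rw [Finset.sum_const, smul_eq_mul]
        exact Nat.mul_le_mul_right _ (card_hammingNorm_le hw d)

open Classical in
theorem card_not_dist_row_mul_le {ρ : Type*} [Fintype ρ] (hw : 0 < w) {d e : ℕ}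
    (he : Fintype.card ρ + e ≤ w) :
    (Finset.univ.filter fun h : Matrix ρ (Fin w) F =>
      ∃ v, v ≠ 0 ∧ hammingNorm v ≤ d ∧ ∃ y, y ᵥ* h = v).card * Fintype.card F ^ e ≤
      (w * Fintype.card F) ^ d * Fintype.card F ^ (Fintype.card ρ * w) := by
  refine le_trans (Nat.mul_le_mul_right _ (Finset.card_le_card_of_injOn transpose (fun h hh => ?_)
    fun _ _ _ _ h => transpose_injective h)) (card_not_dist_col_mul_le hw he)
  simp only [Finset.coe_filter, Finset.mem_univ, true_and, Set.mem_ofPred_eq,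
    mulVec_transpose] at hh ⊢
  exact hh

open Classical in
-- Union bound over the rank k and over the sparse data that determine a factorisation of rank k.
-- The parameter `B` is the inverse of the wanted failure probability, up to the factor 2.
theorem card_not_robust_mul_le {ρ ρ' : Type*} [Fintype ρ] [Fintype ρ'] (hw : 0 < w)
    {m e c B : ℕ} (hm : 0 < m) (hc : 2 ≤ c)
    (hρ : 2 * (w / c + 1) + Fintype.card ρ + m + e ≤ w)
    (hρ' : Fintype.card ρ' + m + e ≤ w)
    (hq : B * w * (w * Fintype.card F) ^ (5 * m * c) ≤ Fintype.card F ^ e) :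
    (Finset.univ.filter fun p : Matrix (Fin w) ρ F × Matrix ρ' (Fin w) F =>
        ∃ (N : Matrix (Fin w) (Fin w) F) (P Q : Finset (Fin w)), N ≠ 0 ∧ P.card ≤ m ∧ Q.card ≤ m ∧
          (∀ i ∈ P, N i = 0) ∧ (∀ j ∈ Q, ∀ i, N i j = 0) ∧ (∀ i, hammingNorm (N i) ≤ m) ∧
          (∀ j, hammingNorm (fun i => N i j) ≤ m) ∧
          ∃ (Y : Matrix ρ (Fin w) F) (X : Matrix (Fin w) ρ' F), ∀ i ∉ P, ∀ j ∉ Q,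
            N i j = (p.1 * Y + X * p.2) i j).card * B ≤
      2 * Fintype.card F ^ (Fintype.card ρ * w + Fintype.card ρ' * w) := by
  set q := Fintype.card F with hqdef
  have hq0 : 0 < q := Fintype.card_pos
  set tot := 2 * q ^ (Fintype.card ρ * w + Fintype.card ρ' * w) with htot
  let SP := Finset.univ.filter fun P : Finset (Fin w) => P.card ≤ m
  let SV := Finset.univ.filter fun v : Fin w → F => hammingNorm v ≤ m
  -- The data are the exceptional sets, k sparse columns, k sparse rows and the positions of these
  -- rows. They determine both factors C and R.
  let S : ∀ k : ℕ, Finset ((Finset (Fin w) × Finset (Fin w)) ×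
      ((Fin k → Fin w → F) × (Fin k → Fin w → F)) × (Fin k → Fin w)) := fun k =>
    (SP ×ˢ SP) ×ˢ ((Fintype.piFinset fun _ => SV) ×ˢ (Fintype.piFinset fun _ => SV)) ×ˢ
      Finset.univ
  let ev : ∀ k : ℕ, ((Finset (Fin w) × Finset (Fin w)) ×
      ((Fin k → Fin w → F) × (Fin k → Fin w → F)) × (Fin k → Fin w)) →
      Matrix (Fin w) ρ F × Matrix ρ' (Fin w) F → Prop := fun k θ p =>
    ∃ (C : Matrix (Fin w) (Fin k) F) (C' : Matrix (Fin k) (Fin w) F) (R : Matrix (Fin k) (Fin w) F)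
      (R' : Matrix (Fin w) (Fin k) F), C' * C = 1 ∧ R * R' = 1 ∧
      C = (Matrix.of θ.2.1.1)ᵀ ∧
      R = (C.submatrix θ.2.2 id)⁻¹ * Matrix.of θ.2.1.2 ∧
      (∀ i ∈ θ.1.1, C i = 0) ∧ (∀ j ∈ θ.1.2, ∀ t, R t j = 0) ∧
      ∃ (Y : Matrix ρ (Fin w) F) (X : Matrix (Fin w) ρ' F), ∀ i ∉ θ.1.1, ∀ j ∉ θ.1.2,
            (C * R) i j = (p.1 * Y + X * p.2) i j
  -- This is ⌈k / c⌉. It is a fixed fraction of k, so that the probability beats the number of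
  -- choices, and yet at most w / c + 1, so that the entropy term 2l in `hρ` stays small against w.
  let l : ℕ → ℕ := fun k => (k + c - 1) / c
  have hcard : ∀ k, 0 < k → (S k).card ≤ (w * q) ^ (5 * m * k) := by
    intro k hk
    have h1 : SP.card ≤ (w * q) ^ m := card_finset_card_le F hw m
    have h2 : SV.card ≤ (w * q) ^ m := card_hammingNorm_le hw m
    have h3 : (S k).card = SP.card * SP.card * (SV.card ^ k * SV.card ^ k * w ^ k) := by
      simp [S, Fintype.card_piFinset]
    rw [h3]
    calc _ ≤ (w * q) ^ m * (w * q) ^ m * (((w * q) ^ m) ^ k * ((w * q) ^ m) ^ k * (w * q) ^ k) := by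
          gcongr
          exact Nat.le_mul_of_pos_right _ hq0
      _ = (w * q) ^ (m + m + (m * k + m * k + k)) := by
          rw [← pow_mul, ← pow_add, ← pow_add, ← pow_add, ← pow_add]
      _ ≤ _ := by
          refine Nat.pow_le_pow_right (Nat.mul_pos hw hq0) ?_
          -- The exponent 2m + 2mk + k is at most 5mk because k and m are positive.
          nlinarith [Nat.mul_le_mul_left m hk, Nat.mul_le_mul_right k hm]
  have hone : ∀ k, 0 < k → k ≤ w → ∀ θ ∈ S k,
      (Finset.univ.filter (ev k θ)).card * q ^ (e * l k) ≤ tot := by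
    intro k hk hkw θ hθ
    simp only [S, SP, Finset.mem_product, Finset.mem_filter, Finset.mem_univ, true_and] at hθ
    have hl1 : 0 < l k := Nat.div_pos (by omega) (by omega)
    have hl2 : 2 * l k ≤ k + 1 := by
      have h1 : c * l k ≤ k + c - 1 := Nat.mul_div_le _ _
      have h2 : 2 * (l k - 1) ≤ c * (l k - 1) := Nat.mul_le_mul_right _ hc
      have h3 : c * (l k - 1) = c * l k - c := by rw [Nat.mul_sub, mul_one]
      omega
    have hl3 : l k ≤ w / c + 1 := by
      rw [← Nat.add_div_right _ (by omega : 0 < c)]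
      exact Nat.div_le_div_right (by omega)
    by_cases hne : ∃ p, ev k θ p
    · obtain ⟨-, C, C', R, R', hC, hR, hCθ, hRθ, hCP, hRQ, -⟩ := hne
      have := card_pairs_mul_le (ρ := ρ) (ρ' := ρ') (e := e) θ.1.1 θ.1.2 hl1 hl2 C C' hC R R' hR
        hCP hRQ hθ.1.1 hθ.1.2
        (by rw [Fintype.card_fin]; omega) (by rw [Fintype.card_fin]; omega)
      rw [Fintype.card_fin] at this
      refine (Nat.mul_le_mul_right _ (Finset.card_le_card fun p hp => ?_)).trans this
      simp only [Finset.mem_filter, Finset.mem_univ, true_and] at hp ⊢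
      obtain ⟨C₁, -, R₁, -, -, -, hC₁, hR₁, -, -, hYX⟩ := hp
      obtain rfl : C₁ = C := hC₁.trans hCθ.symm
      obtain rfl : R₁ = R := hR₁.trans hRθ.symm
      exact hYX
    · have : Finset.univ.filter (ev k θ) = ∅ :=
        Finset.filter_eq_empty_iff.2 fun p _ hp => hne ⟨p, hp⟩
      rw [this]
      simp
  have hk : ∀ k ∈ Finset.Icc 1 w,
      (∑ θ ∈ S k, (Finset.univ.filter (ev k θ)).card) * (B * w) ≤ tot := by
    intro k hk
    rw [Finset.mem_Icc] at hk
    refine Nat.le_of_mul_le_mul_right (c := q ^ (e * l k)) ?_ (by positivity)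
    have h1 : (∑ θ ∈ S k, (Finset.univ.filter (ev k θ)).card) * q ^ (e * l k) ≤
        (S k).card * tot := by
      rw [Finset.sum_mul, ← smul_eq_mul (S k).card]
      exact Finset.sum_le_card_nsmul _ _ _ fun θ hθ => hone k hk.1 hk.2 θ hθ
    have hkl : k ≤ c * l k := by
      have h3 := Nat.div_add_mod (k + c - 1) c
      have h4 := Nat.mod_lt (k + c - 1) (by omega : 0 < c)
      have h5 : c * l k = c * ((k + c - 1) / c) := rfl
      omega
    have hl1 : l k ≠ 0 := by
      intro h0
      rw [h0] at hkl
      omega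
    -- As k ≤ c · l, this is hypothesis `hq` raised to the power l.
    have h2 : (S k).card * (B * w) ≤ q ^ (e * l k) := by
      calc _ ≤ (w * q) ^ (5 * m * (c * l k)) * (B * w) ^ l k := by
            refine Nat.mul_le_mul ((hcard k hk.1).trans (Nat.pow_le_pow_right
              (Nat.mul_pos hw hq0) (Nat.mul_le_mul_left _ hkl))) ?_
            exact Nat.le_self_pow hl1 _
        _ = (B * w * (w * q) ^ (5 * m * c)) ^ l k := by
            rw [mul_pow (B * w), ← pow_mul, mul_assoc (5 * m), mul_comm]
        _ ≤ (q ^ e) ^ l k := Nat.pow_le_pow_left hq _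
        _ = _ := (pow_mul _ _ _).symm
    calc _ = (∑ θ ∈ S k, (Finset.univ.filter (ev k θ)).card) * q ^ (e * l k) * (B * w) := by ring
      _ ≤ (S k).card * tot * (B * w) := Nat.mul_le_mul_right _ h1
      _ = tot * ((S k).card * (B * w)) := by ring
      _ ≤ _ := Nat.mul_le_mul_left _ h2
  -- Each of the w possible ranks contributes at most `tot / (B * w)`.
  refine Nat.le_of_mul_le_mul_right (c := w) ?_ hw
  calc _ ≤ (∑ k ∈ Finset.Icc 1 w, ∑ θ ∈ S k, (Finset.univ.filter (ev k θ)).card) * B * w := by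
        refine Nat.mul_le_mul_right _ (Nat.mul_le_mul_right _ ?_)
        refine le_trans (Finset.card_le_card (t := (Finset.Icc 1 w).biUnion fun k =>
          (S k).biUnion fun θ => Finset.univ.filter (ev k θ)) fun p hp => ?_)
          (Finset.card_biUnion_le.trans (Finset.sum_le_sum fun k _ => Finset.card_biUnion_le))
        simp only [Finset.mem_filter, Finset.mem_univ, true_and] at hp
        obtain ⟨N, P, Q, hN, hP, hQ, hNP, hNQ, hrow, hcol, hYX⟩ := hp
        obtain ⟨k, I, J, hk0, hkw, ⟨C', hC'⟩, ⟨R', hR'⟩, hfac⟩ := N.exists_eq_col_mul_row hN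
        rw [Fintype.card_fin] at hkw
        simp only [Finset.mem_biUnion, Finset.mem_filter, Finset.mem_univ, true_and]
        refine ⟨k, Finset.mem_Icc.2 ⟨hk0, hkw⟩, ((P, Q), (fun t i => N i (J t), fun t j => N (I t) j),
          I), ?_, N.submatrix id J, C', _, R', hC', hR', rfl, rfl, ?_, ?_, ?_⟩
        · simp [S, SP, SV, hP, hQ, hrow, hcol]
        · intro i hi
          funext t
          simp [hNP i hi]
        · intro j hj t
          rw [mul_apply]
          exact Finset.sum_eq_zero fun a _ => by simp [hNQ j hj]
        · rw [← hfac]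
          exact hYX
    _ = ∑ k ∈ Finset.Icc 1 w, (∑ θ ∈ S k, (Finset.univ.filter (ev k θ)).card) * (B * w) := by
        rw [Finset.sum_mul, Finset.sum_mul]
        exact Finset.sum_congr rfl fun k _ => by ring
    _ ≤ _ := by
        refine (Finset.sum_le_card_nsmul _ _ _ hk).trans_eq ?_
        rw [Nat.card_Icc, smul_eq_mul, mul_comm]
        simp

open Classical in
/-- Almost all pairs of generator matrices are robust. -/
theorem card_not_isRobustGenerators_mul_le {ρ ρ' : Type*} [Fintype ρ] [Fintype ρ'] (hw : 0 < w)
    {m e c : ℕ} (hm : 0 < m) (hc : 2 ≤ c)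
    (hρ : 2 * (w / c + 1) + Fintype.card ρ + m + e ≤ w)
    (hρ' : Fintype.card ρ' + m + e ≤ w)
    (hq : 256 * w * (w * Fintype.card F) ^ (5 * m * c) ≤ Fintype.card F ^ e) :
    (Finset.univ.filter fun p : Matrix (Fin w) ρ F × Matrix ρ' (Fin w) F =>
        ¬ IsRobustGenerators m p.1 p.2).card * 64 ≤
      Fintype.card F ^ (Fintype.card ρ * w + Fintype.card ρ' * w) := by
  have h1 := card_not_robust_mul_le (F := F) (ρ := ρ) (ρ' := ρ') hw hm hc hρ hρ' hq
  have h2 := card_not_dist_col_mul_le (F := F) (ρ := ρ) hw (d := 4 * m + 2) (e := e) (by omega)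
  have h3 := card_not_dist_row_mul_le (F := F) (ρ := ρ') hw (d := 4 * m + 2) (e := e) (by omega)
  set q := Fintype.card F with hqdef
  have hq0 : 0 < q := Fintype.card_pos
  set b₁ := (Finset.univ.filter fun p : Matrix (Fin w) ρ F × Matrix ρ' (Fin w) F =>
        ∃ (N : Matrix (Fin w) (Fin w) F) (P Q : Finset (Fin w)), N ≠ 0 ∧ P.card ≤ m ∧ Q.card ≤ m ∧
          (∀ i ∈ P, N i = 0) ∧ (∀ j ∈ Q, ∀ i, N i j = 0) ∧ (∀ i, hammingNorm (N i) ≤ m) ∧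
          (∀ j, hammingNorm (fun i => N i j) ≤ m) ∧
          ∃ (Y : Matrix ρ (Fin w) F) (X : Matrix (Fin w) ρ' F), ∀ i ∉ P, ∀ j ∉ Q,
            N i j = (p.1 * Y + X * p.2) i j)
  set b₂ := Finset.univ.filter fun g : Matrix (Fin w) ρ F =>
      ∃ v, v ≠ 0 ∧ hammingNorm v ≤ 4 * m + 2 ∧ ∃ y, g *ᵥ y = v
  set b₃ := Finset.univ.filter fun h : Matrix ρ' (Fin w) F =>
      ∃ v, v ≠ 0 ∧ hammingNorm v ≤ 4 * m + 2 ∧ ∃ y, y ᵥ* h = v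
  have hd : 256 * (w * q) ^ (4 * m + 2) ≤ q ^ e := by
    refine le_trans (Nat.mul_le_mul (Nat.le_mul_of_pos_right _ hw) (Nat.pow_le_pow_right
      (Nat.mul_pos hw hq0) ?_)) hq
    nlinarith [Nat.mul_le_mul_left m hc]
  have hb : ∀ b n : ℕ, b * q ^ e ≤ (w * q) ^ (4 * m + 2) * q ^ n → b * 256 ≤ q ^ n := by
    intro b n hb
    refine Nat.le_of_mul_le_mul_right (c := q ^ e) ?_ (by positivity)
    calc _ = 256 * (b * q ^ e) := by ring
      _ ≤ 256 * ((w * q) ^ (4 * m + 2) * q ^ n) := Nat.mul_le_mul_left _ hb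
      _ = q ^ n * (256 * (w * q) ^ (4 * m + 2)) := by ring
      _ ≤ _ := Nat.mul_le_mul_left _ hd
  have h2' := hb _ _ h2
  have h3' := hb _ _ h3
  have hcardh : (Finset.univ : Finset (Matrix ρ' (Fin w) F)).card = q ^ (Fintype.card ρ' * w) := by
    rw [Finset.card_univ]
    change Fintype.card (ρ' → Fin w → F) = _
    rw [Fintype.card_fun, Fintype.card_fun, ← pow_mul, mul_comm, Fintype.card_fin]
  have hcardg : (Finset.univ : Finset (Matrix (Fin w) ρ F)).card = q ^ (Fintype.card ρ * w) := by
    rw [Finset.card_univ]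
    change Fintype.card (Fin w → ρ → F) = _
    rw [Fintype.card_fun, Fintype.card_fun, ← pow_mul, Fintype.card_fin]
  have hsub : (Finset.univ.filter fun p : Matrix (Fin w) ρ F × Matrix ρ' (Fin w) F =>
        ¬ IsRobustGenerators m p.1 p.2) ⊆ b₁ ∪ (b₂ ×ˢ Finset.univ ∪ Finset.univ ×ˢ b₃) := by
    intro p hp
    by_contra hnot
    simp only [b₁, b₂, b₃, Finset.mem_filter, Finset.mem_univ, true_and, Finset.mem_union,
      Finset.mem_product, and_true, not_or] at hp hnot
    obtain ⟨n1, n2, n3⟩ := hnot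
    refine hp ⟨fun v hv hy => ?_, fun v hv hy => ?_, fun N P Q hP hQ hNP hNQ hr hc hYX => ?_⟩
    · by_contra hlt
      exact n2 ⟨v, hv, by omega, hy⟩
    · by_contra hlt
      exact n3 ⟨v, hv, by omega, hy⟩
    · by_contra hN
      exact n1 ⟨N, P, Q, hN, hP, hQ, hNP, hNQ, hr, hc, hYX⟩
  -- The three failures have densities at most 2/256, 1/256 and 1/256, which add up to 1/64.
  have hcard := (Finset.card_le_card hsub).trans ((Finset.card_union_le _ _).trans
    (Nat.add_le_add_left (Finset.card_union_le _ _) _))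
  rw [Finset.card_product, Finset.card_product, hcardh, hcardg] at hcard
  have h4 : b₂.card * q ^ (Fintype.card ρ' * w) * 256 ≤
      q ^ (Fintype.card ρ * w + Fintype.card ρ' * w) := by
    rw [pow_add]
    nlinarith [Nat.mul_le_mul_right (q ^ (Fintype.card ρ' * w)) h2']
  have h5 : q ^ (Fintype.card ρ * w) * b₃.card * 256 ≤
      q ^ (Fintype.card ρ * w + Fintype.card ρ' * w) := by
    rw [pow_add]
    nlinarith [Nat.mul_le_mul_left (q ^ (Fintype.card ρ * w)) h3']
  omega

end Counting

/-! ### Robust pairs in both orders, cut from invertible matrices. -/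

section Existence

open Matrix

variable {F : Type*} [Field F] 

/-- A constant lower bound does not survive multiplication by a further factor, so the induction
carries the surplus 2^-(n+2), half of which pays for each step. -/
theorem quarter_le_prod_one_sub_inv_pow {q : ℝ} (hq : 2 ≤ q) (w : ℕ) :
    1 / 4 ≤ ∏ i ∈ Finset.range w, (1 - (q ^ (i + 1))⁻¹) := by
  have key : ∀ n : ℕ, 1 / 4 + ((2 : ℝ) ^ (n + 2))⁻¹ ≤
      ∏ i ∈ Finset.range (n + 1), (1 - (q ^ (i + 1))⁻¹) := by
    intro n
    induction n with
    | zero =>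
      have : q⁻¹ ≤ 2⁻¹ := inv_anti₀ (by norm_num) hq
      simp only [zero_add, Finset.range_one, Finset.prod_singleton, pow_one]
      norm_num
      linarith
    | succ n ih =>
      rw [Finset.prod_range_succ]
      have h1 : (q ^ (n + 1 + 1))⁻¹ ≤ ((2 : ℝ) ^ (n + 2))⁻¹ :=
        inv_anti₀ (by positivity) (pow_le_pow_left₀ (by norm_num) hq _)
      have h2 : ((2 : ℝ) ^ (n + 2))⁻¹ ≤ 1 / 4 := by
        rw [one_div]
        refine inv_anti₀ (by norm_num) ?_
        calc (4 : ℝ) = 2 ^ 2 := by norm_num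
          _ ≤ 2 ^ (n + 2) := pow_le_pow_right₀ (by norm_num) (by omega)
      have h3 : ((2 : ℝ) ^ (n + 1 + 2))⁻¹ = ((2 : ℝ) ^ (n + 2))⁻¹ / 2 := by
        rw [show n + 1 + 2 = (n + 2) + 1 by ring, pow_succ, mul_inv, div_eq_mul_inv]
      have h4 : 0 < ((2 : ℝ) ^ (n + 2))⁻¹ := by positivity
      rw [h3]
      set x := ((2 : ℝ) ^ (n + 2))⁻¹
      calc 1 / 4 + x / 2 ≤ (1 / 4 + x) * (1 - x) := by nlinarith
        _ ≤ (1 / 4 + x) * (1 - (q ^ (n + 1 + 1))⁻¹) := by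
            refine mul_le_mul_of_nonneg_left ?_ (by positivity)
            linarith
        _ ≤ _ := mul_le_mul_of_nonneg_right ih (by linarith)
  cases w with
  | zero => norm_num
  | succ n => exact le_trans (le_add_of_nonneg_right (by positivity)) (key n)

theorem pow_le_four_mul_card_GL [Fintype F] (w : ℕ) :
    Fintype.card F ^ (w * w) ≤ 4 * Nat.card (GL (Fin w) F) := by
  rw [Matrix.card_GL_field]
  set q := Fintype.card F with hq
  have hq2 : 2 ≤ q := Fintype.one_lt_card
  have hqR : (2 : ℝ) ≤ q := by exact_mod_cast hq2
  have h1 : ((∏ i : Fin w, (q ^ w - q ^ (i : ℕ)) : ℕ) : ℝ) =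
      (q : ℝ) ^ (w * w) * ∏ i ∈ Finset.range w, (1 - ((q : ℝ) ^ (i + 1))⁻¹) := by
    rw [← Fin.prod_univ_eq_prod_range (fun i => 1 - ((q : ℝ) ^ (i + 1))⁻¹) w, ← Equiv.prod_comp Fin.revPerm,
      pow_mul, Nat.cast_prod]
    have : ((q : ℝ) ^ w) ^ w = ∏ _i : Fin w, (q : ℝ) ^ w := by simp
    rw [this, ← Finset.prod_mul_distrib]
    refine Finset.prod_congr rfl fun i _ => ?_
    have hi := i.2
    rw [Nat.cast_sub (Nat.pow_le_pow_right (by omega) (Fin.is_lt _).le), mul_sub, mul_one]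
    push_cast
    congr 1
    rw [← div_eq_mul_inv, eq_div_iff (by positivity), ← pow_add]
    congr 1
    simp only [Fin.revPerm_apply, Fin.val_rev]
    omega
  have h2 := quarter_le_prod_one_sub_inv_pow hqR w
  have h3 : (q : ℝ) ^ (w * w) ≤ 4 * ((∏ i : Fin w, (q ^ w - q ^ (i : ℕ)) : ℕ) : ℝ) := by
    rw [h1]
    have : (0 : ℝ) < (q : ℝ) ^ (w * w) := by positivity
    nlinarith
  exact_mod_cast h3

/-- Splitting `Fin w` into the first `r` and the last `w - r` indices. -/
def finSplit {r w : ℕ} (hr : r ≤ w) : Fin r ⊕ Fin (w - r) ≃ Fin w :=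
  finSumFinEquiv.trans (finCongr (by omega))

/-- The first `r` rows of an invertible matrix. -/
def topRows {r w : ℕ} (hr : r ≤ w) (T : Matrix (Fin w) (Fin w) F) : Matrix (Fin r) (Fin w) F :=
  T.submatrix (fun i => finSplit hr (Sum.inl i)) id

/-- The last `w - r` columns of a matrix. -/
def lastCols {r w : ℕ} (hr : r ≤ w) (U : Matrix (Fin w) (Fin w) F) :
    Matrix (Fin w) (Fin (w - r)) F :=
  U.submatrix id (fun i => finSplit hr (Sum.inr i))

section

variable {r w : ℕ} (hr : r ≤ w) {T U : Matrix (Fin w) (Fin w) F}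

/-- Since U inverts T, the last columns of U span the kernel of the top rows of T. One invertible
matrix thus supplies a parity check matrix and a generator matrix of the same code, which lets
robustness be imposed in both orders at once. -/
theorem exists_lastCols_mulVec_eq (hUT : U * T = 1) (v : Fin w → F)
    (hv : topRows hr T *ᵥ v = 0) : ∃ y, lastCols hr U *ᵥ y = v := by
  refine ⟨fun b => (T *ᵥ v) (finSplit hr (Sum.inr b)), ?_⟩
  have h1 : U *ᵥ (T *ᵥ v) = v := by rw [mulVec_mulVec, hUT, one_mulVec]
  conv_rhs => rw [← h1]
  funext i
  simp only [mulVec, dotProduct]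
  rw [← (finSplit hr).sum_comp (fun j => U i j * ∑ k, T j k * v k), Fintype.sum_sum_type]
  have h2 : ∀ a : Fin r, ∑ k, T (finSplit hr (Sum.inl a)) k * v k = 0 := fun a => congrFun hv a
  simp [h2, lastCols]

theorem exists_topRows_mulVec_eq (hTU : T * U = 1) (y : Fin r → F) :
    ∃ v, topRows hr T *ᵥ v = y := by
  let x : Fin w → F := fun j => Sum.elim y 0 ((finSplit hr).symm j)
  refine ⟨U *ᵥ x, ?_⟩
  have h1 : T *ᵥ (U *ᵥ x) = x := by rw [mulVec_mulVec, hTU, one_mulVec]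
  funext a
  refine (congrFun h1 (finSplit hr (Sum.inl a))).trans ?_
  simp [x]

theorem eq_zero_of_vecMul_topRows (hTU : T * U = 1) (a : Fin r → F)
    (ha : a ᵥ* topRows hr T = 0) : a = 0 := by
  have h1 : topRows hr T * U = (1 : Matrix (Fin w) (Fin w) F).submatrix
      (fun i => finSplit hr (Sum.inl i)) id := by
    rw [← hTU, submatrix_mul _ _ _ _ _ Function.bijective_id, submatrix_id_id]
    rfl
  have h2 : a ᵥ* (topRows hr T * U) = 0 := by rw [← vecMul_vecMul, ha, zero_vecMul]
  rw [h1] at h2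
  funext i
  have := congrFun h2 (finSplit hr (Sum.inl i))
  simpa [vecMul, dotProduct, one_apply] using this

end

variable [Fintype F] [DecidableEq F]

open Classical in
-- Passing to the retained columns and rows forgets only the other ones, so at most q^(rw + w(w -
-- r')) pairs of invertible matrices lie over one pair of generators. Densities relative to all
-- matrices carry over.
theorem card_GL_pairs_mul_le {r r' w : ℕ} (hr : r ≤ w) (hr' : r' ≤ w)
    (p : Matrix (Fin w) (Fin (w - r)) F × Matrix (Fin r') (Fin w) F → Prop)
    (hp : (Finset.univ.filter p).card * 64 ≤ Fintype.card F ^ ((w - r) * w + r' * w)) :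
    (Finset.univ.filter fun T : GL (Fin w) F × GL (Fin w) F =>
      p (lastCols hr (T.1⁻¹ : GL (Fin w) F).1, topRows hr' T.2.1)).card * 64 ≤
      Fintype.card F ^ (w * w + w * w) := by
  have h1 : (Finset.univ.filter fun T : GL (Fin w) F × GL (Fin w) F =>
      p (lastCols hr (T.1⁻¹ : GL (Fin w) F).1, topRows hr' T.2.1)).card ≤
      ((Finset.univ.filter p) ×ˢ
        (Finset.univ : Finset ((Fin w → Fin r → F) × (Fin (w - r') → Fin w → F)))).card := by
    refine Finset.card_le_card_of_injOn (fun T => ((lastCols hr (T.1⁻¹ : GL (Fin w) F).1,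
      topRows hr' T.2.1), (fun i a => (T.1⁻¹ : GL (Fin w) F).1 i (finSplit hr (Sum.inl a))),
      fun b j => T.2.1 (finSplit hr' (Sum.inr b)) j)) (fun T hT => ?_) ?_
    · simpa using hT
    · rintro ⟨T, T'⟩ - ⟨S, S'⟩ - h
      simp only [Prod.mk.injEq] at h
      obtain ⟨⟨h1, h2⟩, h3, h4⟩ := h
      have e1 : T⁻¹ = S⁻¹ := by
        refine Units.ext ?_
        ext i j
        obtain ⟨j, rfl⟩ := (finSplit hr).surjective j
        cases j with
        | inl a => exact congrFun (congrFun h3 i) a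
        | inr b => exact congrFun (congrFun h1 i) b
      have e2 : T' = S' := by
        refine Units.ext ?_
        ext i j
        obtain ⟨i, rfl⟩ := (finSplit hr').surjective i
        cases i with
        | inl a => exact congrFun (congrFun h2 a) j
        | inr b => exact congrFun (congrFun h4 b) j
      rw [inv_injective e1, e2]
  refine (Nat.mul_le_mul_right _ h1).trans ?_
  rw [Finset.card_product, Finset.card_univ, Fintype.card_prod]
  simp only [Fintype.card_fun, Fintype.card_fin]
  calc _ = (Finset.univ.filter p).card * 64 *
        (Fintype.card F ^ (r * w) * Fintype.card F ^ (w * (w - r'))) := by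
        rw [← pow_mul, ← pow_mul]
        ring
    _ ≤ _ := Nat.mul_le_mul_right _ hp
    _ = _ := by
        rw [← pow_add, ← pow_add]
        congr 1
        obtain ⟨s, rfl⟩ := Nat.exists_eq_add_of_le hr
        obtain ⟨s', hs'⟩ := Nat.exists_eq_add_of_le hr'
        rw [Nat.add_sub_cancel_left]
        have : r + s - r' = s' := by omega
        rw [this]
        calc _ = (r + s) * (r + s) + (r' + s') * (r + s) := by ring
          _ = _ := by rw [← hs']

/-- Existence of pairs of matrices which are robust in both orders. -/
theorem exists_isRobustPair {r r' w m e c : ℕ} (hw : 0 < w) (hr : r ≤ w) (hr' : r' ≤ w)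
    (hm : 0 < m) (hc : 2 ≤ c)
    (h₁ : 2 * (w / c + 1) + m + e ≤ r) (h₂ : 2 * (w / c + 1) + m + e ≤ r')
    (h₃ : r + m + e ≤ w) (h₄ : r' + m + e ≤ w)
    (hq : 256 * w * (w * Fintype.card F) ^ (5 * m * c) ≤ Fintype.card F ^ e) :
    ∃ (h : Matrix (Fin r) (Fin w) F) (h' : Matrix (Fin r') (Fin w) F),
      IsRobustPair m h h' ∧ IsRobustPair m h' h := by
  classical
  have b₁ := card_GL_pairs_mul_le hr hr' (fun p => ¬ IsRobustGenerators m p.1 p.2) (by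
    have := card_not_isRobustGenerators_mul_le (F := F) (ρ := Fin (w - r)) (ρ' := Fin r') hw hm hc
      (by rw [Fintype.card_fin]; omega) (by rw [Fintype.card_fin]; omega) hq
    simp only [Fintype.card_fin] at this
    convert this)
  have b₂ := card_GL_pairs_mul_le hr' hr (fun p => ¬ IsRobustGenerators m p.1 p.2) (by
    have := card_not_isRobustGenerators_mul_le (F := F) (ρ := Fin (w - r')) (ρ' := Fin r) hw hm hc
      (by rw [Fintype.card_fin]; omega) (by rw [Fintype.card_fin]; omega) hq
    simp only [Fintype.card_fin] at this
    convert this)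
  have hGL := pow_le_four_mul_card_GL (F := F) w
  rw [Nat.card_eq_fintype_card] at hGL
  set n := Fintype.card (GL (Fin w) F)
  have hq0 : 0 < Fintype.card F ^ (w * w) := by have := Fintype.card_pos (α := F); positivity
  have hn : Fintype.card F ^ (w * w + w * w) ≤ 16 * (n * n) := by
    rw [pow_add]
    calc _ ≤ (4 * n) * (4 * n) := Nat.mul_le_mul hGL hGL
      _ = _ := by ring
  set B₁ := Finset.univ.filter fun T : GL (Fin w) F × GL (Fin w) F =>
    ¬ IsRobustGenerators m (lastCols hr (T.1⁻¹ : GL (Fin w) F).1) (topRows hr' T.2.1)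
  set B₂ := Finset.univ.filter fun T : GL (Fin w) F × GL (Fin w) F =>
    ¬ IsRobustGenerators m (lastCols hr' (T.1⁻¹ : GL (Fin w) F).1) (topRows hr T.2.1)
  have b₁' : B₁.card * 64 ≤ Fintype.card F ^ (w * w + w * w) := by convert b₁
  have b₂' : B₂.card * 64 ≤ Fintype.card F ^ (w * w + w * w) := by convert b₂
  -- Invertible pairs make up at least 1/16 of all pairs of matrices, while the two orders fail on
  -- at most 2/64 of them. Swapping the components puts both failures on the same pair.
  obtain ⟨T, hT⟩ : ∃ T : GL (Fin w) F × GL (Fin w) F, T ∉ B₁ ∪ B₂.image Prod.swap := by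
    by_contra hall
    push Not at hall
    have h1 : n * n ≤ B₁.card + B₂.card := by
      have : (Finset.univ : Finset (GL (Fin w) F × GL (Fin w) F)).card = n * n := by
        rw [Finset.card_univ, Fintype.card_prod]
      rw [← this]
      refine (Finset.card_le_card fun T _ => hall T).trans ((Finset.card_union_le _ _).trans ?_)
      exact Nat.add_le_add_left Finset.card_image_le _
    have h2 : 0 < Fintype.card F ^ (w * w + w * w) := by rw [pow_add]; positivity
    omega
  simp only [B₁, B₂, Finset.mem_union, Finset.mem_image, Finset.mem_filter, Finset.mem_univ,
    true_and, not_or, not_not, not_exists, not_and] at hT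
  obtain ⟨g₁, hT₂⟩ := hT
  have g₂ : IsRobustGenerators m (lastCols hr' (T.2⁻¹ : GL (Fin w) F).1) (topRows hr T.1.1) := by
    by_contra hne
    exact hT₂ T.swap hne rfl
  have e₁ : (T.1⁻¹ : GL (Fin w) F).1 * T.1.1 = 1 := T.1.inv_mul
  have e₁' : T.1.1 * (T.1⁻¹ : GL (Fin w) F).1 = 1 := T.1.mul_inv
  have e₂ : (T.2⁻¹ : GL (Fin w) F).1 * T.2.1 = 1 := T.2.inv_mul
  have e₂' : T.2.1 * (T.2⁻¹ : GL (Fin w) F).1 = 1 := T.2.mul_inv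
  exact ⟨topRows hr T.1.1, topRows hr' T.2.1,
    g₁.isRobustPair _ (exists_lastCols_mulVec_eq hr e₁) (exists_topRows_mulVec_eq hr e₁')
      (eq_zero_of_vecMul_topRows hr' e₂'),
    g₂.isRobustPair _ (exists_lastCols_mulVec_eq hr' e₂) (exists_topRows_mulVec_eq hr' e₂')
      (eq_zero_of_vecMul_topRows hr e₁')⟩

end Existence

/-! ### Consequences of edge expansion. -/

namespace OrientedGraph

section Expansion

variable {V E : Type*} (Γ : OrientedGraph V E)

theorem inc_iff {e : E} {v : V} : Γ.Inc e v ↔ v = Γ.src e ∨ v = Γ.tgt e := Sym2.mem_iff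

theorem Inc.exists_connects {Γ : OrientedGraph V E} {e : E} {v : V} (h : Γ.Inc e v) :
    ∃ t, Γ.Connects e v t := by
  obtain ⟨t, ht⟩ := Sym2.mem_iff_exists.1 h
  exact ⟨t, ht⟩

theorem Connects.inc {Γ : OrientedGraph V E} {e : E} {v t : V} (h : Γ.Connects e v t) :
    Γ.Inc e v := by
  unfold Inc
  rw [h]
  exact Sym2.mem_mk_left _ _

theorem Connects.inc' {Γ : OrientedGraph V E} {e : E} {v t : V} (h : Γ.Connects e v t) :
    Γ.Inc e t := by
  unfold Inc
  rw [h]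
  exact Sym2.mem_mk_right _ _

variable [Fintype V]

open Classical in
theorem card_filter_inc_le (e : E) : (Finset.univ.filter fun v => Γ.Inc e v).card ≤ 2 := by
  refine (Finset.card_le_card (t := {Γ.src e, Γ.tgt e}) fun v hv => ?_).trans Finset.card_le_two
  simpa [inc_iff] using hv

variable [Fintype E] {Γ} {a lam : ℝ}

open Classical in
-- Attaching to an incident pair (v, e) the other end of e embeds the pairs counted on the left into
-- E(S, U).
theorem IsEdgeExpanding.sum_card_le (hΓ : Γ.IsEdgeExpanding a lam) (S U : Finset V) (Z : Finset E)
    (hS : (S.card : ℝ) ≤ a) (hU : (U.card : ℝ) ≤ a)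
    (hZ : ∀ e ∈ Z, ∀ v ∈ S, ∀ t, Γ.Connects e v t → t ∈ U) :
    ((∑ v ∈ S, (Z.filter fun e => Γ.Inc e v).card : ℕ) : ℝ) ≤
      lam * √((S.card : ℝ) * U.card) := by
  have h1 := hΓ (S : Set V) (U : Set V) (by rwa [Set.ncard_coe_finset])
    (by rwa [Set.ncard_coe_finset])
  rw [Set.ncard_coe_finset, Set.ncard_coe_finset] at h1
  refine le_trans (Nat.cast_le.2 ?_) h1
  rw [← Finset.card_sigma, ← Set.ncard_coe_finset]
  have hex : ∀ p : Σ _ : V, E, ∃ t, Γ.Inc p.2 p.1 → Γ.Connects p.2 p.1 t := fun p => by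
    by_cases h : Γ.Inc p.2 p.1
    · obtain ⟨t, ht⟩ := h.exists_connects
      exact ⟨t, fun _ => ht⟩
    · exact ⟨p.1, fun h' => absurd h' h⟩
  choose t ht using hex
  refine Set.ncard_le_ncard_of_injOn (fun p => (p.1, p.2, t p)) ?_ ?_ (Set.toFinite _)
  · rintro ⟨v, e⟩ hp
    simp only [Finset.coe_sigma, Set.mem_sigma_iff, Finset.mem_coe, Finset.mem_filter] at hp
    exact ⟨hp.1, hZ e hp.2.1 v hp.1 _ (ht ⟨v, e⟩ hp.2.2), ht ⟨v, e⟩ hp.2.2⟩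
  · rintro ⟨v, e⟩ - ⟨v', e'⟩ - h
    simp only [Prod.mk.injEq] at h
    obtain ⟨rfl, rfl, -⟩ := h
    rfl

open Classical in
/-- In an expanding graph, a small set of edges has few edges at `T` if the vertices outside `T`
are incident to no or to many of its edges. -/
theorem IsEdgeExpanding.sum_card_le_of_forall (hΓ : Γ.IsEdgeExpanding a lam) (hlam : 0 < lam)
    (Z : Finset E) (T : Finset V) (hZ : 2 * (Z.card : ℝ) ≤ a) (d : ℕ) (hd : 2 * lam ≤ d)
    (hT : ∀ v ∉ T, (Z.filter fun e => Γ.Inc e v).card = 0 ∨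
      d ≤ (Z.filter fun e => Γ.Inc e v).card) :
    ((∑ v ∈ T, (Z.filter fun e => Γ.Inc e v).card : ℕ) : ℝ) ≤ 2 * lam * T.card ∧
      (T = ∅ → Z = ∅) := by
  set deg : V → ℕ := fun v => (Z.filter fun e => Γ.Inc e v).card with hdeg
  set U := Finset.univ.filter fun v => deg v ≠ 0 with hUdef
  have hmemU : ∀ e ∈ Z, ∀ t, Γ.Inc e t → t ∈ U := by
    intro e he t ht
    rw [hUdef, Finset.mem_filter]
    refine ⟨Finset.mem_univ _, Finset.card_ne_zero_of_mem (Finset.mem_filter.2 ⟨he, ht⟩)⟩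
  have hUZ : U.card ≤ 2 * Z.card := by
    calc U.card ≤ ∑ v ∈ U, deg v := by
          rw [Finset.card_eq_sum_ones]
          exact Finset.sum_le_sum fun v hv => Nat.one_le_iff_ne_zero.2 (Finset.mem_filter.1 hv).2
      _ ≤ ∑ v, deg v := Finset.sum_le_sum_of_subset (Finset.subset_univ _)
      _ = ∑ e ∈ Z, (Finset.univ.filter fun v => Γ.Inc e v).card := by
          simp only [hdeg, Finset.card_filter]
          rw [Finset.sum_comm]
      _ ≤ ∑ e ∈ Z, 2 := Finset.sum_le_sum fun e _ => Γ.card_filter_inc_le e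
      _ = _ := by rw [Finset.sum_const, smul_eq_mul, mul_comm]
  have hUa : (U.card : ℝ) ≤ a := by
    refine le_trans ?_ hZ
    exact_mod_cast hUZ
  have key : ∀ S ⊆ U, ((∑ v ∈ S, deg v : ℕ) : ℝ) ≤ lam * √((S.card : ℝ) * U.card) := by
    intro S hS
    refine hΓ.sum_card_le S U Z (le_trans ?_ hUa) hUa fun e he v _ t ht => hmemU e he t ht.inc'
    exact_mod_cast Finset.card_le_card hS
  set S := U \ T
  set T' := U ∩ T
  have hcard : U.card = S.card + T'.card := (Finset.card_sdiff_add_card_inter U T).symm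
  have hST : S.card ≤ T'.card := by
    by_contra hlt
    push Not at hlt
    have h1 := key S Finset.sdiff_subset
    have h2 : d * S.card ≤ ∑ v ∈ S, deg v := by
      rw [mul_comm, ← smul_eq_mul]
      refine Finset.card_nsmul_le_sum _ _ _ fun v hv => ?_
      rw [Finset.mem_sdiff] at hv
      rcases hT v hv.2 with h | h
      · exact absurd h (Finset.mem_filter.1 hv.1).2
      · exact h
    have h3 : (d : ℝ) * S.card ≤ lam * √((S.card : ℝ) * U.card) := by
      refine le_trans ?_ h1
      exact_mod_cast h2
    have hS0 : (0 : ℝ) < S.card := by exact_mod_cast (Nat.zero_le _).trans_lt hlt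
    have h4 : √((S.card : ℝ) * U.card) < 2 * S.card := by
      rw [Real.sqrt_lt' (by positivity)]
      have : (U.card : ℝ) < 2 * S.card := by
        have : U.card < 2 * S.card := by omega
        exact_mod_cast this
      nlinarith
    nlinarith
  have hT' : (T'.card : ℝ) ≤ T.card := by exact_mod_cast Finset.card_le_card Finset.inter_subset_right
  have hU2 : (U.card : ℝ) ≤ 2 * T'.card := by
    have : U.card ≤ 2 * T'.card := by omega
    exact_mod_cast this
  constructor
  · have h1 : ∑ v ∈ T, deg v = ∑ v ∈ T', deg v := by
      refine (Finset.sum_subset Finset.inter_subset_right fun v hv hv' => ?_).symm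
      by_contra hne
      exact hv' (Finset.mem_inter.2 ⟨Finset.mem_filter.2 ⟨Finset.mem_univ _, hne⟩, hv⟩)
    have h2 : √((T'.card : ℝ) * U.card) ≤ 2 * T'.card := by
      rw [Real.sqrt_le_left (by positivity)]
      nlinarith [(Nat.cast_nonneg T'.card : (0 : ℝ) ≤ _)]
    calc _ = ((∑ v ∈ T', deg v : ℕ) : ℝ) := by rw [h1]
      _ ≤ _ := key T' Finset.inter_subset_left
      _ ≤ lam * (2 * T'.card) := mul_le_mul_of_nonneg_left h2 hlam.le
      _ ≤ _ := by nlinarith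
  · intro h0
    have hU0 : U = ∅ := by
      rw [← Finset.card_eq_zero]
      have : T'.card = 0 := by simp [T', h0]
      omega
    rw [Finset.eq_empty_iff_forall_notMem]
    intro e he
    have := hmemU e he _ (Γ.src_inc e)
    simp [hU0] at this

end Expansion

/-! ### Lifted Tanner complexes in the coordinates of the lift. -/

section Lift

variable {V E G : Type*} [Group G] (Γ : OrientedGraph V E) (γ : E → G)

open Classical in
/-- The lift of the edge `e` at the lift `(v, g)` of an end point `v` is `(e, shift v e * g)`. -/
noncomputable def shift (v : V) (e : E) : G := if Γ.src e = v then 1 else (γ e)⁻¹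

variable {Γ}

theorem lift_inc_iff (hΓ : ∀ e, Γ.src e ≠ Γ.tgt e) {e : E} {g k : G} {v : V} :
    (Γ.lift γ).Inc (e, g) (v, k) ↔ Γ.Inc e v ∧ g = Γ.shift γ v e * k := by
  simp only [inc_iff, lift, Prod.mk.injEq]
  constructor
  · rintro (⟨rfl, rfl⟩ | ⟨rfl, rfl⟩)
    · simp [shift]
    · simp [shift, hΓ e]
  · rintro ⟨rfl | rfl, rfl⟩
    · simp [shift]
    · simp [shift, hΓ e]

open Classical in
theorem card_filter_lift_inc [Fintype V] [Fintype E] [Fintype G]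
    (hΓ : ∀ e, Γ.src e ≠ Γ.tgt e) (Z : Finset (E × G)) (v : V)
    (k : G) : (Z.filter fun e => (Γ.lift γ).Inc e (v, k)).card =
      (Finset.univ.filter fun e : Γ.Star v => (e.1, Γ.shift γ v e * k) ∈ Z).card := by
  symm
  refine Finset.card_bij (fun e _ => (e.1, Γ.shift γ v e * k)) ?_ ?_ ?_
  · intro e he
    rw [Finset.mem_filter] at he ⊢
    exact ⟨he.2, (lift_inc_iff γ hΓ).2 ⟨e.2, rfl⟩⟩
  · intro e _ e' _ h
    exact Subtype.ext (Prod.mk.inj h).1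
  · rintro ⟨e, g⟩ he
    rw [Finset.mem_filter, lift_inc_iff γ hΓ] at he
    obtain ⟨h1, h2, rfl⟩ := he
    exact ⟨⟨e, h2⟩, by simpa using h1, rfl⟩

/-- Without loops, exactly one of the two summands in `liftedTanner` is active at a given end of an
edge, and `shift` records its group element. -/
theorem liftedTanner_coeff {F : Type*} [Field F] {r : ℕ} (hΓ : ∀ e, Γ.src e ≠ Γ.tgt e)
    (D : LocalMaps F Γ r) (v : V) (k : Fin r)
    (e : Γ.Star v) (g : G) :
    ((liftedTanner D γ).mat (v, k) (e.1, ())).coeff g =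
      haveI := Classical.dec (g = (Γ.shift γ v e)⁻¹)
      if g = (Γ.shift γ v e)⁻¹ then D v k e else 0 := by
  classical
  obtain ⟨e, he⟩ := e
  have h1 := hΓ e
  rcases Γ.inc_iff.1 he with rfl | rfl
  · simp [liftedTanner, shift, h1, Finsupp.single_apply, eq_comm]
  · simp [liftedTanner, shift, h1, h1.symm, Finsupp.single_apply, eq_comm]

theorem liftedTanner_coeff_of_not_inc {F : Type*} [Field F] {r : ℕ} (D : LocalMaps F Γ r) (v : V)
    (k : Fin r) (e : E) (he : ¬ Γ.Inc e v) (g : G) :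
    ((liftedTanner D γ).mat (v, k) (e, ())).coeff g = 0 := by
  rw [inc_iff, not_or] at he
  simp [liftedTanner, he.1, he.2]

theorem leftBoundary_liftedTanner {F : Type*} [Field F] [Fintype V] [Fintype E] [Fintype G] {r : ℕ}
    (hΓ : ∀ e, Γ.src e ≠ Γ.tgt e) (D : LocalMaps F Γ r) (Y ι : Type*) [∀ v, Fintype (Γ.Star v)]
    (c : LocalChain F (fun _ : E × G × Y => Unit × ι))
    (v : V) (g : G) (y : Y) (k : Fin r) (i : ι) :
    leftBoundary (liftedTanner D γ) Y ι c (v, g, y) (k, i) =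
      ∑ e : Γ.Star v, D v k e * c (e.1, Γ.shift γ v e * g, y) ((), i) := by
  classical
  have h1 : ∀ e : Γ.Star v, ∑ g' : G, ((liftedTanner D γ).mat (v, k) (e.1, ())).coeff (g * g'⁻¹) *
      c (e.1, g', y) ((), i) = D v k e * c (e.1, Γ.shift γ v e * g, y) ((), i) := by
    intro e
    rw [Finset.sum_eq_single (Γ.shift γ v e * g)]
    · rw [liftedTanner_coeff γ hΓ, if_pos (by group)]
    · intro g' _ hg'
      rw [liftedTanner_coeff γ hΓ, if_neg, zero_mul]
      intro h
      refine hg' ?_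
      rw [← mul_inv_eq_iff_eq_mul, ← inv_inj, ← h]
      group
    · simp
  simp only [leftBoundary, LinearMap.coe_mk, AddHom.coe_mk, Finset.univ_unique,
    Finset.sum_singleton, PUnit.default_eq_unit]
  rw [← Finset.sum_congr rfl fun e _ => h1 e]
  symm
  refine Finset.sum_of_injOn Subtype.val Subtype.val_injective.injOn (by simp) ?_ (fun _ _ => rfl)
  intro e _ he
  refine Finset.sum_eq_zero fun g' _ => ?_
  rw [liftedTanner_coeff_of_not_inc, zero_mul]
  intro hinc
  exact he ⟨⟨e, hinc⟩, by simp⟩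

open Classical in
-- Here `shift` multiplies on the right, whereas in the lift it multiplies on the left. This is why
-- g⁻¹, and not g, is the group coordinate of a vertex of the lift in `vertexSupport`.
theorem rightBoundary_liftedTanner {F : Type*} [Field F] [Fintype V] [Fintype E] [Fintype G] {r : ℕ}
    (hΓ : ∀ e, Γ.src e ≠ Γ.tgt e) (D : LocalMaps F Γ r) (X κ : Type*)
    (c : LocalChain F (fun _ : X × G × V => κ × Fin r))
    (x : X) (g : G) (e : E) (i : κ) :
    rightBoundary (liftedTanner D γ).dual X κ c (x, g, e) (i, ()) =
      ∑ v : V, if h : Γ.Inc e v then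
        ∑ k, D v k ⟨e, h⟩ * c (x, g * Γ.shift γ v e, v) (i, k) else 0 := by
  simp only [rightBoundary, LinearMap.coe_mk, AddHom.coe_mk, RightComplex.dual]
  refine Finset.sum_congr rfl fun v _ => ?_
  split_ifs with h
  · refine Finset.sum_congr rfl fun k _ => ?_
    rw [Finset.sum_eq_single (g * Γ.shift γ v e)]
    · rw [liftedTanner_coeff γ hΓ D v k ⟨e, h⟩, if_pos (by group)]
    · intro g' _ hg'
      rw [liftedTanner_coeff γ hΓ D v k ⟨e, h⟩, if_neg, zero_mul]
      intro h'
      refine hg' ?_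
      rw [← inv_mul_eq_iff_eq_mul, ← inv_inj, ← h']
      group
    · simp
  · refine Finset.sum_eq_zero fun k _ => Finset.sum_eq_zero fun g' _ => ?_
    rw [liftedTanner_coeff_of_not_inc γ D v k e h, zero_mul]

end Lift

end OrientedGraph

/-! ### Small locally minimal cycles vanish. -/

namespace OrientedGraph

section Cycles

open Matrix
open Classical

variable {F : Type*} [Field F] {V E G : Type*} [Group G] [Fintype V] [Fintype E]
  {Γ : OrientedGraph V E} {γ : E → G} {r r' w m : ℕ} {D : LocalMaps F Γ r} {D' : LocalMaps F Γ r'}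

variable (Γ γ) in
/-- The number of edges `e'` at `v'` along which the cell `(v, g, v')` has a neighbour in the
support of `x`. -/
noncomputable def neighbourCount (x : V → G → V → Matrix (Fin r) (Fin r') F) (v : V) (g : G)
    (v' : V) : ℕ :=
  (Finset.univ.filter fun e' : Γ.Star v' => ∃ v'' ≠ v', Γ.Inc e' v'' ∧
    x v (g * (Γ.shift γ v' e')⁻¹ * Γ.shift γ v'' e') v'' ≠ 0).card

variable (Γ γ) in
/-- The number of cells in the support of `y` at the cell `(v, g, e')`. -/
noncomputable def colWeight (y : E → G → E → F) (v : V) (g : G) (e' : E) : ℕ :=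
  (Finset.univ.filter fun e : Γ.Star v => y e (Γ.shift γ v e * g) e' ≠ 0).card

/-- If this failed, there would be at most 2λ neighbours and at most 8λw entries in the local
matrix; `h₁` and `h₂` turn this into the smallness required by `IsRobustPair.eq_zero`. The weight 4w
makes the two terms on the right comparable: each will average at most 4λw. -/
theorem lt_neighbourCount_add {x : V → G → V → Matrix (Fin r) (Fin r') F} {y : E → G → E → F}
    {lam : ℝ} (hw0 : 0 < w) (hrob : ∀ v v', IsRobustPair m (D v) (D' v'))
    (h₁ : 4 * lam ≤ m) (h₂ : 16 * lam * w ≤ m * m)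
    (hcyc : ∀ v g e' k, (∑ e : Γ.Star v, D v k e * y e (Γ.shift γ v e * g) e') +
      (∑ v', if h : Γ.Inc e' v' then
        ∑ l, D' v' l ⟨e', h⟩ * x v (g * Γ.shift γ v' e') v' k l else 0) = 0)
    (hmin : ∀ e g v' (a : Fin r' → F),
      hammingNorm (fun e' : Γ.Star v' => y e (g * (Γ.shift γ v' e')⁻¹) e') ≤
        hammingNorm (fun e' : Γ.Star v' => y e (g * (Γ.shift γ v' e')⁻¹) e' -
          (a ᵥ* D' v') e') + 2)
    (v : V) (g : G) (v' : V) (hx : x v g v' ≠ 0) :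
    8 * lam * w < 4 * w * (Γ.neighbourCount γ x v g v' : ℝ) +
      (∑ e' : Γ.Star v', Γ.colWeight γ y v (g * (Γ.shift γ v' e')⁻¹) e' : ℕ) := by
  by_contra hle
  push Not at hle
  set n := Γ.neighbourCount γ x v g v' with hn
  set M : Matrix (Γ.Star v) (Γ.Star v') F := fun e e' =>
    y e (Γ.shift γ v e * (g * (Γ.shift γ v' e')⁻¹)) e' with hM
  have hMcard : (∑ e' : Γ.Star v', Γ.colWeight γ y v (g * (Γ.shift γ v' e')⁻¹) e') =
      (Finset.univ.filter fun z : Γ.Star v × Γ.Star v' => M z.1 z.2 ≠ 0).card := by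
    simp only [colWeight, Finset.card_filter, Fintype.sum_prod_type_right, hM]
  rw [hMcard] at hle
  set b := (Finset.univ.filter fun z : Γ.Star v × Γ.Star v' => M z.1 z.2 ≠ 0).card
  have hwR : (0 : ℝ) < w := by exact_mod_cast hw0
  have hn0 : (0 : ℝ) ≤ n := Nat.cast_nonneg _
  have hb0 : (0 : ℝ) ≤ b := Nat.cast_nonneg _
  refine hx ((hrob v v').eq_zero M (x v g v') (Finset.univ.filter fun e' : Γ.Star v' =>
    ∃ v'' ≠ v', Γ.Inc e' v'' ∧ x v (g * (Γ.shift γ v' e')⁻¹ * Γ.shift γ v'' e') v'' ≠ 0)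
    ?_ ?_ ?_ ?_)
  · change 2 * n ≤ m
    have h3 : (n : ℝ) ≤ 2 * lam := by nlinarith
    have : (2 : ℝ) * n ≤ m := by linarith
    exact_mod_cast this
  · have : (2 : ℝ) * b ≤ m * m := by nlinarith
    exact_mod_cast this
  · intro k e' he'
    have h3 := hcyc v (g * (Γ.shift γ v' e')⁻¹) e' k
    rw [Finset.sum_eq_single v'] at h3
    · rw [dif_pos e'.2, inv_mul_cancel_right] at h3
      rw [Matrix.add_apply, mul_apply, mul_apply]
      convert h3 using 2
      exact Finset.sum_congr rfl fun l _ => mul_comm _ _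
    · intro v'' _ hv''
      split_ifs with hinc
      · simp only [Finset.mem_filter, Finset.mem_univ, true_and, not_exists, not_and,
          not_not] at he'
        rw [he' v'' hv'' hinc]
        simp
      · rfl
    · simp
  · intro e a
    have := hmin e (Γ.shift γ v e * g) v' a
    simp only [mul_assoc] at this
    exact this

variable [Fintype G]

/-- The cells `(v, k⁻¹, v')` in the support of `x`, as vertices `(v', k)` of the lift. -/
noncomputable def vertexSupport (x : V → G → V → Matrix (Fin r) (Fin r') F) (v : V) :
    Finset (V × G) :=
  Finset.univ.filter fun p => x v p.2⁻¹ p.1 ≠ 0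

/-- The cells `(e, g, e')` in the support of `y`, as edges `(e, g)` of the lift. -/
noncomputable def edgeSupport (y : E → G → E → F) (e' : E) : Finset (E × G) :=
  Finset.univ.filter fun p => y p.1 p.2 e' ≠ 0

theorem card_filter_edgeSupport (hΓ : ∀ e, Γ.src e ≠ Γ.tgt e) (y : E → G → E → F) (e' : E)
    (v : V) (g : G) : ((edgeSupport y e').filter fun e => (Γ.lift γ).Inc e (v, g)).card =
      Γ.colWeight γ y v g e' := by
  rw [card_filter_lift_inc γ hΓ]
  simp [edgeSupport, colWeight]

theorem sum_neighbourCount_le (hΓ : ∀ e, Γ.src e ≠ Γ.tgt e) {a lam : ℝ}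
    (hexp : (Γ.lift γ).IsEdgeExpanding a lam) (x : V → G → V → Matrix (Fin r) (Fin r') F) (v : V)
    (ha : ((vertexSupport x v).card : ℝ) ≤ a) :
    ((∑ p ∈ vertexSupport x v, Γ.neighbourCount γ x v p.2⁻¹ p.1 : ℕ) : ℝ) ≤
      lam * (vertexSupport x v).card := by
  set S := vertexSupport x v with hS
  -- `Z` consists of the edges with every end in the support. The edges counted by `neighbourCount`
  -- at a point of the support belong to it, since an edge has no ends besides v' and v''.
  set Z : Finset (E × G) := Finset.univ.filter fun p => ∀ v'', Γ.Inc p.1 v'' →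
    x v (p.2⁻¹ * Γ.shift γ v'' p.1) v'' ≠ 0 with hZ
  have h1 := hexp.sum_card_le S S Z ha ha (by
    rintro ⟨e, g⟩ he _ - ⟨v'', k⟩ hc
    have h2 := (lift_inc_iff γ hΓ).1 hc.inc'
    simp only [hZ, Finset.mem_filter, Finset.mem_univ, true_and] at he
    simp only [hS, vertexSupport, Finset.mem_filter, Finset.mem_univ, true_and]
    have := he v'' h2.1
    rwa [h2.2, _root_.mul_inv_rev, inv_mul_cancel_right] at this)
  rw [Real.sqrt_mul_self (Nat.cast_nonneg _)] at h1
  refine le_trans (Nat.cast_le.2 (Finset.sum_le_sum ?_)) h1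
  rintro ⟨v', k⟩ hp
  rw [card_filter_lift_inc γ hΓ, neighbourCount]
  refine Finset.card_le_card fun e' he' => ?_
  simp only [Finset.mem_filter, Finset.mem_univ, true_and] at he' ⊢
  obtain ⟨v'', hne, hinc, hx⟩ := he'
  simp only [hZ, Finset.mem_filter, Finset.mem_univ, true_and]
  intro u hu
  simp only [hS, vertexSupport, Finset.mem_filter, Finset.mem_univ, true_and] at hp
  have h3 : u = v' ∨ u = v'' := by
    have h4 := Γ.inc_iff.1 hu
    have h5 := Γ.inc_iff.1 hinc
    have h6 := Γ.inc_iff.1 e'.2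
    grind
  rw [_root_.mul_inv_rev]
  rcases h3 with rfl | rfl
  · rwa [inv_mul_cancel_right]
  · exact hx

/-- Double counting of the pairs of a cell in the support of `x` and an incident edge on the
right. -/
theorem sum_vertexSupport_sum (x : V → G → V → Matrix (Fin r) (Fin r') F) (f : V → G → E → ℕ) :
    ∑ v, ∑ p ∈ vertexSupport x v, ∑ e' : Γ.Star p.1, f v (p.2⁻¹ * (Γ.shift γ p.1 e')⁻¹) e' =
      ∑ e', ∑ p : V × G, (Finset.univ.filter fun v' => Γ.Inc e' v' ∧
        x p.1 (p.2 * Γ.shift γ v' e') v' ≠ 0).card * f p.1 p.2 e' := by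
  have h1 : ∀ v, ∑ p ∈ vertexSupport x v, ∑ e' : Γ.Star p.1,
      f v (p.2⁻¹ * (Γ.shift γ p.1 e')⁻¹) e' = ∑ v', ∑ e', ∑ g,
        if Γ.Inc e' v' ∧ x v (g * Γ.shift γ v' e') v' ≠ 0 then f v g e' else 0 := by
    intro v
    rw [vertexSupport, Finset.sum_filter, Fintype.sum_prod_type]
    refine Finset.sum_congr rfl fun v' _ => ?_
    calc _ = ∑ k : G, ∑ e' : E, if Γ.Inc e' v' ∧ x v k⁻¹ v' ≠ 0 then
          f v (k⁻¹ * (Γ.shift γ v' e')⁻¹) e' else 0 := by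
          refine Finset.sum_congr rfl fun k _ => ?_
          by_cases hx : x v k⁻¹ v' = 0
          · simp [hx]
          · simp only [ne_eq, hx, not_false_eq_true, if_true, and_true]
            rw [← Finset.sum_filter]
            exact (Finset.sum_subtype _ (by simp) fun e' =>
              f v (k⁻¹ * (Γ.shift γ v' e')⁻¹) e').symm
      _ = ∑ e' : E, ∑ k : G, if Γ.Inc e' v' ∧ x v k⁻¹ v' ≠ 0 then
          f v (k⁻¹ * (Γ.shift γ v' e')⁻¹) e' else 0 := Finset.sum_comm
      _ = _ := by
          refine Finset.sum_congr rfl fun e' _ => ?_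
          refine Fintype.sum_equiv ((Equiv.inv G).trans (Equiv.mulRight (Γ.shift γ v' e')⁻¹))
            _ _ fun k => ?_
          simp
  simp only [h1]
  calc _ = ∑ v, ∑ e', ∑ v', ∑ g,
        if Γ.Inc e' v' ∧ x v (g * Γ.shift γ v' e') v' ≠ 0 then f v g e' else 0 :=
        Finset.sum_congr rfl fun v _ => Finset.sum_comm
    _ = ∑ e', ∑ v, ∑ v', ∑ g,
        if Γ.Inc e' v' ∧ x v (g * Γ.shift γ v' e') v' ≠ 0 then f v g e' else 0 := Finset.sum_comm
    _ = _ := by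
        refine Finset.sum_congr rfl fun e' _ => ?_
        rw [Fintype.sum_prod_type]
        refine Finset.sum_congr rfl fun v _ => ?_
        rw [Finset.sum_comm]
        refine Finset.sum_congr rfl fun g _ => ?_
        rw [← Finset.sum_filter, Finset.sum_const, smul_eq_mul]

/-- Small locally minimal cycles vanish. -/
theorem eq_zero_of_cycle {x : V → G → V → Matrix (Fin r) (Fin r') F} {y : E → G → E → F}
    {a lam : ℝ} (hΓ : ∀ e, Γ.src e ≠ Γ.tgt e) (hexp : (Γ.lift γ).IsEdgeExpanding a lam)
    (hw0 : 0 < w) (hw : ∀ v, Fintype.card (Γ.Star v) = w)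
    (hrob : ∀ v v', IsRobustPair m (D v) (D' v'))
    (hlam : 0 < lam) (h₁ : 4 * lam ≤ m) (h₂ : 16 * lam * w ≤ m * m)
    (hcyc : ∀ v g e' k, (∑ e : Γ.Star v, D v k e * y e (Γ.shift γ v e * g) e') +
      (∑ v', if h : Γ.Inc e' v' then
        ∑ l, D' v' l ⟨e', h⟩ * x v (g * Γ.shift γ v' e') v' k l else 0) = 0)
    (hmin : ∀ e g v' (a : Fin r' → F),
      hammingNorm (fun e' : Γ.Star v' => y e (g * (Γ.shift γ v' e')⁻¹) e') ≤
        hammingNorm (fun e' : Γ.Star v' => y e (g * (Γ.shift γ v' e')⁻¹) e' -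
          (a ᵥ* D' v') e') + 2)
    (ha : 2 * (w : ℝ) * ((∑ v, (vertexSupport x v).card : ℕ) +
      (∑ e', (edgeSupport y e').card : ℕ)) ≤ a) :
    (∀ v g v', x v g v' = 0) ∧ ∀ e g e', y e g e' = 0 := by
  have hwR : (1 : ℝ) ≤ w := by exact_mod_cast hw0
  set NX := ∑ v, (vertexSupport x v).card with hNX
  set NY := ∑ e', (edgeSupport y e').card with hNY
  have hNX0 : (0 : ℝ) ≤ NX := Nat.cast_nonneg _
  have hNY0 : (0 : ℝ) ≤ NY := Nat.cast_nonneg _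
  have hXa : ∀ v, ((vertexSupport x v).card : ℝ) ≤ a := fun v => by
    have h3 : (vertexSupport x v).card ≤ NX :=
      Finset.single_le_sum (f := fun v => (vertexSupport x v).card) (fun _ _ => Nat.zero_le _)
        (Finset.mem_univ v)
    have h4 : ((vertexSupport x v).card : ℝ) ≤ NX := by exact_mod_cast h3
    nlinarith
  have hYa : ∀ e', 2 * ((edgeSupport y e').card : ℝ) ≤ a := fun e' => by
    have h3 : (edgeSupport y e').card ≤ NY :=
      Finset.single_le_sum (f := fun v => (edgeSupport y v).card) (fun _ _ => Nat.zero_le _)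
        (Finset.mem_univ e')
    have h4 : ((edgeSupport y e').card : ℝ) ≤ NY := by exact_mod_cast h3
    nlinarith
  -- the number of neighbours of `(v, g, e')` in the support of `x`
  let N : E → V × G → ℕ := fun e' p => (Finset.univ.filter fun v' => Γ.Inc e' v' ∧
        x p.1 (p.2 * Γ.shift γ v' e') v' ≠ 0).card
  -- Off `T e'` the equation at (v, g, e') has no contribution from `x`, so the values of `y` there
  -- form a codeword of ker (D v).
  let T : E → Finset (V × G) := fun e' => Finset.univ.filter fun p => N e' p ≠ 0
  have hN2 : ∀ e' p, N e' p ≤ 2 := fun e' p =>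
    (Finset.card_le_card fun v' hv' => by
      simp only [Finset.mem_filter, Finset.mem_univ, true_and] at hv' ⊢
      exact hv'.1).trans (Γ.card_filter_inc_le e')
  have hT : ∀ e', ((∑ p ∈ T e', Γ.colWeight γ y p.1 p.2 e' : ℕ) : ℝ) ≤ 2 * lam * (T e').card ∧
      (T e' = ∅ → edgeSupport y e' = ∅) := by
    intro e'
    have := hexp.sum_card_le_of_forall hlam (edgeSupport y e') (T e') (hYa e') (4 * m + 3)
      (by push_cast; linarith) (by
        rintro ⟨v, g⟩ hp
        rw [card_filter_edgeSupport hΓ]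
        have hx0 : ∀ v', Γ.Inc e' v' → x v (g * Γ.shift γ v' e') v' = 0 := by
          intro v' hinc
          by_contra hne
          refine hp (Finset.mem_filter.2 ⟨Finset.mem_univ _, Finset.card_ne_zero_of_mem
            (Finset.mem_filter.2 ⟨Finset.mem_univ v', hinc, hne⟩)⟩)
        by_cases h0 : (fun e : Γ.Star v => y e (Γ.shift γ v e * g) e') = 0
        · left
          have h3 : ∀ e : Γ.Star v, y e (Γ.shift γ v e * g) e' = 0 := fun e => congrFun h0 e
          simp [colWeight, h3]
        · right
          refine (hrob v v).dist_ker _ h0 ?_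
          funext k
          have h3 := hcyc v g e' k
          rw [Finset.sum_eq_zero (s := Finset.univ) (f := fun v' => if h : Γ.Inc e' v' then
              ∑ l, D' v' l ⟨e', h⟩ * x v (g * Γ.shift γ v' e') v' k l else 0), add_zero] at h3
          · exact h3
          · intro v' _
            split_ifs with hinc
            · simp [hx0 v' hinc]
            · rfl)
    refine ⟨?_, this.2⟩
    refine le_trans (le_of_eq ?_) this.1
    congr 1
    exact Finset.sum_congr rfl fun p _ => (card_filter_edgeSupport hΓ y e' p.1 p.2).symm
  -- Every cell in the support of `x` is adjacent to exactly w cells (v, g, e').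
  have hTX : ∑ e', (T e').card ≤ w * NX := by
    have h3 := sum_vertexSupport_sum (Γ := Γ) (γ := γ) x fun _ _ _ => 1
    simp only [Finset.sum_const, Finset.card_univ, smul_eq_mul, mul_one, hw] at h3
    rw [← Finset.sum_mul, mul_comm] at h3
    rw [h3]
    refine Finset.sum_le_sum fun e' _ => ?_
    rw [Finset.card_eq_sum_ones]
    refine (Finset.sum_le_sum fun p hp => ?_).trans
      (Finset.sum_le_sum_of_subset (Finset.subset_univ (T e')))
    exact Nat.one_le_iff_ne_zero.2 (Finset.mem_filter.1 hp).2
  -- A column (v, g, e') occurs in the local matrix of at most two cells of the support, one for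
  -- each end of e', and only if it belongs to `T e'`. This gives the factor 2 · 2λ · w.
  have hMX : ((∑ v, ∑ p ∈ vertexSupport x v, ∑ e' : Γ.Star p.1,
      Γ.colWeight γ y v (p.2⁻¹ * (Γ.shift γ p.1 e')⁻¹) e' : ℕ) : ℝ) ≤ 4 * lam * w * NX := by
    rw [sum_vertexSupport_sum x fun v g e' => Γ.colWeight γ y v g e']
    have h3 : ∀ e', ∑ p : V × G, N e' p * Γ.colWeight γ y p.1 p.2 e' ≤
        2 * ∑ p ∈ T e', Γ.colWeight γ y p.1 p.2 e' := by
      intro e'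
      rw [Finset.mul_sum, Finset.sum_filter]
      refine Finset.sum_le_sum fun p _ => ?_
      split_ifs with hp
      · exact Nat.mul_le_mul_right _ (hN2 e' p)
      · rw [not_not] at hp
        simp [hp]
    calc _ ≤ ((∑ e', 2 * ∑ p ∈ T e', Γ.colWeight γ y p.1 p.2 e' : ℕ) : ℝ) :=
          Nat.cast_le.2 (Finset.sum_le_sum fun e' _ => h3 e')
      _ = ∑ e', 2 * ((∑ p ∈ T e', Γ.colWeight γ y p.1 p.2 e' : ℕ) : ℝ) := by push_cast; rfl
      _ ≤ ∑ e', 2 * (2 * lam * (T e').card) :=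
          Finset.sum_le_sum fun e' _ => mul_le_mul_of_nonneg_left (hT e').1 (by norm_num)
      _ = 4 * lam * ((∑ e', (T e').card : ℕ) : ℝ) := by
          push_cast
          rw [Finset.mul_sum]
          exact Finset.sum_congr rfl fun e' _ => by ring
      _ ≤ 4 * lam * ((w * NX : ℕ) : ℝ) :=
          mul_le_mul_of_nonneg_left (Nat.cast_le.2 hTX) (by linarith)
      _ = _ := by
          push_cast
          ring
  have hnX : ((∑ v, ∑ p ∈ vertexSupport x v, Γ.neighbourCount γ x v p.2⁻¹ p.1 : ℕ) : ℝ) ≤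
      lam * NX := by
    rw [hNX]
    push_cast
    rw [Finset.mul_sum]
    refine Finset.sum_le_sum fun v _ => ?_
    have := sum_neighbourCount_le hΓ hexp x v (hXa v)
    push_cast at this
    exact this
  have hXempty : ∀ v, vertexSupport x v = ∅ := by
    by_contra hne
    push Not at hne
    obtain ⟨v₀, hv₀⟩ := hne
    have hlow : ∀ v, ∀ p ∈ vertexSupport x v, 8 * lam * w <
        4 * w * (Γ.neighbourCount γ x v p.2⁻¹ p.1 : ℝ) +
        (∑ e' : Γ.Star p.1, Γ.colWeight γ y v (p.2⁻¹ * (Γ.shift γ p.1 e')⁻¹) e' : ℕ) :=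
      fun v p hp => lt_neighbourCount_add hw0 hrob h₁ h₂ hcyc hmin v p.2⁻¹ p.1
        (Finset.mem_filter.1 hp).2
    have h3 : ∑ v, ∑ p ∈ vertexSupport x v, 8 * lam * w <
        ∑ v, ∑ p ∈ vertexSupport x v, (4 * w * (Γ.neighbourCount γ x v p.2⁻¹ p.1 : ℝ) +
        (∑ e' : Γ.Star p.1, Γ.colWeight γ y v (p.2⁻¹ * (Γ.shift γ p.1 e')⁻¹) e' : ℕ)) := by
      refine Finset.sum_lt_sum (fun v _ => Finset.sum_le_sum fun p hp => (hlow v p hp).le)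
        ⟨v₀, Finset.mem_univ _, Finset.sum_lt_sum_of_nonempty ?_ fun p hp => hlow v₀ p hp⟩
      exact hv₀
    have h4 : ∑ v, ∑ p ∈ vertexSupport x v, 8 * lam * w = 8 * lam * w * (NX : ℝ) := by
      rw [hNX]
      push_cast
      rw [Finset.mul_sum]
      refine Finset.sum_congr rfl fun v _ => ?_
      rw [Finset.sum_const, nsmul_eq_mul, mul_comm]
    have h5 : ∑ v, ∑ p ∈ vertexSupport x v, (4 * w * (Γ.neighbourCount γ x v p.2⁻¹ p.1 : ℝ) +
        (∑ e' : Γ.Star p.1, Γ.colWeight γ y v (p.2⁻¹ * (Γ.shift γ p.1 e')⁻¹) e' : ℕ)) =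
        4 * w * ((∑ v, ∑ p ∈ vertexSupport x v, Γ.neighbourCount γ x v p.2⁻¹ p.1 : ℕ) : ℝ) +
        ((∑ v, ∑ p ∈ vertexSupport x v, ∑ e' : Γ.Star p.1,
          Γ.colWeight γ y v (p.2⁻¹ * (Γ.shift γ p.1 e')⁻¹) e' : ℕ) : ℝ) := by
      push_cast
      simp only [Finset.sum_add_distrib, Finset.mul_sum]
    -- Both terms on the right are at most 4λw · NX, which contradicts the strict inequality.
    rw [h4, h5] at h3
    have h6 : 4 * (w : ℝ) * ((∑ v, ∑ p ∈ vertexSupport x v,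
        Γ.neighbourCount γ x v p.2⁻¹ p.1 : ℕ) : ℝ) ≤ 4 * w * (lam * NX) :=
      mul_le_mul_of_nonneg_left hnX (by positivity)
    linarith
  have hx0 : ∀ v g v', x v g v' = 0 := by
    intro v g v'
    by_contra hne
    have : (v', g⁻¹) ∈ vertexSupport x v := by simpa [vertexSupport] using hne
    simp [hXempty v] at this
  refine ⟨hx0, fun e g e' => ?_⟩
  have hTe : T e' = ∅ := by simp [T, N, hx0]
  by_contra hne
  have : (e, g) ∈ edgeSupport y e' := by simpa [edgeSupport] using hne
  simp [(hT e').2 hTe] at this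

end Cycles

end OrientedGraph

/-! ### From chains of the lifted product to the pair (x, y). -/

namespace OrientedGraph

section Bridge

open Matrix
open Classical

variable {F : Type*} [Field F] {V E G : Type*} {r r' w m : ℕ}

/-- Chains of degree 1 in the lifted product of two Tanner complexes. -/
abbrev TannerChain (F G V E : Type*) (r r' : ℕ) : Type _ :=
  LocalChain F (Sum.elim (fun _ : E × G × E => Unit × Unit) (fun _ : V × G × V => Fin r × Fin r'))

/-- The coefficients at the cells `(v, g, v')`. -/
def TannerChain.vertexPart (c : TannerChain F G V E r r') (v : V) (g : G) (v' : V) :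
    Matrix (Fin r) (Fin r') F := fun k l => c (Sum.inr (v, g, v')) (k, l)

/-- The coefficients at the cells `(e, g, e')`. -/
def TannerChain.edgePart (c : TannerChain F G V E r r') (e : E) (g : G) (e' : E) : F :=
  c (Sum.inl (e, g, e')) ((), ())

theorem TannerChain.inl_eq_zero_iff (c : TannerChain F G V E r r') (e : E) (g : G) (e' : E) :
    c (Sum.inl (e, g, e')) = 0 ↔ c.edgePart e g e' = 0 := by
  constructor
  · intro h
    exact congrFun h ((), ())
  · intro h
    funext ⟨_, _⟩
    exact h

theorem TannerChain.inr_eq_zero_iff (c : TannerChain F G V E r r') (v : V) (g : G) (v' : V) :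
    c (Sum.inr (v, g, v')) = 0 ↔ c.vertexPart v g v' = 0 := by
  constructor
  · intro h
    funext k l
    exact congrFun h (k, l)
  · intro h
    funext ⟨k, l⟩
    exact congrFun (congrFun h k) l

variable [Group G] [Fintype E] {Γ : OrientedGraph V E} {γ : E → G}

/-- A loop of the base can lift to an edge that is not a loop, so it is excluded by counting: it
adds 2 to the degree of the lifted vertices but only one element to the star. -/
theorem src_ne_tgt_of_isRegular (hreg : (Γ.lift γ).IsRegular w)
    (hw : ∀ v, Fintype.card (Γ.Star v) = w) (e : E) : Γ.src e ≠ Γ.tgt e := by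
  intro he
  set v := Γ.src e
  have h1 := hreg (v, 1)
  have hA : {p : E × G | (Γ.lift γ).src p = (v, 1)}.ncard = {e | Γ.src e = v}.ncard := by
    refine Set.ncard_congr (fun p _ => p.1) (fun p hp => (Prod.mk.inj hp).1) ?_ ?_
    · rintro ⟨e, g⟩ ⟨e', g'⟩ hp hp' h
      have h2 : g = 1 := (Prod.mk.inj hp).2
      have h3 : g' = 1 := (Prod.mk.inj hp').2
      exact Prod.ext h (h2.trans h3.symm)
    · intro e he
      exact ⟨(e, 1), Prod.ext he rfl, rfl⟩
  have hB : {p : E × G | (Γ.lift γ).tgt p = (v, 1)}.ncard = {e | Γ.tgt e = v}.ncard := by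
    refine Set.ncard_congr (fun p _ => p.1) (fun p hp => (Prod.mk.inj hp).1) ?_ ?_
    · rintro ⟨e, g⟩ ⟨e', g'⟩ hp hp' h
      have h2 : γ e * g = 1 := (Prod.mk.inj hp).2
      have h3 : γ e' * g' = 1 := (Prod.mk.inj hp').2
      obtain rfl : e = e' := h
      exact Prod.ext rfl (mul_left_cancel (h2.trans h3.symm))
    · intro e he
      exact ⟨(e, (γ e)⁻¹), Prod.ext he (mul_inv_cancel _), rfl⟩
  have hU : ({e | Γ.src e = v} ∪ {e | Γ.tgt e = v}).ncard = w := by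
    rw [← hw v, ← Nat.card_eq_fintype_card, ← Nat.card_coe_set_eq]
    refine Nat.card_congr (Equiv.subtypeEquivRight fun e => ?_)
    simp only [Set.mem_union, Set.mem_ofPred_eq, inc_iff, eq_comm]
  have h2 := Set.ncard_union_add_ncard_inter {e | Γ.src e = v} {e | Γ.tgt e = v}
  rw [degree, hA, hB, ← h2, hU] at h1
  have h3 : ({e | Γ.src e = v} ∩ {e | Γ.tgt e = v}).ncard = 0 := by omega
  rw [Set.ncard_eq_zero] at h3
  have : e ∈ ({e | Γ.src e = v} ∩ {e | Γ.tgt e = v}) := ⟨rfl, he.symm⟩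
  rw [h3] at this
  exact this

variable [Fintype V] [Fintype G] {D : LocalMaps F Γ r} {D' : LocalMaps F Γ r'}

theorem TannerChain.blockWeight_eq (c : TannerChain F G V E r r') :
    blockWeight c = (∑ v, (vertexSupport c.vertexPart v).card) +
      ∑ e', (edgeSupport c.edgePart e').card := by
  have h1 : blockWeight c = (Finset.univ.filter fun z => c z ≠ 0).card := by
    rw [blockWeight, ← Set.ncard_coe_finset]
    simp
  have h2 : ∑ v, (vertexSupport c.vertexPart v).card =
      (Finset.univ.filter fun z : V × G × V => c (Sum.inr z) ≠ 0).card := by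
    simp only [vertexSupport, Finset.card_filter, Fintype.sum_prod_type]
    refine Finset.sum_congr rfl fun v _ => ?_
    rw [Finset.sum_comm]
    refine Fintype.sum_equiv (Equiv.inv G) _ _ fun k => ?_
    simp only [ne_eq, TannerChain.inr_eq_zero_iff, Equiv.inv_apply]
  have h3 : ∑ e', (edgeSupport c.edgePart e').card =
      (Finset.univ.filter fun z : E × G × E => c (Sum.inl z) ≠ 0).card := by
    simp only [edgeSupport, Finset.card_filter, Fintype.sum_prod_type]
    rw [Finset.sum_comm]
    refine Finset.sum_congr rfl fun e _ => ?_
    rw [Finset.sum_comm]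
    simp only [ne_eq, TannerChain.inl_eq_zero_iff]
  rw [h1, h2, h3, Finset.card_filter, Fintype.sum_sum_type, add_comm, Finset.card_filter,
    Finset.card_filter]

theorem TannerChain.cycle_eq (hΓ : ∀ e, Γ.src e ≠ Γ.tgt e) (c : TannerChain F G V E r r')
    (hc : (liftedProduct (liftedTanner D γ) (liftedTanner D' γ).dual).bd₁ c = 0)
    (v : V) (g : G) (e' : E) (k : Fin r) :
    (∑ e : Γ.Star v, D v k e * c.edgePart e (Γ.shift γ v e * g) e') +
      (∑ v', if h : Γ.Inc e' v' then
        ∑ l, D' v' l ⟨e', h⟩ * c.vertexPart v (g * Γ.shift γ v' e') v' k l else 0) = 0 := by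
  let cl : LocalChain F (fun _ : E × G × E => Unit × Unit) := fun z => c (Sum.inl z)
  let cr : LocalChain F (fun _ : V × G × V => Fin r × Fin r') := fun z => c (Sum.inr z)
  have h1 : leftBoundary (liftedTanner D γ) E Unit cl (v, g, e') (k, ()) +
      rightBoundary (liftedTanner D' γ).dual V (Fin r) cr (v, g, e') (k, ()) = 0 :=
    congrFun (congrFun hc (v, g, e')) (k, ())
  rw [leftBoundary_liftedTanner γ hΓ, rightBoundary_liftedTanner γ hΓ] at h1
  exact h1

/-- Apply local minimality to the 2-cell (e, g, v') with coefficient `a`. Its boundary changes the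
row of e at v' by a codeword and otherwise touches only the cells over the two ends of e, which
account for the summand 2. -/
theorem TannerChain.hammingNorm_le (hΓ : ∀ e, Γ.src e ≠ Γ.tgt e) (c : TannerChain F G V E r r')
    (hc : (liftedProduct (liftedTanner D γ) (liftedTanner D' γ).dual).IsLocallyMinimal c)
    (e : E) (g : G) (v' : V) (a : Fin r' → F) :
    hammingNorm (fun e' : Γ.Star v' => c.edgePart e (g * (Γ.shift γ v' e')⁻¹) e') ≤
      hammingNorm (fun e' : Γ.Star v' => c.edgePart e (g * (Γ.shift γ v' e')⁻¹) e' -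
        (a ᵥ* D' v') e') + 2 := by
  set u : LocalChain F (fun _ : E × G × V => Unit × Fin r') :=
    Pi.single (e, g, v') fun q => a q.2 with hu
  have hmin := hc (e, g, v') fun q => a q.2
  have hu0 : ∀ z, z ≠ (e, g, v') → u z = 0 := fun z hz => Pi.single_eq_of_ne hz _
  have hu1 : u (e, g, v') = fun q => a q.2 := Pi.single_eq_same _ _
  obtain ⟨c', hc'⟩ : ∃ c' : TannerChain F G V E r r',
      c' = c + (liftedProduct (liftedTanner D γ) (liftedTanner D' γ).dual).bd₂ u := ⟨_, rfl⟩
  have hmin' : blockWeight c ≤ blockWeight c' := by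
    rw [hc']
    convert hmin
  have hinl : ∀ e₁ g₁ e', c'.edgePart e₁ g₁ e' = c.edgePart e₁ g₁ e' - ∑ v, if h : Γ.Inc e' v then
        ∑ k, D' v k ⟨e', h⟩ * u (e₁, g₁ * Γ.shift γ v e', v) ((), k) else 0 := by
    intro e₁ g₁ e'
    have h1 : c'.edgePart e₁ g₁ e' = c.edgePart e₁ g₁ e' +
        -(rightBoundary (liftedTanner D' γ).dual E Unit u (e₁, g₁, e') ((), ())) := by
      rw [hc']
      rfl
    rw [h1, rightBoundary_liftedTanner γ hΓ, sub_eq_add_neg]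
  have hinr : ∀ v g₁ v₁ k l, c'.vertexPart v g₁ v₁ k l = c.vertexPart v g₁ v₁ k l +
      ∑ e₁ : Γ.Star v, D v k e₁ * u (e₁.1, Γ.shift γ v e₁ * g₁, v₁) ((), l) := by
    intro v g₁ v₁ k l
    have h1 : c'.vertexPart v g₁ v₁ k l = c.vertexPart v g₁ v₁ k l +
        leftBoundary (liftedTanner D γ) V (Fin r') u (v, g₁, v₁) (k, l) := by
      rw [hc']
      rfl
    rw [h1, leftBoundary_liftedTanner γ hΓ]
  let ρ : Γ.Star v' → (E × G × E) ⊕ (V × G × V) :=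
    fun e' => Sum.inl (e, g * (Γ.shift γ v' e')⁻¹, e'.1)
  have hρ : Function.Injective ρ := fun e₁ e₂ h => by
    simp only [ρ, Sum.inl.injEq, Prod.mk.injEq] at h
    exact Subtype.ext h.2.2
  let R : Finset ((E × G × E) ⊕ (V × G × V)) := Finset.univ.image ρ
  -- `R` is the row and `W` the two vertex cells; no other cell becomes non-zero.
  let W : Finset ((E × G × E) ⊕ (V × G × V)) :=
    {Sum.inr (Γ.src e, g, v'), Sum.inr (Γ.tgt e, γ e * g, v')}
  have hsame : ∀ z, z ∉ R → z ∉ W → c z = 0 → c' z = 0 := by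
    rintro (⟨e₁, g₁, e'⟩ | ⟨v, g₁, v₁⟩) hR hW hz
    · rw [TannerChain.inl_eq_zero_iff] at hz ⊢
      rw [hinl, hz, zero_sub, neg_eq_zero]
      refine Finset.sum_eq_zero fun v _ => ?_
      split_ifs with hinc
      · refine Finset.sum_eq_zero fun k _ => ?_
        rw [hu0 _ fun h => ?_, Pi.zero_apply, mul_zero]
        simp only [Prod.mk.injEq] at h
        obtain ⟨rfl, h2, rfl⟩ := h
        refine hR (Finset.mem_image.2 ⟨⟨e', hinc⟩, Finset.mem_univ _, ?_⟩)
        simp only [ρ, ← h2, mul_inv_cancel_right]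
      · rfl
    · rw [TannerChain.inr_eq_zero_iff] at hz ⊢
      funext k l
      rw [hinr, hz, Matrix.zero_apply, zero_add]
      refine Finset.sum_eq_zero fun e₁ _ => ?_
      rw [hu0 _ fun h => ?_, Pi.zero_apply, mul_zero]
      simp only [Prod.mk.injEq] at h
      obtain ⟨h1, h2, rfl⟩ := h
      have h3 := e₁.2
      rw [h1] at h2 h3
      have h4 : g₁ = (Γ.shift γ v e)⁻¹ * g := by rw [← h2, inv_mul_cancel_left]
      refine hW ?_
      rcases Γ.inc_iff.1 h3 with rfl | rfl
      · simp [W, h4, shift]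
      · simp [W, h4, shift, hΓ e]
  have hrow : ∀ d : TannerChain F G V E r r', ((Finset.univ.filter fun z => d z ≠ 0) ∩ R).card =
      hammingNorm (fun e' : Γ.Star v' => d.edgePart e (g * (Γ.shift γ v' e')⁻¹) e') := by
    intro d
    have h1 : (Finset.univ.filter fun z => d z ≠ 0) ∩ R =
        (Finset.univ.filter fun e' : Γ.Star v' =>
          d.edgePart e (g * (Γ.shift γ v' e')⁻¹) e' ≠ 0).image ρ := by
      ext z
      simp only [R, Finset.mem_inter, Finset.mem_filter, Finset.mem_univ, true_and,
        Finset.mem_image]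
      constructor
      · rintro ⟨hz, e', rfl⟩
        exact ⟨e', fun h => hz ((d.inl_eq_zero_iff _ _ _).2 h), rfl⟩
      · rintro ⟨e', h, rfl⟩
        exact ⟨fun hz => h ((d.inl_eq_zero_iff _ _ _).1 hz), e', rfl⟩
    rw [h1, Finset.card_image_of_injective _ hρ]
    rfl
  have hrow' : (fun e' : Γ.Star v' => c'.edgePart e (g * (Γ.shift γ v' e')⁻¹) e') =
      fun e' : Γ.Star v' => c.edgePart e (g * (Γ.shift γ v' e')⁻¹) e' - (a ᵥ* D' v') e' := by
    funext e'
    rw [hinl, Finset.sum_eq_single v']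
    · rw [dif_pos e'.2, inv_mul_cancel_right, hu1]
      congr 1
      simp only [vecMul, dotProduct]
      exact Finset.sum_congr rfl fun k _ => mul_comm _ _
    · intro v _ hv
      split_ifs with hinc
      · refine Finset.sum_eq_zero fun k _ => ?_
        rw [hu0 _ fun h => hv (by simpa using (congrArg (fun z => z.2.2) h)), Pi.zero_apply,
          mul_zero]
      · rfl
    · simp
  have hbw : ∀ d : TannerChain F G V E r r',
      blockWeight d = (Finset.univ.filter fun z => d z ≠ 0).card := fun d => by
    rw [blockWeight, ← Set.ncard_coe_finset]
    simp
  rw [← hrow', ← hrow, ← hrow]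
  rw [hbw, hbw] at hmin'
  set A₀ := Finset.univ.filter fun z => c z ≠ 0
  set A₁ := Finset.univ.filter fun z => c' z ≠ 0
  have h1 : A₁ ⊆ (A₀ \ R) ∪ ((A₁ ∩ R) ∪ W) := by
    intro z hz
    by_contra hnot
    simp only [Finset.mem_union, Finset.mem_sdiff, Finset.mem_inter, hz, true_and, not_or,
      not_and, not_not] at hnot
    obtain ⟨n1, n2, n3⟩ := hnot
    refine (Finset.mem_filter.1 hz).2 (hsame z n2 n3 ?_)
    by_contra hne
    exact n2 (n1 (Finset.mem_filter.2 ⟨Finset.mem_univ _, hne⟩))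
  have h2 := (Finset.card_le_card h1).trans ((Finset.card_union_le _ _).trans
    (Nat.add_le_add_left (Finset.card_union_le _ _) _))
  have h3 : W.card ≤ 2 := Finset.card_le_two
  have h4 := Finset.card_sdiff_add_card_inter A₀ R
  omega

theorem le_locallyMinimalDistance {a lam : ℝ} (hΓ : ∀ e, Γ.src e ≠ Γ.tgt e)
    (hexp : (Γ.lift γ).IsEdgeExpanding a lam)
    (hw0 : 0 < w) (hw : ∀ v, Fintype.card (Γ.Star v) = w)
    (hrob : ∀ v v', IsRobustPair m (D v) (D' v'))
    (hlam : 0 < lam) (h₁ : 4 * lam ≤ m) (h₂ : 16 * lam * w ≤ m * m) :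
    ENNReal.ofReal (a / (2 * w)) ≤
      ((liftedProduct (liftedTanner D γ) (liftedTanner D' γ).dual).locallyMinimalDistance :
        ℝ≥0∞) := by
  have hwR : (0 : ℝ) < w := by exact_mod_cast hw0
  have key : ((⌈a / (2 * w)⌉₊ : ℕ) : ℕ∞) ≤
      (liftedProduct (liftedTanner D γ) (liftedTanner D' γ).dual).locallyMinimalDistance := by
    refine le_iInf₂ fun c hc => ?_
    obtain ⟨hcyc, hne, hmin⟩ := hc
    rw [Nat.cast_le, Nat.ceil_le]
    by_contra hlt
    push Not at hlt
    let c₁ : TannerChain F G V E r r' := c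
    obtain ⟨hx, hy⟩ := eq_zero_of_cycle (x := c₁.vertexPart) (y := c₁.edgePart) hΓ hexp hw0 hw hrob
      hlam h₁ h₂ (c₁.cycle_eq hΓ hcyc) (c₁.hammingNorm_le hΓ hmin) (by
        rw [lt_div_iff₀ (by positivity)] at hlt
        rw [← Nat.cast_add, ← c₁.blockWeight_eq, mul_comm]
        exact hlt.le)
    refine hne (funext fun z => ?_)
    rcases z with ⟨e, g, e'⟩ | ⟨v, g, v'⟩
    · exact (c₁.inl_eq_zero_iff e g e').2 (hy e g e')
    · exact (c₁.inr_eq_zero_iff v g v').2 (hx v g v')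
  calc ENNReal.ofReal (a / (2 * w)) ≤ ((⌈a / (2 * w)⌉₊ : ℕ) : ℝ≥0∞) := by
        rw [ENNReal.ofReal_le_natCast]
        exact Nat.le_ceil _
    _ = (((⌈a / (2 * w)⌉₊ : ℕ) : ℕ∞) : ℝ≥0∞) := by simp
    _ ≤ _ := ENat.toENNReal_le.2 key

end Bridge

end OrientedGraph

/-! ### Choice of the parameters. -/

section Parameters

/-- Take logarithms. With w = t^10 and log w ≤ 10t the left side is O(t^9), while the right side
grows like t^10. In `ht`, 18 = 8 + 10 covers log 256 and log w, and the last Q covers the rounding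
in `he`. -/
theorem pow_le_pow_of_large {q w m c e : ℕ} {t η Q : ℝ} (hq : 2 ≤ q) (hQ : Real.log q = Q)
    (ht1 : 1 ≤ t) (htw : t ^ 10 = w) (hm : (m : ℝ) ≤ 2 * t ^ 8) (he : η * t ^ 10 / 4 - 1 ≤ e)
    (ht : 18 + 100 * c + 10 * c * Q + Q ≤ η * Q / 4 * t) :
    256 * w * (w * q) ^ (5 * m * c) ≤ q ^ e := by
  have ht0 : 0 < t := by linarith
  have hqR : (0 : ℝ) < q := by exact_mod_cast (by omega : 0 < q)
  have hQ0 : 0 < Q := by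
    rw [← hQ]
    exact Real.log_pos (by exact_mod_cast hq)
  have hwR : (0 : ℝ) < w := by
    rw [← htw]
    positivity
  have hlogw : Real.log w ≤ 10 * t := by
    rw [← htw, Real.log_pow]
    have := Real.log_le_self ht0.le
    push_cast
    linarith
  have hlogw0 : 0 ≤ Real.log w := Real.log_nonneg (by rw [← htw]; exact one_le_pow₀ ht1)
  have h256 : Real.log 256 ≤ 8 := by
    rw [show (256 : ℝ) = 2 ^ 8 by norm_num, Real.log_pow]
    have := Real.log_two_lt_d9
    push_cast
    linarith
  have key : Real.log (256 * w * (w * q) ^ (5 * m * c)) ≤ Real.log ((q : ℝ) ^ e) := by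
    rw [Real.log_mul (by positivity) (by positivity), Real.log_mul (by norm_num) hwR.ne',
      Real.log_pow, Real.log_mul hwR.ne' hqR.ne', Real.log_pow, hQ]
    have hc0 : (0 : ℝ) ≤ c := Nat.cast_nonneg c
    have h1 : ((5 * m * c : ℕ) : ℝ) * (Real.log w + Q) ≤ 10 * t ^ 8 * c * (10 * t + Q) := by
      have h2 : ((5 * m * c : ℕ) : ℝ) ≤ 10 * t ^ 8 * c := by
        push_cast
        have := mul_le_mul_of_nonneg_right hm hc0
        linarith
      exact mul_le_mul h2 (by linarith) (by linarith) (by positivity)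
    have h3 : (η * t ^ 10 / 4 - 1) * Q ≤ e * Q := mul_le_mul_of_nonneg_right he hQ0.le
    have h9 : (18 + 100 * c + 10 * c * Q + Q) * t ^ 9 ≤ η * Q / 4 * t * t ^ 9 :=
      mul_le_mul_of_nonneg_right ht (by positivity)
    have e1 : (1 : ℝ) ≤ t ^ 9 := one_le_pow₀ ht1
    have e2 : t ≤ t ^ 9 := le_self_pow₀ ht1 (by norm_num)
    have e3 : t ^ 8 ≤ t ^ 9 := pow_le_pow_right₀ ht1 (by norm_num)
    have e4 : 10 * (c : ℝ) * Q * t ^ 8 ≤ 10 * c * Q * t ^ 9 :=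
      mul_le_mul_of_nonneg_left e3 (by positivity)
    have e5 : Q * 1 ≤ Q * t ^ 9 := mul_le_mul_of_nonneg_left e1 hQ0.le
    nlinarith
  have h2 := (Real.log_le_log_iff (by positivity) (by positivity)).1 key
  exact_mod_cast h2

theorem floor_div_mem_Ioo {ρ₀ ρ₁ : ℝ} {w : ℕ} (hρ₀ : 0 ≤ ρ₀) (hρ : ρ₀ < ρ₁)
    (hw : 2 / (ρ₁ - ρ₀) < w) :
    ((⌊(ρ₀ + ρ₁) / 2 * w⌋₊ : ℕ) : ℝ) / w ∈ Set.Ioo ρ₀ ρ₁ := by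
  have h0 : 0 < ρ₁ - ρ₀ := by linarith
  have hw0 : (0 : ℝ) < w := lt_trans (by positivity) hw
  rw [div_lt_iff₀ h0] at hw
  have h1 := Nat.floor_le (a := (ρ₀ + ρ₁) / 2 * w) (mul_nonneg (by linarith) hw0.le)
  have h2 := Nat.lt_floor_add_one ((ρ₀ + ρ₁) / 2 * w)
  constructor
  · rw [lt_div_iff₀ hw0]
    nlinarith
  · rw [div_lt_iff₀ hw0]
    nlinarith

theorem exists_parameters {q : ℕ} (hq : 2 ≤ q) {ρ₀ ρ₁ ρ₀' ρ₁' μ : ℝ}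
    (hρ₀ : 0 ≤ ρ₀) (hρ : ρ₀ < ρ₁) (hρ₁ : ρ₁ ≤ 1)
    (hρ₀' : 0 ≤ ρ₀') (hρ' : ρ₀' < ρ₁') (hρ₁' : ρ₁' ≤ 1) :
    ∃ w₀ : ℕ, ∀ w, w₀ ≤ w → ∃ r r' m e c : ℕ,
      (r : ℝ) / w ∈ Set.Ioo ρ₀ ρ₁ ∧ (r' : ℝ) / w ∈ Set.Ioo ρ₀' ρ₁' ∧ 0 < w ∧ 0 < m ∧ 2 ≤ c ∧
      2 * (w / c + 1) + m + e ≤ r ∧ 2 * (w / c + 1) + m + e ≤ r' ∧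
      r + m + e ≤ w ∧ r' + m + e ≤ w ∧ 256 * w * (w * q) ^ (5 * m * c) ≤ q ^ e ∧
      4 * (μ * √w) ≤ m ∧ 16 * (μ * √w) * w ≤ m * m := by
  set ρ := (ρ₀ + ρ₁) / 2 with hρdef
  set ρ' := (ρ₀' + ρ₁') / 2 with hρdef'
  -- η is the room that both target rates leave to 0 and to 1; m, e and w / c are taken as small
  -- fractions of ηw.
  obtain ⟨η, hη0, h1, h2, h3, h4⟩ : ∃ η : ℝ, 0 < η ∧ η ≤ ρ ∧ η ≤ ρ' ∧ ρ + η ≤ 1 ∧ ρ' + η ≤ 1 := by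
    refine ⟨min (min ρ ρ') (min (1 - ρ) (1 - ρ')), ?_, ?_, ?_, ?_, ?_⟩
    · simp only [lt_min_iff]
      refine ⟨⟨?_, ?_⟩, ?_, ?_⟩ <;> linarith
    · exact (min_le_left _ _).trans (min_le_left _ _)
    · exact (min_le_left _ _).trans (min_le_right _ _)
    · have := (min_le_right (min ρ ρ') (min (1 - ρ) (1 - ρ'))).trans (min_le_left _ _)
      linarith
    · have := (min_le_right (min ρ ρ') (min (1 - ρ) (1 - ρ'))).trans (min_le_right _ _)
      linarith
  set Q := Real.log q with hQ
  have hQ0 : 0 < Q := Real.log_pos (by exact_mod_cast hq)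
  set c : ℕ := ⌈16 / η⌉₊ + 2 with hc
  obtain ⟨t₀, h5, h6, h7, h8, h9, h10, h11⟩ : ∃ t₀ : ℝ, 1 ≤ t₀ ∧ 16 * μ ≤ t₀ ∧ 16 / η ≤ t₀ ∧
      2 / (ρ₁ - ρ₀) + 1 ≤ t₀ ∧ 2 / (ρ₁' - ρ₀') + 1 ≤ t₀ ∧
      (18 + 100 * c + 10 * c * Q + Q) / (η * Q / 4) ≤ t₀ ∧ 6 / η ≤ t₀ := by
    have := (Filter.eventually_ge_atTop (1 : ℝ)).and ((Filter.eventually_ge_atTop (16 * μ)).and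
      ((Filter.eventually_ge_atTop (16 / η)).and
      ((Filter.eventually_ge_atTop (2 / (ρ₁ - ρ₀) + 1)).and
      ((Filter.eventually_ge_atTop (2 / (ρ₁' - ρ₀') + 1)).and
      ((Filter.eventually_ge_atTop ((18 + 100 * c + 10 * c * Q + Q) / (η * Q / 4))).and
      (Filter.eventually_ge_atTop (6 / η)))))))
    exact this.exists
  refine ⟨⌈t₀ ^ 10⌉₊, fun w hw => ?_⟩
  have hw' : t₀ ^ 10 ≤ w := Nat.ceil_le.1 hw
  -- With w = t^10, m = ⌈t^8⌉ exceeds the order t^(15/2) = w^(3/4) demanded by m² ≥ 16μ w^(3/2), and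
  -- m log w is still negligible against w.
  obtain ⟨t, htw, htt⟩ : ∃ t : ℝ, t ^ 10 = w ∧ t₀ ≤ t := by
    refine ⟨(w : ℝ) ^ ((10 : ℕ) : ℝ)⁻¹, Real.rpow_inv_natCast_pow (Nat.cast_nonneg w) (by norm_num),
      ?_⟩
    have : t₀ = (t₀ ^ 10) ^ ((10 : ℕ) : ℝ)⁻¹ :=
      (Real.pow_rpow_inv_natCast (by linarith) (by norm_num)).symm
    rw [this]
    exact Real.rpow_le_rpow (by positivity) hw' (by positivity)
  have ht1 : 1 ≤ t := h5.trans htt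
  have ht0 : 0 < t := by linarith
  have htw' : t ≤ w := htw ▸ le_self_pow₀ ht1 (by norm_num)
  have hw0 : 0 < w := by
    have : (0 : ℝ) < w := by linarith
    exact_mod_cast this
  have hsqrt : √(w : ℝ) = t ^ 5 := by
    rw [← htw, show t ^ 10 = (t ^ 5) ^ 2 by ring, Real.sqrt_sq (by positivity)]
  have hm1 : t ^ 8 ≤ (⌈t ^ 8⌉₊ : ℕ) := Nat.le_ceil _
  have hm2 : ((⌈t ^ 8⌉₊ : ℕ) : ℝ) ≤ 2 * t ^ 8 := by
    have := Nat.ceil_lt_add_one (a := t ^ 8) (by positivity)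
    have h12 : 1 ≤ t ^ 8 := one_le_pow₀ ht1
    linarith
  have hηt : 16 ≤ η * t := by
    have := h7.trans htt
    rwa [div_le_iff₀ hη0, mul_comm] at this
  have hm3 : 2 * t ^ 8 ≤ η * w / 8 := by
    rw [← htw]
    have : 16 * 1 ≤ η * t * t := mul_le_mul hηt ht1 (by norm_num) (by positivity)
    nlinarith [pow_pos ht0 8]
  have he1 : ((⌊η * w / 4⌋₊ : ℕ) : ℝ) ≤ η * w / 4 := Nat.floor_le (by positivity)
  have he2 := Nat.lt_floor_add_one (η * w / 4)
  have hwc : ((w / c : ℕ) : ℝ) ≤ η * w / 16 := by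
    have hcR : 16 / η ≤ c := by
      have := Nat.le_ceil (16 / η)
      rw [hc]
      push_cast
      linarith
    refine Nat.cast_div_le.trans ?_
    rw [div_le_iff₀ (lt_of_lt_of_le (by positivity) hcR)]
    rw [div_le_iff₀ hη0] at hcR
    nlinarith [(Nat.cast_nonneg w : (0 : ℝ) ≤ w)]
  have hw6 : 6 ≤ η * w := by
    have := (h11.trans htt).trans htw'
    rwa [div_le_iff₀ hη0, mul_comm] at this
  have hwR : (0 : ℝ) < w := by exact_mod_cast hw0
  have hr : ∀ s : ℝ, η ≤ s → 2 * (w / c + 1) + ⌈t ^ 8⌉₊ + ⌊η * w / 4⌋₊ ≤ ⌊s * w⌋₊ := by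
    intro s hs
    refine Nat.le_floor ?_
    push_cast
    have : η * w ≤ s * w := mul_le_mul_of_nonneg_right hs hwR.le
    linarith
  have hr' : ∀ s : ℝ, 0 ≤ s → s + η ≤ 1 → ⌊s * w⌋₊ + ⌈t ^ 8⌉₊ + ⌊η * w / 4⌋₊ ≤ w := by
    intro s hs0 hs
    have h12 : ((⌊s * w⌋₊ : ℕ) : ℝ) ≤ s * w := Nat.floor_le (by positivity)
    have h13 : (s + η) * w ≤ 1 * w := mul_le_mul_of_nonneg_right hs hwR.le
    have : ((⌊s * w⌋₊ + ⌈t ^ 8⌉₊ + ⌊η * w / 4⌋₊ : ℕ) : ℝ) ≤ w := by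
      push_cast
      linarith
    exact_mod_cast this
  refine ⟨⌊ρ * w⌋₊, ⌊ρ' * w⌋₊, ⌈t ^ 8⌉₊, ⌊η * w / 4⌋₊, c, floor_div_mem_Ioo hρ₀ hρ (by linarith),
    floor_div_mem_Ioo hρ₀' hρ' (by linarith), hw0, Nat.ceil_pos.2 (by positivity), by omega,
    hr ρ h1, hr ρ' h2, hr' ρ (by linarith) h3, hr' ρ' (by linarith) h4, ?_, ?_, ?_⟩
  · refine pow_le_pow_of_large (t := t) (η := η) (Q := Q) hq hQ.symm ht1 htw hm2 ?_ ?_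
    · rw [htw]
      linarith
    · have := h10.trans htt
      rw [div_le_iff₀ (by positivity)] at this
      linarith
  · rw [hsqrt]
    have h12 : 16 * μ * t ^ 5 ≤ t * t ^ 5 :=
      mul_le_mul_of_nonneg_right (h6.trans htt) (by positivity)
    have h13 : t * t ^ 5 ≤ t ^ 8 := by
      rw [← pow_succ']
      exact pow_le_pow_right₀ ht1 (by norm_num)
    have h14 : (0 : ℝ) < t ^ 8 := by positivity
    nlinarith
  · rw [hsqrt, ← htw]
    have h12 : 16 * μ * t ^ 15 ≤ t * t ^ 15 :=
      mul_le_mul_of_nonneg_right (h6.trans htt) (by positivity)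
    have h13 : t ^ 8 * t ^ 8 ≤ ((⌈t ^ 8⌉₊ : ℕ) : ℝ) * (⌈t ^ 8⌉₊ : ℕ) :=
      mul_le_mul hm1 hm1 (by positivity) (by positivity)
    calc 16 * (μ * t ^ 5) * t ^ 10 = 16 * μ * t ^ 15 := by ring
      _ ≤ t * t ^ 15 := h12
      _ = t ^ 8 * t ^ 8 := by ring
      _ ≤ _ := h13

end Parameters

theorem mainTheorem3 {F : Type*} [Field F] [Fintype F]
    (ρ₀ ρ₁ ρ₀' ρ₁' : ℝ) (hρ₀ : 0 ≤ ρ₀) (hρ : ρ₀ < ρ₁) (hρ₁ : ρ₁ ≤ 1)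
    (hρ₀' : 0 ≤ ρ₀') (hρ' : ρ₀' < ρ₁') (hρ₁' : ρ₁' ≤ 1)
    (μ : ℝ) (hμ : 0 < μ) (W : Set ℕ) (hW : W.Infinite) :
    ∃ w₀ : ℕ, ∀ w ∈ W, w₀ ≤ w →
      ∃ (r r' : ℕ) (h : Matrix (Fin r) (Fin w) F) (h' : Matrix (Fin r') (Fin w) F),
        (r : ℝ) / w ∈ Set.Ioo ρ₀ ρ₁ ∧ (r' : ℝ) / w ∈ Set.Ioo ρ₀' ρ₁' ∧
        ∀ {G V E : Type*} [Group G] [Fintype G] [Fintype V] [Fintype E]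
          (Γ : OrientedGraph V E) (γ : E → G) (a : ℝ),
          (Γ.lift γ).IsRegular w → (Γ.lift γ).IsSimple →
          (Γ.lift γ).IsEdgeExpanding a (μ * √(w : ℝ)) →
          ∀ A ∈ liftedTannerCodes Γ γ h, ∀ B ∈ liftedTannerCodes Γ γ h',
            ENNReal.ofReal (a / (2 * w)) ≤
              ((liftedProduct A B.dual).locallyMinimalDistance : ℝ≥0∞) ∧
            ENNReal.ofReal (a / (2 * w)) ≤
              ((liftedProduct B A.dual).locallyMinimalDistance : ℝ≥0∞) := by
  classical
  obtain ⟨w₀, hw₀⟩ := exists_parameters (q := Fintype.card F) (μ := μ) Fintype.one_lt_card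
    hρ₀ hρ hρ₁ hρ₀' hρ' hρ₁'
  refine ⟨w₀, fun w _ hw => ?_⟩
  obtain ⟨r, r', m, e, c, hr, hr', hw0, hm, hc, h₁, h₂, h₃, h₄, hq, h₅, h₆⟩ := hw₀ w hw
  obtain ⟨h, h', hrob, hrob'⟩ := exists_isRobustPair (F := F) hw0 (by omega) (by omega) hm hc
    h₁ h₂ h₃ h₄ hq
  refine ⟨r, r', h, h', hr, hr', ?_⟩
  intro G V E _ _ _ _ Γ γ a hreg _ hexp A hA B hB
  obtain ⟨D, hD, rfl⟩ := hA
  obtain ⟨D', hD', rfl⟩ := hB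
  -- The permutation of columns in `MatrixEquivalent` is a bijection of the star with `Fin w`.
  have hcard : ∀ v, Fintype.card (Γ.Star v) = w := fun v => by
    obtain ⟨_, τ, _⟩ := hD v
    rw [Fintype.card_congr τ, Fintype.card_fin]
  have hΓ := OrientedGraph.src_ne_tgt_of_isRegular hreg hcard
  have hlam : 0 < μ * √(w : ℝ) := by
    have : (0 : ℝ) < w := by exact_mod_cast hw0
    positivity
  refine ⟨OrientedGraph.le_locallyMinimalDistance hΓ hexp hw0 hcard (fun v v' => ?_) hlam h₅ h₆,
    OrientedGraph.le_locallyMinimalDistance hΓ hexp hw0 hcard (fun v v' => ?_) hlam h₅ h₆⟩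
  · obtain ⟨σ, τ, hσ⟩ := hD v
    obtain ⟨σ', τ', hσ'⟩ := hD' v'
    rw [hσ, hσ']
    exact hrob.submatrix σ τ σ' τ'
  · obtain ⟨σ, τ, hσ⟩ := hD' v
    obtain ⟨σ', τ', hσ'⟩ := hD v'
    rw [hσ, hσ']
    exact hrob'.submatrix σ τ σ' τ'
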